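/- **Setting.** Let $\Omega\subset\mathbb C^n$ ($n\ge1$) be a bounded domain with smooth boundary $\mathbf b\Omega$ and smooth defining function $\rho$ ($\Omega=\{\rho<0\}$, $d\rho\ne0$ on $\mathbf b\Omega$), equipped with non-isotropic polydiscs of the kind McNeal constructed on simple domains (finite type in $\mathbb C^2$, strictly pseudoconvex, convex of finite type, decoupled of finite type). That is: with constants uniform in $q\in\mathbf b\Omega$, there are holomorphic, bi-Lipschitz coordinates $z=(z_1,\dots,z_n)$ centered at $q$ on a fixed-size Euclidean ball around $q$, and quantities $\tau_j(q,\delta)$ ($0<\delta<\delta_0$), nondecreasing in $\delta$, with $\tau_1(q,\delta)=\delta$, $\delta^{1/2}\lesssim\tau_j(q,\delta)\lesssim\delta^{1/m}$ for $j\ge2$, and $\tau_j(q,2\delta)\lesssim\tau_j(q,\delta)$, such that the polydisc $D(q,\delta)=\{|z_j|<\tau_j(q,\delta),\ j=1,\dots,n\}$ lies in the coordinate patch and $|\rho-\rho(q)|\lesssim\delta$ on it. Let $\mathsf d$ be a quasi-metric on $\mathbf b\Omega$ whose balls $B(q,\delta)$ are, for small $\delta$, comparable with $D(q,\delta)\cap\mathbf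 b\Omega$ (for some $a\ge 1$, $D(q,\delta)\cap\mathbf b\Omega\subseteq B(q,a\delta)$ and $B(q,\delta)\subseteq D(q,a\delta)$). Let $\pi$ be the nearest-point projection to $\mathbf b\Omega$, and $\epsilon_0>0$ sufficiently small (depending on the setting). Put $B^\#(z,t)=\{w\in\Omega:\pi(w)\in B(z,t),\ |\pi(w)-w|<t\}$ and $\mathscr B=\{B^\#(z,t):z\in\mathbf b\Omega,\ 0<t\le\epsilon_0\}\cup\{\Omega\}$. A *dyadic system* $\mathcal Q=\{Q^k_j\}_{k\ge0}$ with parameters $s>1$, $\delta>0$ and points $p^{(k)}_j\in Q^k_j$ consists of Borel subsets of $\mathbf b\Omega$ such that: for each $k$ the $p^{(k)}_j$ are a maximal set in $\mathbf b\Omega$ with mutual $\mathsf d$-distances $>s^{-k}\delta$; for each $k$ the $Q^k_j$ partition $\mathbf b\Omega$; for $k<l$ either $Q^l_i\subseteq Q^k_j$ or $Q^l_i\cap Q^k_j=\emptyset$; for constants $c,C>0$, $B(p^{(k)}_j,cs^{-k}\delta)\subseteq Q^k_j\subseteq B(p^{(k)}_j,Cs^{-k}\delta)$; and each $Q^k_j$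 contains a bounded number of $Q^{k+1}_i$. Given a height $0<h<\epsilon_0$ (the standard choice is $h=\delta$), the dyadic tents are $\hat K^k_j=\{z\in\Omega:\pi(z)\in Q^k_j,\ |\pi(z)-z|<s^{-k}h\}$ and, as the tent of generation $-1$, $\hat K^{-1}=\Omega$. The kubes are $K^k_j=\hat K^k_j\setminus\bigcup\{\hat K^{k+1}_l: p^{(k+1)}_l\in Q^k_j\}$ and $K^{-1}=\Omega\setminus\bigcup_j\hat K^0_j$. Fix finitely many such systems and heights, with tent collections $\mathcal T_1,\dots,\mathcal T_N$, and let $\mathscr T=\mathcal T_1\cup\dots\cup\mathcal T_N\cup\{\Omega\}$. Let $W$ be a $d\times d$ matrix weight ($d\ge1$) on $\Omega$: measurable, a.e. positive definite, with $W$ and $W^{-1}$ integrable. Write $\langle W\rangle_B=|B|^{-1}\int_BW\,dV$, and let $$\mathcal B_2(W)=\sup_{B\in\mathscr S}\big\|\langle W\rangle_B^{1/2}\langle W^{-1}\rangle_B^{1/2}\big\|^2,$$ where $\mathscr S$ is either one of $\mathscr B$ and $\mathscr T$, and $\|\cdot\|$ is the operator norm on $\mathbb C^d$. For $\mathcal T=\mathcal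 T_l$ put $\mathcal W(z)=\sum_{K}\langle W\rangle_K1_K(z)$, the sum being over the kubes of $\mathcal T$. For a tent $\hat K\in\mathcal T$ and a unit vector $v\in\mathbb C^d$ put $$\omega(v;z)=\big\langle\langle\mathcal W^{-1}\rangle_{\hat K}^{1/2}\,\mathcal W(z)\,\langle\mathcal W^{-1}\rangle_{\hat K}^{1/2}v,v\big\rangle .$$ **Lemma 4.3.** There is a constant $C>0$, independent of $W$, such that for every matrix weight $W$ with $\mathcal B_2(W)<\infty$ there is $r>1$ with $$C^{-1}\mathcal B_2(W)^{-1}\le r-1\le C\,\mathcal B_2(W)^{-1}$$ such that for every $l$, every tent $\hat K\in\mathcal T_l$ and every unit vector $v\in\mathbb C^d$, $\omega(v;\cdot)^r$ is integrable on $\hat K$ and $$\Big(\frac1{|\hat K|}\int_{\hat K}\omega(v;z)^r\,dV(z)\Big)^{1/r}\le \frac{C}{|\hat K|}\int_{\hat K}\omega(v;z)\,dV(z).$$ -/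

import Mathlib

open MeasureTheory Set
open scoped ENNReal ContDiff Matrix.Norms.L2Operator MatrixOrder ComplexOrder

noncomputable section

namespace BekolleBonami

/-- `ℂⁿ` with its Euclidean norm; `volume` on it is Lebesgue measure. -/
abbrev Cn (n : ℕ) : Type := EuclideanSpace ℂ (Fin n)

/-! ### The domain -/

/-- `Ω` is a bounded domain with smooth boundary, and `ρ` is a defining function of `Ω`. -/
structure IsSmoothBoundedDomain {n : ℕ} (Ω : Set (Cn n)) (ρ : Cn n → ℝ) : Prop where
  connected : IsConnected Ω
  bounded : Bornology.IsBounded Ω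
  smooth : ContDiff ℝ ∞ ρ
  eq_sublevel : Ω = {z | ρ z < 0}
  fderiv_ne_zero : ∀ p ∈ frontier Ω, fderiv ℝ ρ p ≠ 0

/-- The nearest-point map `π` onto the boundary of `Ω`. Wherever the nearest boundary point is
unique, this is that point. -/
def proj {n : ℕ} (Ω : Set (Cn n)) (z : Cn n) : Cn n :=
  open Classical in
  if h : ∃ p ∈ frontier Ω, dist z p = Metric.infDist z (frontier Ω) then h.choose else z

/-! ### Non-isotropic polydiscs and the boundary quasi-metric -/

/-- A system of non-isotropic polydiscs along the boundary of `Ω`: for every boundary point `q` a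
holomorphic coordinate system `coord q` on the Euclidean ball `ball q R`, centered at `q`, and
radii `τ q δ j` (`0 < δ < δ₀`, `j : Fin n`; the index `0` is the first coordinate), with constants
`R, L, A, δ₀, m` that are uniform in `q`. -/
structure PolydiscSystem {n : ℕ} [NeZero n] (Ω : Set (Cn n)) (ρ : Cn n → ℝ) where
  /-- The coordinates `(z_1, …, z_n)` centered at a boundary point. -/
  coord : Cn n → Cn n → Cn n
  /-- The quantities `τ_j(q, δ)`. -/
  τ : Cn n → ℝ → Fin n → ℝ
  R : ℝ
  δ₀ : ℝ
  L : ℝ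
  A : ℝ
  m : ℕ
  R_pos : 0 < R
  δ₀_pos : 0 < δ₀
  m_pos : 0 < m
  coord_self : ∀ q ∈ frontier Ω, coord q q = 0
  coord_holomorphic : ∀ q ∈ frontier Ω, DifferentiableOn ℂ (coord q) (Metric.ball q R)
  coord_bilipschitz : ∀ q ∈ frontier Ω, ∀ x ∈ Metric.ball q R, ∀ y ∈ Metric.ball q R,
    ‖coord q x - coord q y‖ ≤ L * ‖x - y‖ ∧ ‖x - y‖ ≤ L * ‖coord q x - coord q y‖
  τ_first : ∀ q ∈ frontier Ω, ∀ δ ∈ Ioo 0 δ₀, τ q δ 0 = δ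
  τ_lower : ∀ q ∈ frontier Ω, ∀ δ ∈ Ioo 0 δ₀, ∀ j, j ≠ 0 → δ ^ (1 / 2 : ℝ) ≤ A * τ q δ j
  τ_upper : ∀ q ∈ frontier Ω, ∀ δ ∈ Ioo 0 δ₀, ∀ j, j ≠ 0 → τ q δ j ≤ A * δ ^ (1 / m : ℝ)
  /-- The polydiscs increase with `δ`. -/
  τ_mono : ∀ q ∈ frontier Ω, ∀ δ ∈ Ioo 0 δ₀, ∀ δ' ∈ Ioo 0 δ₀, δ ≤ δ' → ∀ j, τ q δ j ≤ τ q δ' j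
  /-- `D(q, 2δ) ⊆ A · D(q, δ)`. -/
  τ_two_mul : ∀ q ∈ frontier Ω, ∀ δ, 0 < δ → 2 * δ < δ₀ → ∀ j, τ q (2 * δ) j ≤ A * τ q δ j
  /-- The polydiscs lie in the range of the coordinates. -/
  polydisc_subset : ∀ q ∈ frontier Ω, ∀ δ ∈ Ioo 0 δ₀,
    {w : Cn n | ∀ j, ‖w j‖ < τ q δ j} ⊆ coord q '' Metric.ball q R
  /-- On `D(q, δ)` the defining function changes by `O(δ)`. -/
  defining_variation : ∀ q ∈ frontier Ω, ∀ δ ∈ Ioo 0 δ₀, ∀ z ∈ Metric.ball q R,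
    (∀ j, ‖coord q z j‖ < τ q δ j) → |ρ z - ρ q| ≤ A * δ

/-- The polydisc `D(q, δ) = {z : |z_j| < τ_j(q, δ), j = 1, …, n}`. -/
def PolydiscSystem.polydisc {n : ℕ} [NeZero n] {Ω : Set (Cn n)} {ρ : Cn n → ℝ}
    (P : PolydiscSystem Ω ρ) (q : Cn n) (δ : ℝ) : Set (Cn n) :=
  {z ∈ Metric.ball q P.R | ∀ j, ‖P.coord q z j‖ < P.τ q δ j}

/-- The ball `B(q, δ) ⊆ bΩ` of a distance function `qd` on the boundary. -/
def bdryBall {n : ℕ} (Ω : Set (Cn n)) (qd : Cn n → Cn n → ℝ) (q : Cn n) (δ : ℝ) : Set (Cn n) :=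
  {x ∈ frontier Ω | qd q x < δ}

/-- `qd` is a quasi-metric on the boundary of `Ω` that is comparable, at small scales, with the one
induced by the polydiscs: its balls are comparable with the sets `D(q, δ) ∩ bΩ`.
(Symmetry is only asked up to a constant.) -/
structure IsBoundaryQuasiMetric {n : ℕ} [NeZero n] {Ω : Set (Cn n)} {ρ : Cn n → ℝ}
    (P : PolydiscSystem Ω ρ) (qd : Cn n → Cn n → ℝ) : Prop where
  nonneg : ∀ x ∈ frontier Ω, ∀ y ∈ frontier Ω, 0 ≤ qd x y
  eq_zero_iff : ∀ x ∈ frontier Ω, ∀ y ∈ frontier Ω, qd x y = 0 ↔ x = y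
  quasi_symm : ∃ κ : ℝ, ∀ x ∈ frontier Ω, ∀ y ∈ frontier Ω, qd x y ≤ κ * qd y x
  quasi_triangle : ∃ κ : ℝ, ∀ x ∈ frontier Ω, ∀ y ∈ frontier Ω, ∀ z ∈ frontier Ω,
    qd x z ≤ κ * (qd x y + qd y z)
  comparable : ∃ a : ℝ, ∃ t₀ : ℝ, 1 ≤ a ∧ 0 < t₀ ∧ a * t₀ < P.δ₀ ∧
    ∀ q ∈ frontier Ω, ∀ t ∈ Ioo 0 t₀,
      P.polydisc q t ∩ frontier Ω ⊆ bdryBall Ω qd q (a * t) ∧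
      bdryBall Ω qd q t ⊆ P.polydisc q (a * t) ∩ frontier Ω

/-! ### Dyadic systems on the boundary, tents and kubes -/

/-- A dyadic system `𝒬 = {Q_j^k}` on the boundary of `Ω`, with parameters `s > 1` and `δ > 0`,
reference points `p_j^{(k)} ∈ Q_j^k`, and generations `k = 0, 1, 2, …`. -/
structure DyadicSystem {n : ℕ} (Ω : Set (Cn n)) (qd : Cn n → Cn n → ℝ) where
  s : ℝ
  δ : ℝ
  one_lt_s : 1 < s
  δ_pos : 0 < δ
  /-- The index set of generation `k`. -/
  ι : ℕ → Type
  pt : ∀ k, ι k → Cn n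
  Q : ∀ k, ι k → Set (Cn n)
  pt_mem : ∀ k j, pt k j ∈ Q k j
  measurable_Q : ∀ k j, MeasurableSet (Q k j)
  /-- The reference points of a generation form a maximal separated set. -/
  separated : ∀ k i j, i ≠ j → (s ^ k)⁻¹ * δ < qd (pt k i) (pt k j)
  maximal : ∀ k, ∀ x ∈ frontier Ω, ∃ j, qd x (pt k j) ≤ (s ^ k)⁻¹ * δ
  iUnion_Q : ∀ k, ⋃ j, Q k j = frontier Ω
  disjoint_Q : ∀ k i j, i ≠ j → Disjoint (Q k i) (Q k j)
  nested : ∀ k l, k < l → ∀ j i, Q l i ⊆ Q k j ∨ Disjoint (Q k j) (Q l i)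
  sandwich : ∃ c C : ℝ, 0 < c ∧ 0 < C ∧ ∀ k j,
    bdryBall Ω qd (pt k j) (c * ((s ^ k)⁻¹ * δ)) ⊆ Q k j ∧
    Q k j ⊆ bdryBall Ω qd (pt k j) (C * ((s ^ k)⁻¹ * δ))
  children : ∃ M : ℕ, ∀ k j, {i | Q (k + 1) i ⊆ Q k j}.encard ≤ M

/-- The part of `Ω` lying over `U ⊆ bΩ` at distance less than `t` from the boundary. -/
def tentOver {n : ℕ} (Ω U : Set (Cn n)) (t : ℝ) : Set (Cn n) :=
  {z ∈ Ω | proj Ω z ∈ U ∧ dist (proj Ω z) z < t}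

namespace DyadicSystem

variable {n : ℕ} {Ω : Set (Cn n)} {qd : Cn n → Cn n → ℝ}

/-- Indices of the tents: `some ⟨k, j⟩` for the tent over `Q_j^k`, and `none` for the root `Ω`. -/
abbrev Idx (S : DyadicSystem Ω qd) : Type := Option (Σ k, S.ι k)

/-- The dyadic tent over `Q_j^k`, of height `h s^{-k}`. -/
def smallTent (S : DyadicSystem Ω qd) (h : ℝ) (k : ℕ) (j : S.ι k) : Set (Cn n) :=
  tentOver Ω (S.Q k j) ((S.s ^ k)⁻¹ * h)

/-- The dyadic tents, the whole domain being the tent of generation `-1`. -/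
def tent (S : DyadicSystem Ω qd) (h : ℝ) : S.Idx → Set (Cn n)
  | none => Ω
  | some ⟨k, j⟩ => S.smallTent h k j

/-- The dyadic kubes: a tent minus the tents of the next generation whose reference point lies in
its base. -/
def kube (S : DyadicSystem Ω qd) (h : ℝ) : S.Idx → Set (Cn n)
  | none => Ω \ ⋃ j, S.smallTent h 0 j
  | some ⟨k, j⟩ =>
      S.smallTent h k j \ ⋃ (l : S.ι (k + 1)) (_ : S.pt (k + 1) l ∈ S.Q k j), S.smallTent h (k + 1) l

end DyadicSystem

/-! ### Matrix weights -/

/-- The entrywise average `⟨W⟩_B = |B|⁻¹ ∫_B W dV`. -/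
def avg {n d : ℕ} (W : Cn n → Matrix (Fin d) (Fin d) ℂ) (B : Set (Cn n)) :
    Matrix (Fin d) (Fin d) ℂ :=
  Matrix.of fun a b => ⨍ z in B, W z a b

/-- A matrix weight on `Ω`: almost everywhere positive definite, with `W` and `W⁻¹` integrable. -/
structure IsMatrixWeight {n d : ℕ} (Ω : Set (Cn n)) (W : Cn n → Matrix (Fin d) (Fin d) ℂ) :
    Prop where
  posDef : ∀ᵐ z ∂(volume.restrict Ω), (W z).PosDef
  integrable : ∀ a b, IntegrableOn (fun z => W z a b) Ω
  integrable_inv : ∀ a b, IntegrableOn (fun z => (W z)⁻¹ a b) Ω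

/-- `sup_{B ∈ 𝓢} ‖⟨W⟩_B^{1/2} ⟨W⁻¹⟩_B^{1/2}‖²`, with the operator norm on `ℂ^d`. -/
def B2 {n d : ℕ} (𝓢 : Set (Set (Cn n))) (W : Cn n → Matrix (Fin d) (Fin d) ℂ) : ℝ≥0∞ :=
  ⨆ B ∈ 𝓢, ENNReal.ofReal
    (‖CFC.sqrt (avg W B) * CFC.sqrt (avg (fun z => (W z)⁻¹) B)‖ ^ 2)

/-- The collection of all tents `B^#(z, r)`, `z ∈ bΩ`, `0 < r ≤ ε₀`, together with `Ω`. -/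
def ballTents {n : ℕ} (Ω : Set (Cn n)) (qd : Cn n → Cn n → ℝ) (ε₀ : ℝ) : Set (Set (Cn n)) :=
  {B | ∃ z ∈ frontier Ω, ∃ r ∈ Ioc 0 ε₀, B = tentOver Ω (bdryBall Ω qd z r) r} ∪ {Ω}

/-- All dyadic tents of a finite family of dyadic systems, together with `Ω`. -/
def dyadicTents {n N : ℕ} {Ω : Set (Cn n)} {qd : Cn n → Cn n → ℝ}
    (𝒬 : Fin N → DyadicSystem Ω qd) (h : Fin N → ℝ) : Set (Set (Cn n)) :=
  {B | ∃ l, ∃ i, B = (𝒬 l).tent (h l) i} ∪ {Ω}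

/-- The step averaging weight `𝒲(z) = ∑ ⟨W⟩_K 1_K(z)`, the sum over all dyadic kubes `K`
(which are pairwise disjoint, so that at most one term is nonzero). -/
def stepWeight {n d : ℕ} {Ω : Set (Cn n)} {qd : Cn n → Cn n → ℝ} (S : DyadicSystem Ω qd) (h : ℝ)
    (W : Cn n → Matrix (Fin d) (Fin d) ℂ) (z : Cn n) : Matrix (Fin d) (Fin d) ℂ :=
  ∑' i : S.Idx, (S.kube h i).indicator (fun _ => avg W (S.kube h i)) z

/-- The scalar step weight `ω(v; z) = ⟨⟨𝒲⁻¹⟩_T^{1/2} 𝒲(z) ⟨𝒲⁻¹⟩_T^{1/2} v, v⟩` of the tent `T` with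
index `i`. -/
def scalarStepWeight {n d : ℕ} {Ω : Set (Cn n)} {qd : Cn n → Cn n → ℝ} (S : DyadicSystem Ω qd)
    (h : ℝ) (W : Cn n → Matrix (Fin d) (Fin d) ℂ) (i : S.Idx) (v : EuclideanSpace ℂ (Fin d))
    (z : Cn n) : ℝ :=
  let H := CFC.sqrt (avg (fun w => (stepWeight S h W w)⁻¹) (S.tent h i))
  (inner ℂ v (Matrix.toEuclideanLin (H * stepWeight S h W z * H) v)).re

end BekolleBonami

end

/-! ### Reverse Hölder inequality on a tree of tents -/

/-! For a fixed tent, the normalising matrix and the unit vector enter only through one vector `u`,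
namely the square root of the average of `𝒲⁻¹` applied to `v`: the scalar weight is `⟨𝒲(z) u, u⟩`.
The inequality is proved for every fixed `u`. On a union of kubes this weight has the same mass as
`⟨W u, u⟩ dV`, so what is known about `W` passes to the step weight without any estimate of `𝒲⁻¹`.

Two facts are needed. The first is an `A₂` comparison (`measure_sq_mul_quad_le`): writing `w(E)` for
the integral of `⟨W u, u⟩` over `E`, every `G ⊆ B` satisfies `|G|² w(B) ≤ b w(G) |B|²`, where `b` is
the matrix `A₂` quantity of `B`. It comes from integrating Cauchy–Schwarz for `W(z)` and `W(z)⁻¹`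
over `G`. The second is geometric (`exists_tentTree`): a kube is a fixed proportion of its tent, and
a tent is a fixed proportion of its parent. Kubes are large because sliding along the normals is a
Lipschitz map from the upper strip of a tent onto its lower strips. Parents are comparable with
their children because ball tents contain, and are contained in, images of comparable polydiscs and
are therefore doubling.

Given these, `reverse_holder` is a Calderón–Zygmund stopping argument. In a tent of average `A`,
stop at the maximal strict descendants of average above `2A`. They fill at most half of the tent, so
by the `A₂` comparison the remaining part carries at least the fraction `1/(4B)` of the mass. On
that part the weight is at most `2A/c`: being constant on kubes, it is bounded on a kube by `1/c`
times the average over the tent of that kube. The stopping tents have average at most `2DA` and are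
treated by induction. The loss factor `(2D)^ε` can be absorbed when `ε` is a small multiple of `1/(B
log(2D))`, and this is where `r - 1 ≈ 1/𝓑₂(W)` comes from. -/

/-- A tree of sets `T i` ("tents") of generation `gen i`, each the disjoint union of "kubes" `K j`
of its descendants; kubes are a fixed proportion `c` of their tents, and tents are a fixed
proportion `D⁻¹` of their parents. -/
structure TentTree {X : Type*} [MeasurableSpace X] (μ : Measure X) {I : Type*}
    (T K : I → Set X) (gen : I → ℕ) (c D : ℝ) : Prop where
  measurableSet_tent : ∀ i, MeasurableSet (T i)
  measurableSet_kube : ∀ i, MeasurableSet (K i)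
  measure_pos : ∀ i, μ (T i) ≠ 0
  measure_ne_top : ∀ i, μ (T i) ≠ ⊤
  kube_subset : ∀ i, K i ⊆ T i
  disjoint_kube : ∀ i j, i ≠ j → Disjoint (K i) (K j)
  cover : ∀ i, ∀ z ∈ T i, ∃ j, gen i ≤ gen j ∧ T j ⊆ T i ∧ z ∈ K j
  disjoint_of_gen_eq : ∀ i j, i ≠ j → gen i = gen j → Disjoint (T i) (T j)
  nested : ∀ i j, gen i < gen j → T j ⊆ T i ∨ Disjoint (T i) (T j)
  parent : ∀ i j, gen i < gen j → T j ⊆ T i →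
    ∃ p, gen p + 1 = gen j ∧ T j ⊆ T p ∧ T p ⊆ T i ∧ μ.real (T p) ≤ D * μ.real (T j)
  kube_large : ∀ i, c * μ.real (T i) ≤ μ.real (K i)

namespace TentTree

variable {X : Type*} [MeasurableSpace X] {μ : Measure X} {I : Type*}
  {T K : I → Set X} {gen : I → ℕ} {c D : ℝ}

lemma measureReal_pos (h : TentTree μ T K gen c D) (i : I) : 0 < μ.real (T i) :=
  ENNReal.toReal_pos (h.measure_pos i) (h.measure_ne_top i)

lemma nonempty (h : TentTree μ T K gen c D) (i : I) : (T i).Nonempty :=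
  nonempty_of_measure_ne_zero (h.measure_pos i)

lemma eq_of_mem_kube (h : TentTree μ T K gen c D) {i j : I} {z : X} (hi : z ∈ K i) (hj : z ∈ K j) :
    i = j := by
  by_contra hne
  exact Set.disjoint_left.1 (h.disjoint_kube i j hne) hi hj

/-- A kube that meets a tent belongs to a descendant of that tent. -/
lemma of_mem_kube (h : TentTree μ T K gen c D) {i j : I} {z : X} (hi : z ∈ T i) (hj : z ∈ K j) :
    gen i ≤ gen j ∧ T j ⊆ T i := by
  obtain ⟨k, hk, hki, hzk⟩ := h.cover i z hi
  obtain rfl := h.eq_of_mem_kube hj hzk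
  exact ⟨hk, hki⟩

lemma eq_of_gen_eq (h : TentTree μ T K gen c D) {i j : I} {z : X} (hg : gen i = gen j)
    (hi : z ∈ T i) (hj : z ∈ T j) : i = j := by
  by_contra hne
  exact Set.disjoint_left.1 (h.disjoint_of_gen_eq i j hne hg) hi hj

lemma subset_of_gen_lt (h : TentTree μ T K gen c D) {i j : I} {z : X} (hg : gen i < gen j)
    (hi : z ∈ T i) (hj : z ∈ T j) : T j ⊆ T i :=
  (h.nested i j hg).resolve_right fun hd => Set.disjoint_left.1 hd hi hj

/-- The maximal strict descendants of `T i` on which the averages `A` exceed `lam`. -/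
def stopping (T : I → Set X) (gen : I → ℕ) (A : I → ℝ) (i : I) (lam : ℝ) : Set I :=
  {j | gen i < gen j ∧ T j ⊆ T i ∧ lam < A j ∧
    ∀ k, gen i < gen k → gen k < gen j → T j ⊆ T k → A k ≤ lam}

/-- Of two nested stopping tents of different generations, the larger would have average above
`lam`, against the maximality of the smaller. -/
lemma stopping_disjoint (h : TentTree μ T K gen c D) (A : I → ℝ) (i : I) (lam : ℝ) :
    (stopping T gen A i lam).PairwiseDisjoint T := by
  have key : ∀ j ∈ stopping T gen A i lam, ∀ k ∈ stopping T gen A i lam, gen j < gen k →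
      Disjoint (T j) (T k) := by
    intro j hj k hk hjk
    refine (h.nested j k hjk).resolve_left fun hs => ?_
    exact absurd (hk.2.2.2 j hj.1 hjk hs) (not_le.2 hj.2.2.1)
  intro j hj k hk hne
  rcases lt_trichotomy (gen j) (gen k) with hl | he | hl
  · exact key j hj k hk hl
  · exact h.disjoint_of_gen_eq j k hne he
  · exact (key k hk j hj hl).symm

/-- Off the stopping tents, the averages over all tents are at most `lam`. -/
lemma le_of_notMem_stopping (h : TentTree μ T K gen c D) (A : I → ℝ) {i j : I} {lam : ℝ} {z : X}
    (hi : A i ≤ lam) (hzi : z ∈ T i) (hz : z ∉ ⋃ k ∈ stopping T gen A i lam, T k)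
    (hj : z ∈ K j) : A j ≤ lam := by
  obtain ⟨hij, hsub⟩ := h.of_mem_kube hzi hj
  rcases hij.eq_or_lt with he | hlt
  · obtain rfl := h.eq_of_gen_eq he hzi (h.kube_subset j hj)
    exact hi
  by_contra! hA
  -- Among the tents between `T j` and `T i` with average above `lam`, one of least generation is a
  -- stopping tent, and it contains `z`.
  let P : ℕ → Prop := fun m => ∃ k, gen k = m ∧ gen i < gen k ∧ T j ⊆ T k ∧ T k ⊆ T i ∧ lam < A k
  have hex : ∃ m, P m := ⟨gen j, j, rfl, hlt, Subset.rfl, hsub, hA⟩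
  classical
  obtain ⟨k, hkm, hik, hjk, hki, hAk⟩ := Nat.find_spec hex
  apply hz
  refine Set.mem_biUnion (x := k) ⟨hik, hki, hAk, ?_⟩ (hjk (h.kube_subset j hj))
  intro l hil hlk hkl
  by_contra! hAl
  refine Nat.find_min hex (m := gen l) (hkm ▸ hlk) ⟨l, rfl, hil, hjk.trans hkl, ?_, hAl⟩
  have hz' := hjk (h.kube_subset j hj)
  exact h.subset_of_gen_lt hil hzi (hkl hz')

/-- The average of a stopping tent is controlled through its parent. -/
lemma stopping_average_le (h : TentTree μ T K gen c D) {m : I → ℝ} {i j : I} {lam : ℝ}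
    (hmono : ∀ i j, T j ⊆ T i → m j ≤ m i) (hm : ∀ i, 0 ≤ m i)
    (hi : m i / μ.real (T i) ≤ lam)
    (hj : j ∈ stopping T gen (fun i => m i / μ.real (T i)) i lam) :
    m j / μ.real (T j) ≤ D * lam := by
  obtain ⟨p, hp, hjp, hpi, hD⟩ := h.parent i j hj.1 hj.2.1
  have hj0 := h.measureReal_pos j
  have hp0 := h.measureReal_pos p
  have hav : m p / μ.real (T p) ≤ lam := by
    -- The parent is either `T i` itself, whose average is bounded by assumption, or a strict
    -- descendant lying above a stopping tent, which maximality controls.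
    rcases (Nat.lt_succ_iff.1 (by have := hj.1; omega : gen i < gen p + 1)).eq_or_lt with he | hlt
    · obtain ⟨z, hz⟩ := h.nonempty j
      obtain rfl := h.eq_of_gen_eq he (hpi (hjp hz)) (hjp hz)
      exact hi
    · exact hj.2.2.2 p hlt (by omega) hjp
  rw [div_le_iff₀ hj0]
  rw [div_le_iff₀ hp0] at hav
  have hl : 0 ≤ lam := (div_nonneg (hm i) (h.measureReal_pos i).le).trans hi
  nlinarith [hmono p j hjp]

end TentTree

/-- This is what dictates the exponent: with this `ε` the power equals `exp (1 / (16 B))`, and `exp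
x ≤ 1 + 2x` on `[0, 1]`. -/
lemma rpow_le_one_add_of_le {D B ε : ℝ} (hD : 2 ≤ D) (hB : 1 ≤ B)
    (hε : ε = 1 / (16 * B * Real.log (2 * D))) : (2 * D) ^ ε ≤ 1 + 1 / (8 * B) := by
  have hlog : 0 < Real.log (2 * D) := Real.log_pos (by linarith)
  rw [Real.rpow_def_of_pos (by linarith)]
  have h1 : Real.log (2 * D) * ε = 1 / (16 * B) := by rw [hε]; field_simp
  rw [h1]
  have hx : |1 / (16 * B)| ≤ 1 := by
    rw [abs_of_pos (by positivity), div_le_one (by positivity)]; linarith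
  have h2 := Real.abs_exp_sub_one_le hx
  rw [abs_of_pos (a := 1 / (16 * B)) (by positivity)] at h2
  have h3 := (abs_le.1 h2).2
  have : 2 * (1 / (16 * B)) = 1 / (8 * B) := by field_simp; norm_num
  linarith

/-- The arithmetic of one step of the stopping-time induction. -/
lemma stopping_step_arith {g e B P Q Y : ℝ} (hg : 0 ≤ g) (he : 0 ≤ e) (hB : 1 ≤ B) (hP : 0 ≤ P)
    (hge : g + e ≤ 4 * B * g) (hQ : Q ≤ 1 + 1 / (8 * B)) (hY : Y = 2 * P) :
    P * g + Y * (Q * e) ≤ Y * (g + e) := by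
  subst hY
  -- The excess `e / (8B)` is paid for by `g / 2`, since `e ≤ 4Bg`. The factor `2` in `Y` then
  -- leaves exactly `P * g` to spare.
  have h1 : Q * e ≤ e + g / 2 := by
    have h2 : Q * e ≤ (1 + 1 / (8 * B)) * e := mul_le_mul_of_nonneg_right hQ he
    have h3 : 1 / (8 * B) * e ≤ g / 2 := by
      rw [div_mul_eq_mul_div, one_mul, div_le_iff₀ (by positivity)]; linarith
    linarith
  nlinarith

namespace TentTree

variable {X : Type*} [MeasurableSpace X] {μ : Measure X} {I : Type*}
  {T K : I → Set X} {gen : I → ℕ} {c D : ℝ}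

/-- This plays the role of Lebesgue differentiation: a function constant on kubes is bounded on each
kube by the average over its tent, because the kube fills the proportion `c` of that tent. -/
lemma kube_value_mul_le (h : TentTree μ T K gen c D) {f : X → ℝ≥0∞} {a : I → ℝ}
    (ha : ∀ i, 0 ≤ a i) (hf : ∀ i, ∀ z ∈ K i, f z = ENNReal.ofReal (a i))
    (hfin : ∀ i, ∫⁻ z in T i, f z ∂μ ≠ ⊤) (i : I) :
    c * a i ≤ (∫⁻ z in T i, f z ∂μ).toReal / μ.real (T i) := by
  rw [le_div_iff₀ (h.measureReal_pos i)]
  have h1 : ENNReal.ofReal (a i) * μ (K i) ≤ ∫⁻ z in T i, f z ∂μ := by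
    rw [← setLIntegral_const, setLIntegral_congr_fun (h.measurableSet_kube i) (fun z hz => (hf i z hz).symm)]
    exact lintegral_mono_set (h.kube_subset i)
  have h2 := ENNReal.toReal_mono (hfin i) h1
  rw [ENNReal.toReal_mul, ENNReal.toReal_ofReal (ha i)] at h2
  have h3 := h.kube_large i
  have h4 : a i * μ.real (K i) ≤ (∫⁻ z in T i, f z ∂μ).toReal := h2
  nlinarith [ha i]

/-- The set of points of `T i` outside a family of tents is a union of kubes. -/
lemma diff_eq_iUnion_kube (h : TentTree μ T K gen c D) (i : I) (J : Set I) :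
    T i \ ⋃ k ∈ J, T k = ⋃ j ∈ {j | K j ⊆ T i \ ⋃ k ∈ J, T k}, K j := by
  apply Subset.antisymm
  · rintro z ⟨hzi, hz⟩
    obtain ⟨j, -, hji, hzj⟩ := h.cover i z hzi
    refine Set.mem_biUnion (x := j) ?_ hzj
    intro y hy
    refine ⟨hji (h.kube_subset j hy), fun hyk => hz ?_⟩
    simp only [mem_iUnion] at hyk ⊢
    obtain ⟨k, hk, hyk⟩ := hyk
    exact ⟨k, hk, (h.of_mem_kube hyk hy).2 (h.kube_subset j hzj)⟩
  · exact iUnion₂_subset fun j hj => hj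

/-- The kubes of generation less than `N`. -/
def below (K : I → Set X) (gen : I → ℕ) (N : ℕ) : Set X := ⋃ j ∈ {j | gen j < N}, K j

/-- One stopping-time step. Intersecting with `below K gen N` truncates the tree to finite depth, so
that the estimate for the stopping tents is available by induction and no finiteness of the integral
of `f ^ (1 + ε)` is presupposed. -/
lemma reverse_holder_step (h : TentTree μ T K gen c D) [Countable I]
    {f : X → ℝ≥0∞} {a : I → ℝ} (ha : ∀ i, 0 ≤ a i)
    (hf : ∀ i, ∀ z ∈ K i, f z = ENNReal.ofReal (a i))
    (hfin : ∀ i, ∫⁻ z in T i, f z ∂μ ≠ ⊤) {B ε : ℝ} (hc : 0 < c) (hD : 2 ≤ D) (hB : 1 ≤ B)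
    (hε : ε = 1 / (16 * B * Real.log (2 * D)))
    (hH : ∀ i, ∀ J : Set I, (⋃ j ∈ J, K j) ⊆ T i →
      μ.real (⋃ j ∈ J, K j) ^ 2 * (∫⁻ z in T i, f z ∂μ).toReal ≤
        B * (∫⁻ z in ⋃ j ∈ J, K j, f z ∂μ).toReal * μ.real (T i) ^ 2) {N : ℕ} (i : I)
    (ih : ∀ j, gen i < gen j → ∫⁻ z in T j ∩ below K gen N, f z ^ (1 + ε) ∂μ ≤
      ENNReal.ofReal (2 * (2 / c) ^ ε *
        (((∫⁻ z in T j, f z ∂μ).toReal / μ.real (T j)) ^ ε * (∫⁻ z in T j, f z ∂μ).toReal))) :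
    ∫⁻ z in T i ∩ below K gen N, f z ^ (1 + ε) ∂μ ≤
      ENNReal.ofReal (2 * (2 / c) ^ ε *
        (((∫⁻ z in T i, f z ∂μ).toReal / μ.real (T i)) ^ ε * (∫⁻ z in T i, f z ∂μ).toReal)) := by
  have hlog : 0 < Real.log (2 * D) := Real.log_pos (by linarith)
  have hε0 : 0 < ε := by rw [hε]; positivity
  set m : I → ℝ := fun i => (∫⁻ z in T i, f z ∂μ).toReal with hm
  set A : I → ℝ := fun i => m i / μ.real (T i) with hA
  have hm0 : ∀ i, 0 ≤ m i := fun i => ENNReal.toReal_nonneg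
  have hA0 : ∀ i, 0 ≤ A i := fun i => div_nonneg (hm0 i) (h.measureReal_pos i).le
  have hmono : ∀ i j, T j ⊆ T i → m j ≤ m i := fun i j hji =>
    ENNReal.toReal_mono (hfin i) (lintegral_mono_set hji)
  have hcA : ∀ j, c * a j ≤ A j := h.kube_value_mul_le ha hf hfin
  have hμi := h.measureReal_pos i
  change _ ≤ ENNReal.ofReal (2 * (2 / c) ^ ε * (A i ^ ε * m i))
  -- A tent of mass zero has only kubes of value zero. It is set aside because the stopping level
  -- must be positive.
  rcases (hm0 i).eq_or_lt with hmi | hmi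
  · have hz : ∀ z ∈ T i ∩ below K gen N, f z ^ (1 + ε) = 0 := by
      rintro z ⟨hz, -⟩
      obtain ⟨j, -, hji, hzj⟩ := h.cover i z hz
      have h1 := hmono i j hji
      have h2 : A j = 0 := by
        rw [hA]; simp only
        rw [show m j = 0 by linarith [hm0 j], zero_div]
      have h3 : a j = 0 := le_antisymm (by nlinarith [hcA j]) (ha j)
      rw [hf j z hzj, h3, ENNReal.ofReal_zero, ENNReal.zero_rpow_of_pos (by linarith)]
    have hms : MeasurableSet (T i ∩ below K gen N) := (h.measurableSet_tent i).inter
      (MeasurableSet.biUnion (to_countable _) fun j _ => h.measurableSet_kube j)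
    rw [setLIntegral_congr_fun (g := fun _ => 0) hms hz]
    simp
  have hAi : 0 < A i := div_pos hmi hμi
  -- Twice the average, so that Chebyshev's inequality gives the stopping tents at most half the
  -- measure.
  set lam := 2 * A i with hlam
  set J := stopping T gen A i lam with hJ
  set E := ⋃ k ∈ J, T k with hE
  have hEm : MeasurableSet E :=
    MeasurableSet.biUnion (to_countable _) fun j _ => h.measurableSet_tent j
  have hLm : MeasurableSet (below K gen N) :=
    MeasurableSet.biUnion (to_countable _) fun j _ => h.measurableSet_kube j
  have hEi : E ⊆ T i := iUnion₂_subset fun j hj => hj.2.1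
  have hdisj := h.stopping_disjoint A i lam
  set g := (∫⁻ z in T i \ E, f z ∂μ).toReal with hg
  set e := (∫⁻ z in E, f z ∂μ).toReal with he
  have hfinG : ∫⁻ z in T i \ E, f z ∂μ ≠ ⊤ :=
    ne_top_of_le_ne_top (hfin i) (lintegral_mono_set sdiff_subset)
  have hfinE : ∫⁻ z in E, f z ∂μ ≠ ⊤ :=
    ne_top_of_le_ne_top (hfin i) (lintegral_mono_set hEi)
  have hge : g + e = m i := by
    rw [hg, he, ← ENNReal.toReal_add hfinG hfinE, add_comm, hm]
    congr 1
    rw [← lintegral_inter_add_sdiff f (T i) hEm, inter_eq_self_of_subset_right hEi]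
  have hEsum : ∫⁻ z in E, f z ∂μ = ∑' j : J, ENNReal.ofReal (m j) := by
    rw [hE, lintegral_biUnion (to_countable _) (fun j _ => h.measurableSet_tent j) hdisj]
    exact tsum_congr fun j => (ENNReal.ofReal_toReal (hfin j)).symm
  -- Chebyshev, summed over the disjoint stopping tents.
  have hEμ : lam * μ.real E ≤ e := by
    have h1 : ENNReal.ofReal lam * μ E ≤ ∫⁻ z in E, f z ∂μ := by
      rw [hEsum, hE, measure_biUnion (to_countable _) hdisj (fun j _ => h.measurableSet_tent j),
        ← ENNReal.tsum_mul_left]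
      refine ENNReal.tsum_le_tsum fun j => ?_
      have hj := j.2.2.2.1
      replace hj : lam < m j / μ.real (T j) := hj
      rw [lt_div_iff₀ (h.measureReal_pos j)] at hj
      have h2 := ENNReal.ofReal_le_ofReal hj.le
      rw [ENNReal.ofReal_mul (by positivity)] at h2
      rwa [Measure.real, ENNReal.ofReal_toReal (h.measure_ne_top _)] at h2
    have h2 := ENNReal.toReal_mono hfinE h1
    rwa [ENNReal.toReal_mul, ENNReal.toReal_ofReal (by positivity)] at h2
  have hAm : A i * μ.real (T i) = m i := div_mul_cancel₀ _ hμi.ne'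
  have hg0 : 0 ≤ g := ENNReal.toReal_nonneg
  have he0 : 0 ≤ e := ENNReal.toReal_nonneg
  have hEhalf : μ.real E ≤ μ.real (T i) / 2 := by
    have h1 : lam * μ.real E ≤ A i * μ.real (T i) := by linarith
    rw [hlam] at h1
    have : A i * (2 * μ.real E) ≤ A i * μ.real (T i) := by linarith
    linarith [le_of_mul_le_mul_left this hAi]
  have hGhalf : μ.real (T i) / 2 ≤ μ.real (T i \ E) := by
    rw [measureReal_sdiff hEi hEm (h.measure_ne_top i)]
    linarith
  -- The complement of the stopping tents is a union of kubes with at least half the measure; the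
  -- `A₂` comparison turns this into a lower bound for its share of the mass.
  have hgB : g + e ≤ 4 * B * g := by
    have h1 := hH i _ ((h.diff_eq_iUnion_kube i J).symm ▸ sdiff_subset)
    rw [← h.diff_eq_iUnion_kube i J] at h1
    change μ.real (T i \ E) ^ 2 * m i ≤ B * g * μ.real (T i) ^ 2 at h1
    rw [hge]
    have h2 : (μ.real (T i) / 2) ^ 2 ≤ μ.real (T i \ E) ^ 2 :=
      pow_le_pow_left₀ (by positivity) hGhalf 2
    have h3 : (μ.real (T i) / 2) ^ 2 * m i ≤ B * g * μ.real (T i) ^ 2 :=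
      (mul_le_mul_of_nonneg_right h2 hmi.le).trans h1
    have h4 : μ.real (T i) ^ 2 * m i ≤ μ.real (T i) ^ 2 * (4 * B * g) := by linarith
    exact le_of_mul_le_mul_left h4 (by positivity)
  -- Off the stopping tents every tent average is at most `lam`, so the kube values are at most `lam
  -- / c`.
  have hgood : ∫⁻ z in T i \ E, f z ^ (1 + ε) ∂μ ≤ ENNReal.ofReal ((lam / c) ^ ε * g) := by
    rw [ENNReal.ofReal_mul (by positivity), hg, ENNReal.ofReal_toReal hfinG,
      ← lintegral_const_mul' _ _ ENNReal.ofReal_ne_top]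
    refine setLIntegral_mono' ((h.measurableSet_tent i).diff hEm) fun z hz => ?_
    rw [add_comm 1 ε, ENNReal.rpow_add_of_nonneg _ _ hε0.le zero_le_one, ENNReal.rpow_one]
    refine mul_le_mul_left ?_ _
    obtain ⟨j, -, -, hzj⟩ := h.cover i z hz.1
    have h1 := h.le_of_notMem_stopping A (i := i) (lam := lam) (by linarith) hz.1 hz.2 hzj
    rw [hf j z hzj, ENNReal.ofReal_rpow_of_nonneg (ha j) hε0.le]
    refine ENNReal.ofReal_le_ofReal (Real.rpow_le_rpow (ha j) ?_ hε0.le)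
    rw [le_div_iff₀ hc]; linarith [hcA j]
  -- Inside the stopping tents the induction hypothesis applies; passing through the parents bounds
  -- each of their averages by `D * lam`.
  have hbad : ∫⁻ z in E ∩ below K gen N, f z ^ (1 + ε) ∂μ ≤
      ENNReal.ofReal (2 * (2 / c) ^ ε * ((D * lam) ^ ε * e)) := by
    have h1 : ENNReal.ofReal (2 * (2 / c) ^ ε * ((D * lam) ^ ε * e)) =
        ∑' j : J, ENNReal.ofReal (2 * (2 / c) ^ ε * ((D * lam) ^ ε * m j)) := by
      rw [← mul_assoc, ENNReal.ofReal_mul (by positivity), he, ENNReal.ofReal_toReal hfinE, hEsum,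
        ← ENNReal.tsum_mul_left]
      refine tsum_congr fun j => ?_
      rw [← ENNReal.ofReal_mul (by positivity), mul_assoc]
    rw [h1, hE, iUnion₂_inter, lintegral_biUnion (to_countable _)
      (fun j _ => (h.measurableSet_tent j).inter hLm)
      (fun j hj k hk hne => (hdisj hj hk hne).mono inter_subset_left inter_subset_left)]
    refine ENNReal.tsum_le_tsum fun j => (ih j j.2.1).trans (ENNReal.ofReal_le_ofReal ?_)
    have h2 : A j ≤ D * lam :=
      h.stopping_average_le hmono hm0 (by change A i ≤ lam; linarith) j.2
    have h3 : A j ^ ε ≤ (D * lam) ^ ε := Real.rpow_le_rpow (hA0 j) h2 hε0.le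
    have h4 := hm0 j
    change 2 * (2 / c) ^ ε * (A j ^ ε * m j) ≤ _
    gcongr
  calc ∫⁻ z in T i ∩ below K gen N, f z ^ (1 + ε) ∂μ
      ≤ ∫⁻ z in (T i \ E) ∪ (E ∩ below K gen N), f z ^ (1 + ε) ∂μ := by
        refine lintegral_mono_set ?_
        rintro z ⟨hz, hzL⟩
        by_cases hzE : z ∈ E
        · exact Or.inr ⟨hzE, hzL⟩
        · exact Or.inl ⟨hz, hzE⟩
    _ ≤ ENNReal.ofReal ((lam / c) ^ ε * g) +
        ENNReal.ofReal (2 * (2 / c) ^ ε * ((D * lam) ^ ε * e)) :=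
        (lintegral_union_le _ _ _).trans (add_le_add hgood hbad)
    _ ≤ _ := by
        rw [← ENNReal.ofReal_add (by positivity) (by positivity), ← hge]
        refine ENNReal.ofReal_le_ofReal ?_
        have e1 : (lam / c) ^ ε = A i ^ ε * (2 / c) ^ ε := by
          rw [← Real.mul_rpow hAi.le (by positivity)]; congr 1; rw [hlam]; ring
        have e2 : (D * lam) ^ ε = A i ^ ε * (2 * D) ^ ε := by
          rw [← Real.mul_rpow hAi.le (by positivity)]; congr 1; rw [hlam]; ring
        rw [e1, e2]
        have h5 := stopping_step_arith (P := (2 / c) ^ ε) hg0 he0 hB (by positivity) hgB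
          (rpow_le_one_add_of_le hD hB hε) rfl
        have h6 := mul_le_mul_of_nonneg_left h5 (Real.rpow_nonneg hAi.le ε)
        linarith

/-- Reverse Hölder inequality on a tree of tents, for a function that is constant on kubes and
satisfies an `A₂`-type comparison on unions of kubes. -/
theorem reverse_holder (h : TentTree μ T K gen c D) [Countable I]
    {f : X → ℝ≥0∞} {a : I → ℝ} (ha : ∀ i, 0 ≤ a i)
    (hf : ∀ i, ∀ z ∈ K i, f z = ENNReal.ofReal (a i))
    (hfin : ∀ i, ∫⁻ z in T i, f z ∂μ ≠ ⊤) {B ε : ℝ} (hc : 0 < c) (hD : 2 ≤ D) (hB : 1 ≤ B)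
    (hε : ε = 1 / (16 * B * Real.log (2 * D)))
    (hH : ∀ i, ∀ J : Set I, (⋃ j ∈ J, K j) ⊆ T i →
      μ.real (⋃ j ∈ J, K j) ^ 2 * (∫⁻ z in T i, f z ∂μ).toReal ≤
        B * (∫⁻ z in ⋃ j ∈ J, K j, f z ∂μ).toReal * μ.real (T i) ^ 2) (i : I) :
    ∫⁻ z in T i, f z ^ (1 + ε) ∂μ ≤
      ENNReal.ofReal (2 * (2 / c) ^ ε *
        (((∫⁻ z in T i, f z ∂μ).toReal / μ.real (T i)) ^ ε * (∫⁻ z in T i, f z ∂μ).toReal)) := by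
  -- The induction runs over the number `n` of generations between the tent and the truncation
  -- level. At `n = 0` the truncated tent is empty, since the kubes meeting a tent have at least its
  -- generation.
  have key : ∀ n N i, N ≤ gen i + n → ∫⁻ z in T i ∩ below K gen N, f z ^ (1 + ε) ∂μ ≤
      ENNReal.ofReal (2 * (2 / c) ^ ε *
        (((∫⁻ z in T i, f z ∂μ).toReal / μ.real (T i)) ^ ε *
          (∫⁻ z in T i, f z ∂μ).toReal)) := by
    intro n
    induction n with
    | zero =>
      intro N i hN
      have : T i ∩ below K gen N = ∅ := by
        refine eq_empty_of_forall_notMem ?_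
        rintro z ⟨hz, hzL⟩
        simp only [below, mem_iUnion] at hzL
        obtain ⟨j, hj, hzj⟩ := hzL
        have h1 := (h.of_mem_kube hz hzj).1
        have h2 : gen j < N := hj
        omega
      rw [this]
      simp
    | succ n ih =>
      intro N i hN
      exact h.reverse_holder_step ha hf hfin hc hD hB hε hH i fun j hj => ih N j (by omega)
  have hU : T i = ⋃ N, T i ∩ below K gen N := by
    apply Subset.antisymm
    · intro z hz
      obtain ⟨j, -, -, hzj⟩ := h.cover i z hz
      exact mem_iUnion.2 ⟨gen j + 1, hz, Set.mem_biUnion (x := j) (Nat.lt_succ_self _) hzj⟩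
    · exact iUnion_subset fun N => inter_subset_left
  -- The truncated bounds do not depend on `N`, so monotone convergence removes the truncation.
  conv_lhs => rw [hU]
  rw [setLIntegral_iUnion_of_directed]
  · exact iSup_le fun N => key N N i (by omega)
  · refine directed_of_isDirected_le fun M N hMN => inter_subset_inter_right _ ?_
    exact biUnion_subset_biUnion_left fun j (hj : gen j < M) => lt_of_lt_of_le hj hMN

end TentTree

namespace BekolleBonami

open Filter Topology

/-! ### Normals and nearest points -/

/-- A second-order Taylor bound for a smooth function, uniform on a ball. -/
lemma exists_taylor_bound {E : Type*} [NormedAddCommGroup E] [InnerProductSpace ℝ E]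
    [FiniteDimensional ℝ E] {ρ : E → ℝ} (hρ : ContDiff ℝ ∞ ρ) (r : ℝ) :
    ∃ M : ℝ, 0 < M ∧ ∀ x ∈ Metric.closedBall (0 : E) r, ∀ y ∈ Metric.closedBall (0 : E) r,
      ‖fderiv ℝ ρ x - fderiv ℝ ρ y‖ ≤ M * ‖x - y‖ ∧
        |ρ y - ρ x - fderiv ℝ ρ x (y - x)| ≤ M * ‖y - x‖ ^ 2 := by
  have h1 : ContDiff ℝ 1 (fderiv ℝ ρ) := hρ.fderiv_right (m := 1) (by norm_cast)
  obtain ⟨K, hK⟩ := h1.contDiffOn.exists_lipschitzOnWith one_ne_zero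
    (convex_closedBall (0 : E) r) (isCompact_closedBall _ _)
  refine ⟨K + 1, by positivity, fun x hx y hy => ?_⟩
  have hlip : ∀ x ∈ Metric.closedBall (0 : E) r, ∀ y ∈ Metric.closedBall (0 : E) r,
      ‖fderiv ℝ ρ x - fderiv ℝ ρ y‖ ≤ (K + 1) * ‖x - y‖ := fun x hx y hy => by
    have := hK.dist_le_mul x hx y hy
    rw [dist_eq_norm, dist_eq_norm] at this
    nlinarith [norm_nonneg (x - y)]
  refine ⟨hlip x hx y hy, ?_⟩
  have hseg : segment ℝ x y ⊆ Metric.closedBall (0 : E) r :=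
    (convex_closedBall _ _).segment_subset hx hy
  have := Convex.norm_image_sub_le_of_norm_hasFDerivWithin_le' (f := ρ) (f' := fderiv ℝ ρ)
    (C := (K + 1) * ‖y - x‖) (s := segment ℝ x y) (x := x) (y := y) (φ := fderiv ℝ ρ x)
    (fun z _ => ((hρ.differentiable (by simp)) z).hasFDerivAt.hasFDerivWithinAt)
    (fun z hz => (hlip z (hseg hz) x hx).trans ?_) (convex_segment x y)
    (left_mem_segment ℝ x y) (right_mem_segment ℝ x y)
  · rw [Real.norm_eq_abs] at this
    linarith
  · refine mul_le_mul_of_nonneg_left ?_ (by positivity)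
    obtain ⟨t, ht, rfl⟩ := (segment_eq_image' ℝ x y ▸ hz : z ∈ (fun t : ℝ => x + t • (y - x)) '' Icc 0 1)
    simp only [add_sub_cancel_left, norm_smul, Real.norm_eq_abs, abs_of_nonneg ht.1]
    nlinarith [ht.2, norm_nonneg (y - x)]

/-- If `⟨g, v⟩ ≤ 0` on the open half space `⟨u, v⟩ > 0`, then `g` is a nonpositive multiple of
`u`. -/
lemma eq_neg_smul_of_halfSpace {E : Type*} [NormedAddCommGroup E] [InnerProductSpace ℝ E]
    {g u : E} (hg : g ≠ 0) (hu : u ≠ 0)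
    (h : ∀ v, 0 < inner ℝ u v → inner ℝ g v ≤ 0) : u = -‖u‖ • (‖g‖⁻¹ • g) := by
  have hu2 : 0 < ‖u‖ ^ 2 := by positivity
  set α := inner ℝ u g / ‖u‖ ^ 2 with hα
  set w := g - α • u with hw
  have huw : inner ℝ u w = 0 := by
    rw [hw, inner_sub_right, inner_smul_right, real_inner_self_eq_norm_sq, hα]
    field_simp
    ring
  have hgw : inner ℝ g w = ‖w‖ ^ 2 := by
    have : g = w + α • u := by rw [hw]; abel
    rw [this, inner_add_left, inner_smul_left, huw, real_inner_self_eq_norm_sq]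
    simp
  have hgu : inner ℝ g u ≤ 0 := h u (by rw [real_inner_self_eq_norm_sq]; exact hu2)
  -- Testing on `w + t • u` with small `t > 0` forces the component `w` of `g` orthogonal to `u` to
  -- vanish. The `1` in the chosen `t` keeps the denominator positive when `⟨g, u⟩ = 0`.
  have hw0 : w = 0 := by
    by_contra hne
    have hwp : 0 < ‖w‖ ^ 2 := by have := norm_pos_iff.2 hne; positivity
    have key : ∀ t : ℝ, 0 < t → ‖w‖ ^ 2 + t * inner ℝ g u ≤ 0 := fun t ht => by
      have := h (w + t • u) (by
        rw [inner_add_right, inner_smul_right, huw, real_inner_self_eq_norm_sq]; positivity)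
      rwa [inner_add_right, inner_smul_right, hgw] at this
    have h1 := key (‖w‖ ^ 2 / (2 * (1 - inner ℝ g u))) (by
      apply div_pos hwp; linarith)
    have h2 : ‖w‖ ^ 2 / (2 * (1 - inner ℝ g u)) * (1 - inner ℝ g u) = ‖w‖ ^ 2 / 2 := by
      have : 1 - inner ℝ g u ≠ 0 := by linarith
      field_simp
    have h3 : 0 < ‖w‖ ^ 2 / (2 * (1 - inner ℝ g u)) := by apply div_pos hwp; linarith
    nlinarith
  have hgα : g = α • u := by rw [← sub_eq_zero]; exact hw0
  have hα0 : α < 0 := by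
    rcases lt_trichotomy α 0 with hl | he | hp
    · exact hl
    · rw [he, zero_smul] at hgα; exact absurd hgα hg
    · rw [hgα, inner_smul_left, real_inner_self_eq_norm_sq] at hgu
      simp only [conj_trivial] at hgu
      have : 0 < α * ‖u‖ ^ 2 := by positivity
      linarith
  have hgn : ‖g‖ = -α * ‖u‖ := by
    rw [hgα, norm_smul, Real.norm_eq_abs, abs_of_neg hα0]
  have hun : ‖u‖ ≠ 0 := norm_ne_zero_iff.2 hu
  rw [hgn]
  conv_rhs => rw [hgα]
  rw [smul_smul, smul_smul]
  have hα1 : α ≠ 0 := hα0.ne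
  have : -‖u‖ * (-α * ‖u‖)⁻¹ * α = 1 := by
    field_simp
  rw [this, one_smul]

variable {n : ℕ} {Ω : Set (Cn n)} {ρ : Cn n → ℝ}

namespace IsSmoothBoundedDomain

lemma isOpen (hΩ : IsSmoothBoundedDomain Ω ρ) : IsOpen Ω := by
  rw [hΩ.eq_sublevel]
  exact isOpen_lt hΩ.smooth.continuous continuous_const

lemma eq_zero_of_mem_frontier (hΩ : IsSmoothBoundedDomain Ω ρ) {p : Cn n} (hp : p ∈ frontier Ω) :
    ρ p = 0 := by
  rw [hΩ.eq_sublevel] at hp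
  exact frontier_lt_subset_eq hΩ.smooth.continuous continuous_const hp

lemma isCompact_frontier (hΩ : IsSmoothBoundedDomain Ω ρ) : IsCompact (frontier Ω) :=
  Metric.isCompact_of_isClosed_isBounded isClosed_frontier
    (hΩ.bounded.closure.subset frontier_subset_closure)

lemma measure_ne_top (hΩ : IsSmoothBoundedDomain Ω ρ) : volume Ω ≠ ⊤ :=
  hΩ.bounded.measure_lt_top.ne

lemma frontier_nonempty [NeZero n] (hΩ : IsSmoothBoundedDomain Ω ρ) : (frontier Ω).Nonempty := by
  rw [nonempty_iff_ne_empty]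
  intro h
  rcases frontier_eq_empty_iff.1 h with h | h
  · exact hΩ.connected.nonempty.ne_empty h
  · have := hΩ.bounded
    rw [h] at this
    exact NormedSpace.unbounded_univ ℝ (Cn n) this

lemma notMem_of_mem_frontier (hΩ : IsSmoothBoundedDomain Ω ρ) {p : Cn n} (hp : p ∈ frontier Ω) :
    p ∉ Ω := by
  rw [hΩ.isOpen.frontier_eq] at hp
  exact hp.2

/-- A connected set that meets `Ω` and its complement meets the boundary. -/
lemma exists_mem_frontier (hΩ : IsSmoothBoundedDomain Ω ρ) {s : Set (Cn n)} (hs : IsPreconnected s)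
    {x y : Cn n} (hx : x ∈ s) (hxΩ : x ∈ Ω) (hy : y ∈ s) (hyΩ : y ∉ Ω) :
    ∃ p ∈ s, p ∈ frontier Ω := by
  by_contra! hcon
  have hcl : ∀ p ∈ s, p ∉ Ω → p ∈ (closure Ω)ᶜ := fun p hp hpΩ hpc =>
    hcon p hp (by rw [hΩ.isOpen.frontier_eq]; exact ⟨hpc, hpΩ⟩)
  obtain ⟨p, -, hp1, hp2⟩ := hs Ω (closure Ω)ᶜ hΩ.isOpen isClosed_closure.isOpen_compl
    (fun p hp => (em (p ∈ Ω)).imp_right (hcl p hp)) ⟨x, hx, hxΩ⟩ ⟨y, hy, hcl y hy hyΩ⟩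
  exact hp2 (subset_closure hp1)

/-- A ball about a point of `Ω` that does not meet the boundary lies in `Ω`. -/
lemma ball_infDist_subset (hΩ : IsSmoothBoundedDomain Ω ρ) {z : Cn n} (hz : z ∈ Ω) :
    Metric.ball z (Metric.infDist z (frontier Ω)) ⊆ Ω := by
  by_contra hcon
  obtain ⟨y, hy, hyΩ⟩ := not_subset.1 hcon
  have hr : 0 < Metric.infDist z (frontier Ω) := dist_nonneg.trans_lt (Metric.mem_ball.1 hy)
  obtain ⟨x, hx, hxf⟩ := hΩ.exists_mem_frontier
    (convex_ball z (Metric.infDist z (frontier Ω))).isPreconnected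
    (Metric.mem_ball_self hr) hz hy hyΩ
  have := Metric.infDist_le_dist_of_mem (x := z) hxf
  rw [Metric.mem_ball, dist_comm] at hx
  linarith

end IsSmoothBoundedDomain

/-- A unit normal field `ν` along the boundary, with a width `ε` on which boundary normals do not
focus. -/
structure IsNormalField (Ω : Set (Cn n)) (ρ : Cn n → ℝ) (ν : Cn n → Cn n) (K ε : ℝ) : Prop where
  pos : 0 < ε
  K_pos : 0 < K
  small : ε * (4 * K) ≤ 1
  norm_eq : ∀ p ∈ frontier Ω, ‖ν p‖ = 1
  tangential : ∀ p ∈ frontier Ω, ∀ q ∈ frontier Ω, |inner ℝ (ν p) (q - p)| ≤ K * ‖q - p‖ ^ 2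
  lipschitz : ∀ p ∈ frontier Ω, ∀ q ∈ frontier Ω, ‖ν p - ν q‖ ≤ K * ‖p - q‖
  mem : ∀ p ∈ frontier Ω, ∀ s, 0 < s → s < ε → p - s • ν p ∈ Ω
  eq_of_nearest : ∀ z ∈ Ω, ∀ p ∈ frontier Ω, dist p z = Metric.infDist z (frontier Ω) →
    z = p - dist p z • ν p
  growth : ∃ c > 0, ∀ p ∈ frontier Ω, ∀ y ∈ Metric.ball p ε, ∀ t, 0 < t → t < ε →
    ρ y + c * t ≤ ρ (y + t • ν p)

/-- The field is the normalised gradient of `ρ`. Compactness bounds the gradient below by `m` on the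
boundary, and the second-order Taylor constant `M` gives everything else: `K = 2M / m` measures how
fast the boundary leaves its tangent plane and how fast normals turn, and within distance `ε` the
quadratic errors are dominated by the gradient. -/
lemma IsSmoothBoundedDomain.exists_isNormalField [NeZero n] (hΩ : IsSmoothBoundedDomain Ω ρ) :
    ∃ ν K ε, IsNormalField Ω ρ ν K ε := by
  obtain ⟨r, hr⟩ := hΩ.bounded.closure.subset_closedBall (0 : Cn n)
  -- The radius `r + 2` leaves room for a point at distance at most `1` from the boundary, moved
  -- once more by at most `1`.
  obtain ⟨M, hM, hT⟩ := exists_taylor_bound hΩ.smooth (r + 2)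
  have hfr : ∀ p ∈ frontier Ω, ‖p‖ ≤ r := fun p hp => by
    simpa using hr (frontier_subset_closure hp)
  have hcont : Continuous fun p => ‖fderiv ℝ ρ p‖ :=
    (hΩ.smooth.continuous_fderiv (by simp)).norm
  obtain ⟨m, hm, hmin⟩ : ∃ m > 0, ∀ p ∈ frontier Ω, m ≤ ‖fderiv ℝ ρ p‖ := by
    obtain ⟨p, hp, hmin⟩ := hΩ.isCompact_frontier.exists_isMinOn hΩ.frontier_nonempty
      hcont.continuousOn
    exact ⟨_, norm_pos_iff.2 (hΩ.fderiv_ne_zero p hp), fun q hq => hmin hq⟩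
  set g : Cn n → Cn n := fun p => (InnerProductSpace.toDual ℝ (Cn n)).symm (fderiv ℝ ρ p) with hg
  have hgn : ∀ p, ‖g p‖ = ‖fderiv ℝ ρ p‖ := fun p => LinearIsometryEquiv.norm_map _ _
  have hgi : ∀ p v, inner ℝ (g p) v = fderiv ℝ ρ p v := fun p v =>
    InnerProductSpace.toDual_symm_apply
  have hgm : ∀ p ∈ frontier Ω, m ≤ ‖g p‖ := fun p hp => by rw [hgn]; exact hmin p hp
  have hg0 : ∀ p ∈ frontier Ω, 0 < ‖g p‖ := fun p hp => hm.trans_le (hgm p hp)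
  have hball : ∀ p, ‖p‖ ≤ r + 2 → p ∈ Metric.closedBall (0 : Cn n) (r + 2) := fun p hp => by
    simpa using hp
  have hν1 : ∀ p ∈ frontier Ω, ‖‖g p‖⁻¹ • g p‖ = 1 := fun p hp => by
    rw [norm_smul, norm_inv, norm_norm, inv_mul_cancel₀ (hg0 p hp).ne']
  have hgν : ∀ p ∈ frontier Ω, fderiv ℝ ρ p (‖g p‖⁻¹ • g p) = ‖g p‖ := fun p hp => by
    rw [← hgi, inner_smul_right, real_inner_self_eq_norm_sq]
    have := (hg0 p hp).ne'
    field_simp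
  have hK : 0 < 2 * M / m := by positivity
  -- The three bounds keep all points in the Taylor ball, keep `M ε ≤ m / 4`, and give `ε * (4 * K)
  -- ≤ 1`.
  set ε := min (min 1 (m / (4 * M))) (1 / (4 * (2 * M / m))) with hε
  have hε0 : 0 < ε := by positivity
  have hε1 : ε ≤ 1 := (min_le_left _ _).trans (min_le_left _ _)
  have hεm : ε ≤ m / (4 * M) := (min_le_left _ _).trans (min_le_right _ _)
  have hεM : ε * (4 * M) ≤ m := by rwa [le_div_iff₀ (by positivity)] at hεm
  refine ⟨fun p => ‖g p‖⁻¹ • g p, 2 * M / m, ε, hε0, hK, ?_, hν1, ?_, ?_, ?_, ?_, ?_⟩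
  · have : ε ≤ 1 / (4 * (2 * M / m)) := min_le_right _ _
    rwa [le_div_iff₀ (by positivity)] at this
  · intro p hp q hq
    have h1 := (hT p (hball p (by linarith [hfr p hp])) q (hball q (by linarith [hfr q hq]))).2
    rw [hΩ.eq_zero_of_mem_frontier hp, hΩ.eq_zero_of_mem_frontier hq, sub_zero, zero_sub,
      abs_neg] at h1
    rw [inner_smul_left, hgi, conj_trivial, abs_mul, abs_inv, abs_norm, inv_mul_le_iff₀ (hg0 p hp)]
    have h2 : M * ‖q - p‖ ^ 2 ≤ m * (2 * M / m * ‖q - p‖ ^ 2) := by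
      have : m * (2 * M / m * ‖q - p‖ ^ 2) = 2 * M * ‖q - p‖ ^ 2 := by field_simp
      rw [this]; nlinarith [sq_nonneg (‖q - p‖)]
    have h3 : m * (2 * M / m * ‖q - p‖ ^ 2) ≤ ‖g p‖ * (2 * M / m * ‖q - p‖ ^ 2) :=
      mul_le_mul_of_nonneg_right (hgm p hp) (by positivity)
    linarith
  · intro p hp q hq
    have h1 := (hT p (hball p (by linarith [hfr p hp])) q (hball q (by linarith [hfr q hq]))).1
    have h2 : ‖g p - g q‖ ≤ M * ‖p - q‖ := by
      rw [hg]; simp only; rw [← map_sub, LinearIsometryEquiv.norm_map]; exact h1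
    have hp0 := hg0 p hp
    have hq0 := hg0 q hq
    have h3 : ‖g p‖⁻¹ • g p - ‖g q‖⁻¹ • g q =
        ‖g p‖⁻¹ • ((g p - g q) + (‖g q‖ - ‖g p‖) • (‖g q‖⁻¹ • g q)) := by
      rw [smul_add, smul_sub, smul_smul, smul_smul]
      have : ‖g p‖⁻¹ * (‖g q‖ - ‖g p‖) * ‖g q‖⁻¹ = ‖g p‖⁻¹ - ‖g q‖⁻¹ := by
        field_simp
      rw [this, sub_smul]; abel
    rw [h3, norm_smul, norm_inv, norm_norm, inv_mul_le_iff₀ hp0]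
    have h4 : ‖(g p - g q) + (‖g q‖ - ‖g p‖) • (‖g q‖⁻¹ • g q)‖ ≤ 2 * M * ‖p - q‖ := by
      refine (norm_add_le _ _).trans ?_
      rw [norm_smul, hν1 q hq, mul_one, Real.norm_eq_abs]
      have := abs_norm_sub_norm_le (g q) (g p)
      rw [norm_sub_rev] at this
      linarith
    refine h4.trans ?_
    have h5 : m * (2 * M / m * ‖p - q‖) = 2 * M * ‖p - q‖ := by field_simp
    rw [← h5]
    exact mul_le_mul_of_nonneg_right (hgm p hp) (by positivity)
  · intro p hp s hs hsε
    rw [hΩ.eq_sublevel, mem_ofPred_eq]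
    have hn : ‖p - s • (‖g p‖⁻¹ • g p)‖ ≤ r + 2 := by
      refine (norm_sub_le _ _).trans ?_
      rw [norm_smul, hν1 p hp, mul_one, Real.norm_eq_abs, abs_of_pos hs]
      linarith [hfr p hp]
    have h1 := (hT p (hball p (by linarith [hfr p hp])) _ (hball _ hn)).2
    rw [hΩ.eq_zero_of_mem_frontier hp, sub_zero, sub_sub_cancel_left, map_neg, norm_neg,
      map_smul, hgν p hp, norm_smul, hν1 p hp, mul_one, Real.norm_eq_abs, abs_of_pos hs,
      smul_eq_mul] at h1
    have h2 := (abs_le.1 h1).2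
    have h3 : M * s < ‖g p‖ := by nlinarith [hgm p hp]
    have h4 := mul_lt_mul_of_pos_left h3 hs
    linarith
  · intro z hz p hp hd
    have hzp : z - p ≠ 0 := by
      rw [sub_ne_zero]; rintro rfl
      exact hΩ.notMem_of_mem_frontier hp hz
    have h1 := eq_neg_smul_of_halfSpace (g := g p) (u := z - p) (norm_pos_iff.1 (hg0 p hp)) hzp ?_
    · rw [dist_comm, dist_eq_norm]
      exact (sub_eq_iff_eq_add.1 h1).trans (by rw [neg_smul]; abel)
    -- If `v` points into the ball about `z` through `p`, then `p + t • v` is in that ball, hence in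
    -- `Ω`, for small `t > 0`. A positive derivative of `ρ` along `v` would make `ρ` positive there.
    · intro v hv
      rw [hgi]
      by_contra! hcon
      have ev1 : ∀ᶠ t : ℝ in 𝓝[>] 0, t * ‖v‖ < 1 := by
        have : Tendsto (fun t : ℝ => t * ‖v‖) (𝓝 0) (𝓝 (0 * ‖v‖)) :=
          tendsto_id.mul_const _
        rw [zero_mul] at this
        exact (this.mono_left nhdsWithin_le_nhds).eventually (gt_mem_nhds one_pos)
      have ev2 : ∀ᶠ t : ℝ in 𝓝[>] 0, t * ‖v‖ ^ 2 < 2 * inner ℝ (z - p) v := by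
        have : Tendsto (fun t : ℝ => t * ‖v‖ ^ 2) (𝓝 0) (𝓝 (0 * ‖v‖ ^ 2)) :=
          tendsto_id.mul_const _
        rw [zero_mul] at this
        exact (this.mono_left nhdsWithin_le_nhds).eventually (gt_mem_nhds (by positivity))
      have ev3 : ∀ᶠ t : ℝ in 𝓝[>] 0, t * (M * ‖v‖ ^ 2) < fderiv ℝ ρ p v := by
        have : Tendsto (fun t : ℝ => t * (M * ‖v‖ ^ 2)) (𝓝 0) (𝓝 (0 * (M * ‖v‖ ^ 2))) :=
          tendsto_id.mul_const _
        rw [zero_mul] at this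
        exact (this.mono_left nhdsWithin_le_nhds).eventually (gt_mem_nhds hcon)
      obtain ⟨t, h1, h2, h3, ht⟩ :=
        (ev1.and (ev2.and (ev3.and self_mem_nhdsWithin))).exists
      replace ht : 0 < t := ht
      have hmem : p + t • v ∈ Ω := by
        refine hΩ.ball_infDist_subset hz ?_
        rw [← hd, Metric.mem_ball, dist_comm p z, dist_eq_norm, dist_eq_norm]
        refine lt_of_pow_lt_pow_left₀ 2 (norm_nonneg _) ?_
        rw [show p + t • v - z = t • v - (z - p) by abel, norm_sub_sq_real, norm_smul,
          inner_smul_left, conj_trivial, Real.norm_eq_abs, abs_of_pos ht, real_inner_comm, mul_pow]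
        nlinarith
      rw [hΩ.eq_sublevel, mem_ofPred_eq] at hmem
      have hn : ‖p + t • v‖ ≤ r + 2 := by
        refine (norm_add_le _ _).trans ?_
        rw [norm_smul, Real.norm_eq_abs, abs_of_pos ht]
        linarith [hfr p hp]
      have h4 := (hT p (hball p (by linarith [hfr p hp])) _ (hball _ hn)).2
      rw [hΩ.eq_zero_of_mem_frontier hp, sub_zero, add_sub_cancel_left, map_smul, norm_smul,
        Real.norm_eq_abs, abs_of_pos ht, smul_eq_mul] at h4
      have h5 := (abs_le.1 h4).1
      have h6 : t * (t * (M * ‖v‖ ^ 2)) < t * fderiv ℝ ρ p v := mul_lt_mul_of_pos_left h3 ht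
      nlinarith
  · refine ⟨m / 4, by positivity, fun p hp y hy t ht htε => ?_⟩
    rw [Metric.mem_ball, dist_eq_norm] at hy
    have hy1 : ‖y‖ ≤ r + 1 := by
      have := norm_add_le (y - p) p
      rw [sub_add_cancel] at this
      linarith [hfr p hp]
    have hn : ‖y + t • (‖g p‖⁻¹ • g p)‖ ≤ r + 2 := by
      refine (norm_add_le _ _).trans ?_
      rw [norm_smul, hν1 p hp, mul_one, Real.norm_eq_abs, abs_of_pos ht]
      linarith
    have h1 := (hT y (hball y (by linarith)) _ (hball _ hn)).2
    rw [add_sub_cancel_left, map_smul, norm_smul, hν1 p hp, mul_one, Real.norm_eq_abs,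
      abs_of_pos ht, smul_eq_mul] at h1
    have h2 := (abs_le.1 h1).1
    have h3 := (hT y (hball y (by linarith)) p (hball p (by linarith [hfr p hp]))).1
    have h4 := (fderiv ℝ ρ y - fderiv ℝ ρ p).le_opNorm (‖g p‖⁻¹ • g p)
    rw [hν1 p hp, mul_one, _root_.sub_apply, hgν p hp, Real.norm_eq_abs] at h4
    have h5 := (abs_le.1 h4).1
    have h6 : M * ‖y - p‖ ≤ m / 4 := by nlinarith
    have h7 : m / 2 + m / 4 ≤ fderiv ℝ ρ y (‖g p‖⁻¹ • g p) := by linarith [hgm p hp]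
    have h8 : M * t ≤ m / 4 := by nlinarith
    nlinarith

end BekolleBonami

/-! ### Nearest-point projection and volumes of strips over the boundary -/

namespace BekolleBonami

/-- A Lipschitz map increases Haar measure by at most the dimensional power of its constant. -/
lemma measure_image_le_of_lipschitzOn {E : Type*} [NormedAddCommGroup E] [NormedSpace ℝ E]
    [FiniteDimensional ℝ E] [MeasurableSpace E] [BorelSpace E] (μ : Measure E) [μ.IsAddHaarMeasure]
    {L : NNReal} {f : E → E} {s : Set E} (hf : LipschitzOnWith L f s) :
    μ (f '' s) ≤ (L : ℝ≥0∞) ^ Module.finrank ℝ E * μ s := by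
  -- Haar measure is a multiple of Hausdorff measure of the full dimension, which scales in this way
  -- under Lipschitz maps.
  have h := hf.hausdorffMeasure_image_le (d := Module.finrank ℝ E) (by positivity)
  have := isAddHaarMeasure_hausdorffMeasure (E := E)
  rw [Measure.isAddLeftInvariant_eq_smul μ (Measure.hausdorffMeasure (Module.finrank ℝ E : ℝ))]
  simp only [Measure.smul_apply, ENNReal.rpow_natCast] at h ⊢
  rw [ENNReal.smul_def, ENNReal.smul_def, smul_eq_mul, smul_eq_mul, mul_left_comm]
  gcongr

variable {n : ℕ} {Ω : Set (Cn n)} {ρ : Cn n → ℝ}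

/-- The part of `Ω` lying over `U` at distance between `a` and `b` from the boundary. -/
def strip (Ω U : Set (Cn n)) (a b : ℝ) : Set (Cn n) :=
  {z ∈ Ω | proj Ω z ∈ U ∧ a ≤ dist (proj Ω z) z ∧ dist (proj Ω z) z < b}

lemma tentOver_mono {U V : Set (Cn n)} {s t : ℝ} (hUV : U ⊆ V) (hst : s ≤ t) :
    tentOver Ω U s ⊆ tentOver Ω V t := fun _ hz => ⟨hz.1, hUV hz.2.1, hz.2.2.trans_le hst⟩

lemma tentOver_subset {U : Set (Cn n)} {t : ℝ} : tentOver Ω U t ⊆ Ω := fun _ hz => hz.1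

namespace IsSmoothBoundedDomain

variable [NeZero n]

lemma proj_spec (hΩ : IsSmoothBoundedDomain Ω ρ) (z : Cn n) :
    proj Ω z ∈ frontier Ω ∧ dist z (proj Ω z) = Metric.infDist z (frontier Ω) := by
  have h : ∃ p ∈ frontier Ω, dist z p = Metric.infDist z (frontier Ω) := by
    obtain ⟨p, hp, h⟩ := hΩ.isCompact_frontier.exists_infDist_eq_dist hΩ.frontier_nonempty z
    exact ⟨p, hp, h.symm⟩
  rw [proj, dif_pos h]
  exact h.choose_spec

lemma proj_mem (hΩ : IsSmoothBoundedDomain Ω ρ) (z : Cn n) : proj Ω z ∈ frontier Ω :=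
  (hΩ.proj_spec z).1

lemma dist_proj (hΩ : IsSmoothBoundedDomain Ω ρ) (z : Cn n) :
    dist (proj Ω z) z = Metric.infDist z (frontier Ω) := by
  rw [dist_comm]; exact (hΩ.proj_spec z).2

lemma dist_proj_pos (hΩ : IsSmoothBoundedDomain Ω ρ) {z : Cn n} (hz : z ∈ Ω) :
    0 < dist (proj Ω z) z := by
  rw [dist_pos]
  intro h
  exact hΩ.notMem_of_mem_frontier (hΩ.proj_mem z) (by rwa [h])

end IsSmoothBoundedDomain

namespace IsNormalField

variable [NeZero n] {ν : Cn n → Cn n} {K ε : ℝ}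

lemma eq_sub (hν : IsNormalField Ω ρ ν K ε) (hΩ : IsSmoothBoundedDomain Ω ρ) {z : Cn n}
    (hz : z ∈ Ω) : z = proj Ω z - dist (proj Ω z) z • ν (proj Ω z) :=
  hν.eq_of_nearest z hz _ (hΩ.proj_mem z) (hΩ.dist_proj z)

/-- Moving from `p` along the inner normal, the nearest boundary point remains `p`. -/
lemma proj_sub (hν : IsNormalField Ω ρ ν K ε) (hΩ : IsSmoothBoundedDomain Ω ρ) {p : Cn n}
    (hp : p ∈ frontier Ω) {s : ℝ} (hs : 0 ≤ s) (hsε : s < ε) : proj Ω (p - s • ν p) = p := by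
  set z := p - s • ν p with hz
  set q := proj Ω z with hq
  have hqf : q ∈ frontier Ω := hΩ.proj_mem z
  have h1 : dist q z ≤ s := by
    rw [hΩ.dist_proj z]
    refine (Metric.infDist_le_dist_of_mem hp).trans ?_
    rw [dist_comm, dist_eq_norm, hz, sub_sub_cancel, norm_smul, hν.norm_eq p hp, mul_one,
      Real.norm_eq_abs, abs_of_nonneg hs]
  have h2 : ‖q - z‖ ^ 2 ≤ s ^ 2 := by
    rw [← dist_eq_norm]; exact pow_le_pow_left₀ dist_nonneg h1 2
  have h3 : ‖q - z‖ ^ 2 = ‖q - p‖ ^ 2 + 2 * s * inner ℝ (ν p) (q - p) + s ^ 2 := by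
    rw [show q - z = (q - p) + s • ν p by rw [hz]; abel, norm_add_sq_real, inner_smul_right,
      norm_smul, hν.norm_eq p hp, mul_one, Real.norm_eq_abs, sq_abs, real_inner_comm]
    ring
  have h4 := (abs_le.1 (hν.tangential p hp q hqf)).1
  -- The cross term is at least `-2sK‖q - p‖²`, and `sK ≤ 1/4`; so `q` can be as near to `z` as `p`
  -- only if `q = p`.
  have h5 : ‖q - p‖ ^ 2 ≤ 0 := by
    have h6 : s * K ≤ 1 / 4 := by nlinarith [hν.small, hν.K_pos]
    nlinarith [sq_nonneg ‖q - p‖]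
  have h7 : ‖q - p‖ = 0 := by nlinarith [norm_nonneg (q - p)]
  exact sub_eq_zero.1 (norm_eq_zero.1 h7)

/-- Writing `z = p - s ν(p)` and `w = q - t ν(q)` and pairing `z - w` with `p - q`, the normal terms
cost at most `(s + t) K ‖p - q‖² ≤ ‖p - q‖² / 2`. Half of `‖p - q‖²` survives. -/
lemma proj_lipschitz (hν : IsNormalField Ω ρ ν K ε) (hΩ : IsSmoothBoundedDomain Ω ρ)
    {z w : Cn n} (hz : z ∈ Ω) (hw : w ∈ Ω) (hzε : dist (proj Ω z) z < ε)
    (hwε : dist (proj Ω w) w < ε) : ‖proj Ω z - proj Ω w‖ ≤ 2 * ‖z - w‖ := by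
  set p := proj Ω z with hp
  set q := proj Ω w with hq
  set s := dist p z with hs
  set t := dist q w with ht
  have hs0 : 0 ≤ s := dist_nonneg
  have ht0 : 0 ≤ t := dist_nonneg
  have hpf : p ∈ frontier Ω := hΩ.proj_mem z
  have hqf : q ∈ frontier Ω := hΩ.proj_mem w
  have ez : z = p - s • ν p := hν.eq_sub hΩ hz
  have ew : w = q - t • ν q := hν.eq_sub hΩ hw
  have h1 := (abs_le.1 (hν.tangential p hpf q hqf)).1
  have h2 := (abs_le.1 (hν.tangential q hqf p hpf)).1
  have h3 : inner ℝ (z - w) (p - q) =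
      ‖p - q‖ ^ 2 + s * inner ℝ (ν p) (q - p) + t * inner ℝ (ν q) (p - q) := by
    have : z - w = (p - q) - s • ν p + t • ν q := by rw [ez, ew]; abel
    rw [this, inner_add_left, inner_sub_left, inner_smul_left, inner_smul_left,
      real_inner_self_eq_norm_sq, ← neg_sub p q, inner_neg_right]
    simp only [conj_trivial]
    ring
  have h4 : inner ℝ (z - w) (p - q) ≤ ‖z - w‖ * ‖p - q‖ := real_inner_le_norm _ _
  rw [norm_sub_rev q p] at h1
  have h6 : s * K ≤ 1 / 4 := by nlinarith [hν.small, hν.K_pos]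
  have h7 : t * K ≤ 1 / 4 := by nlinarith [hν.small, hν.K_pos]
  have h8 : ‖p - q‖ ^ 2 ≤ 2 * ‖z - w‖ * ‖p - q‖ := by
    have h9 : s * (-(K * ‖p - q‖ ^ 2)) ≤ s * inner ℝ (ν p) (q - p) :=
      mul_le_mul_of_nonneg_left h1 hs0
    have h10 : t * (-(K * ‖p - q‖ ^ 2)) ≤ t * inner ℝ (ν q) (p - q) :=
      mul_le_mul_of_nonneg_left h2 ht0
    nlinarith [sq_nonneg ‖p - q‖]
  rcases (norm_nonneg (p - q)).eq_or_lt with h0 | h0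
  · rw [← h0]; positivity
  · rw [sq] at h8; exact le_of_mul_le_mul_right h8 h0

/-- Moving a point along its normal changes its distance from the boundary, but not its nearest
boundary point. -/
lemma shift (hν : IsNormalField Ω ρ ν K ε) (hΩ : IsSmoothBoundedDomain Ω ρ) {z : Cn n}
    (hz : z ∈ Ω) {σ : ℝ} (hσ : 0 ≤ σ) (hzσ : dist (proj Ω z) z + σ < ε) :
    z - σ • ν (proj Ω z) ∈ Ω ∧ proj Ω (z - σ • ν (proj Ω z)) = proj Ω z ∧
      dist (proj Ω z) (z - σ • ν (proj Ω z)) = dist (proj Ω z) z + σ := by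
  set p := proj Ω z with hp
  have hpf : p ∈ frontier Ω := hΩ.proj_mem z
  have hd : 0 < dist p z := hΩ.dist_proj_pos hz
  have e : z - σ • ν p = p - (dist p z + σ) • ν p := by
    conv_lhs => rw [hν.eq_sub hΩ hz]
    rw [← hp, add_smul]; abel
  rw [e]
  refine ⟨hν.mem p hpf _ (by linarith) hzσ, hν.proj_sub hΩ hpf (by linarith) hzσ, ?_⟩
  rw [dist_eq_norm, sub_sub_cancel, norm_smul, hν.norm_eq p hpf, mul_one, Real.norm_eq_abs,
    abs_of_pos (by linarith)]

/-- Sliding outward by `σ` along the normals carries the inner strip onto a set containing the strip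
nearer to the boundary. The map is `2`-Lipschitz, since `σK ≤ 1/4` and `π` is itself `2`-Lipschitz
there, so volume grows by at most a dimensional factor. No measurability of `U` is needed. -/
lemma measure_strip_le (hν : IsNormalField Ω ρ ν K ε) (hΩ : IsSmoothBoundedDomain Ω ρ)
    (U : Set (Cn n)) {a b σ : ℝ} (hσ : 0 ≤ σ) (hb : b + σ ≤ ε) :
    volume (strip Ω U a b) ≤
      2 ^ Module.finrank ℝ (Cn n) * volume (strip Ω U (a + σ) (b + σ)) := by
  rcases le_or_gt b 0 with hb0 | hb0
  · have : strip Ω U a b = ∅ := eq_empty_of_forall_notMem fun z hz =>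
      absurd (hz.2.2.2.trans_le hb0) (not_lt.2 dist_nonneg)
    rw [this]; simp
  have hlip : LipschitzOnWith 2 (fun y => y + σ • ν (proj Ω y)) (strip Ω U (a + σ) (b + σ)) := by
    refine LipschitzOnWith.of_dist_le_mul fun x hx y hy => ?_
    rw [dist_eq_norm, dist_eq_norm]
    have h1 := hν.proj_lipschitz hΩ hx.1 hy.1 (hx.2.2.2.trans_le hb) (hy.2.2.2.trans_le hb)
    have h2 := hν.lipschitz _ (hΩ.proj_mem x) _ (hΩ.proj_mem y)
    have h3 : x + σ • ν (proj Ω x) - (y + σ • ν (proj Ω y)) =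
        (x - y) + σ • (ν (proj Ω x) - ν (proj Ω y)) := by rw [smul_sub]; abel
    rw [h3]
    refine (norm_add_le _ _).trans ?_
    rw [norm_smul, Real.norm_eq_abs, abs_of_nonneg hσ]
    have h4 : σ * ‖ν (proj Ω x) - ν (proj Ω y)‖ ≤ σ * (K * (2 * ‖x - y‖)) :=
      mul_le_mul_of_nonneg_left (h2.trans (mul_le_mul_of_nonneg_left h1 hν.K_pos.le)) hσ
    have h5 : σ * K ≤ 1 / 4 := by nlinarith [hν.small, hν.K_pos]
    have h6 : ((2 : NNReal) : ℝ) = 2 := rfl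
    rw [h6]
    nlinarith [norm_nonneg (x - y)]
  refine (measure_mono ?_).trans (measure_image_le_of_lipschitzOn volume hlip)
  intro z hz
  obtain ⟨h1, h2, h3⟩ := hν.shift hΩ hz.1 (σ := σ) hσ (by linarith [hz.2.2.2])
  refine ⟨z - σ • ν (proj Ω z), ⟨h1, ?_, ?_, ?_⟩, ?_⟩
  · rw [h2]; exact hz.2.1
  · rw [h2, h3]; linarith [hz.2.2.1]
  · rw [h2, h3]; linarith [hz.2.2.2]
  · simp only [h2, sub_add_cancel]

/-- The upper part of a tent is a fixed proportion of the tent. -/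
lemma exists_measure_tentOver_le_strip (hν : IsNormalField Ω ρ ν K ε)
    (hΩ : IsSmoothBoundedDomain Ω ρ) {s : ℝ} (hs : 1 < s) :
    ∃ C : ℝ, 0 < C ∧ ∀ (U : Set (Cn n)) (t : ℝ), 0 < t → t ≤ ε →
      volume.real (tentOver Ω U t) ≤ C * volume.real (strip Ω U (s⁻¹ * t) t) := by
  have hθ : 0 < 1 - s⁻¹ := by rw [sub_pos]; exact inv_lt_one_of_one_lt₀ hs
  obtain ⟨N, hN⟩ := exists_nat_gt (1 / (1 - s⁻¹))
  have hN0 : 0 < (N : ℝ) := lt_trans (by positivity) hN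
  refine ⟨N * 2 ^ Module.finrank ℝ (Cn n), by positivity, fun U t ht htε => ?_⟩
  -- The width of the top strip. The tent is cut into at most `N` layers of this width; each full
  -- layer is slid onto the top one, and a layer cut off at height `t` already lies in it.
  set w := (1 - s⁻¹) * t with hw
  have hw0 : 0 < w := by positivity
  have htw : s⁻¹ * t = t - w := by rw [hw]; ring
  set top := strip Ω U (s⁻¹ * t) t with htop
  have hsub : tentOver Ω U t ⊆
      ⋃ k ∈ Finset.range N, strip Ω U (k * w) (min ((k + 1) * w) t) := by
    rintro z ⟨hz, hzU, hzt⟩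
    have hd : 0 ≤ dist (proj Ω z) z := dist_nonneg
    have h1 := Nat.floor_le (div_nonneg hd hw0.le)
    have h2 := Nat.lt_floor_add_one (dist (proj Ω z) z / w)
    rw [le_div_iff₀ hw0] at h1
    rw [div_lt_iff₀ hw0] at h2
    simp only [mem_iUnion, Finset.mem_range]
    refine ⟨⌊dist (proj Ω z) z / w⌋₊, ?_, hz, hzU, h1, lt_min h2 hzt⟩
    have h3 : t < N * w := by
      rw [div_lt_iff₀ hθ] at hN; rw [hw]; nlinarith
    have h4 : (⌊dist (proj Ω z) z / w⌋₊ : ℝ) * w < N * w := by linarith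
    exact_mod_cast lt_of_mul_lt_mul_right h4 hw0.le
  have hstrip : ∀ k ∈ Finset.range N, volume (strip Ω U (k * w) (min ((k + 1) * w) t)) ≤
      2 ^ Module.finrank ℝ (Cn n) * volume top := by
    intro k _
    rcases le_or_gt ((k + 1) * w) t with hk | hk
    · rw [min_eq_left hk]
      have := hν.measure_strip_le hΩ U (a := k * w) (b := (k + 1) * w) (σ := t - (k + 1) * w)
        (by linarith) (by linarith)
      convert this using 3
      rw [htop, htw]
      congr 1 <;> ring
    · rw [min_eq_right hk.le]
      refine (measure_mono ?_).trans (le_mul_of_one_le_left' (one_le_pow₀ one_le_two))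
      rintro z ⟨hz, hzU, hz1, hz2⟩
      refine ⟨hz, hzU, ?_, hz2⟩
      rw [htw]; linarith
  have hle : volume (tentOver Ω U t) ≤ (N * 2 ^ Module.finrank ℝ (Cn n)) * volume top := by
    refine (measure_mono hsub).trans ((measure_biUnion_finset_le _ _).trans ?_)
    refine (Finset.sum_le_sum hstrip).trans ?_
    rw [Finset.sum_const, Finset.card_range, nsmul_eq_mul, mul_assoc]
  have hfin : volume top ≠ ⊤ := ne_top_of_le_ne_top hΩ.measure_ne_top (measure_mono fun z hz => hz.1)
  have := ENNReal.toReal_mono (ENNReal.mul_ne_top (by finiteness) hfin) hle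
  simpa [Measure.real, ENNReal.toReal_mul] using this

/-- On the collar of width `t` the projection is Lipschitz, hence continuous, so the tent is a
relative preimage of a Borel set. -/
lemma measurableSet_tentOver (hν : IsNormalField Ω ρ ν K ε) (hΩ : IsSmoothBoundedDomain Ω ρ)
    {U : Set (Cn n)} (hU : MeasurableSet U) {t : ℝ} (ht : t ≤ ε) :
    MeasurableSet (tentOver Ω U t) := by
  set V : Set (Cn n) := Ω ∩ {z | Metric.infDist z (frontier Ω) < t} with hV
  have hVm : MeasurableSet V := hΩ.isOpen.measurableSet.inter
    (isOpen_lt (Metric.continuous_infDist_pt _) continuous_const).measurableSet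
  have hcont : ContinuousOn (proj Ω) V := by
    refine LipschitzOnWith.continuousOn (K := 2) (LipschitzOnWith.of_dist_le_mul ?_)
    intro x hx y hy
    rw [dist_eq_norm, dist_eq_norm]
    refine hν.proj_lipschitz hΩ hx.1 hy.1 ?_ ?_ <;> rw [hΩ.dist_proj]
    · exact hx.2.trans_le ht
    · exact hy.2.trans_le ht
  have h1 : MeasurableSet (V.domRestrict (proj Ω) ⁻¹' U) :=
    (continuousOn_iff_continuous_domRestrict.1 hcont).measurable hU
  have h2 := hVm.subtype_image h1
  convert h2 using 1
  ext z
  simp only [tentOver, hV, mem_image, mem_preimage, Subtype.exists, exists_and_right,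
    exists_eq_right, hΩ.dist_proj, mem_inter_iff, mem_ofPred_eq]
  tauto

end IsNormalField

end BekolleBonami

/-! ### Polydisc volumes and doubling of ball tents -/

namespace BekolleBonami

/-- A map that is Lipschitz from below does not decrease Haar measure by more than the dimensional
power of its constant. -/
lemma measure_le_of_antilipschitzOn {E : Type*} [NormedAddCommGroup E] [NormedSpace ℝ E]
    [FiniteDimensional ℝ E] [MeasurableSpace E] [BorelSpace E] (μ : Measure E) [μ.IsAddHaarMeasure]
    {L : NNReal} {f : E → E} {s : Set E} (hf : ∀ x ∈ s, ∀ y ∈ s, ‖x - y‖ ≤ L * ‖f x - f y‖) :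
    μ s ≤ (L : ℝ≥0∞) ^ Module.finrank ℝ E * μ (f '' s) := by
  have hinj : InjOn f s := fun x hx y hy h => by
    have := hf x hx y hy
    rw [h, sub_self, norm_zero, mul_zero] at this
    exact sub_eq_zero.1 (norm_le_zero_iff.1 this)
  rcases isEmpty_or_nonempty E with hE | hE
  · simp [Set.eq_empty_of_isEmpty s]
  have hg : LipschitzOnWith L (Function.invFunOn f s) (f '' s) := by
    refine LipschitzOnWith.of_dist_le_mul ?_
    rintro _ ⟨x, hx, rfl⟩ _ ⟨y, hy, rfl⟩
    rw [hinj.leftInvOn_invFunOn hx, hinj.leftInvOn_invFunOn hy, dist_eq_norm, dist_eq_norm]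
    exact hf x hx y hy
  have := measure_image_le_of_lipschitzOn μ hg
  rwa [hinj.leftInvOn_invFunOn.image_image] at this

/-- The centered polydisc with radii `σ`. -/
def box {n : ℕ} (σ : Fin n → ℝ) : Set (Cn n) := {w | ∀ j, ‖w j‖ < σ j}

lemma box_mono {n : ℕ} {σ σ' : Fin n → ℝ} (h : ∀ j, σ j ≤ σ' j) : box σ ⊆ box σ' :=
  fun _ hw j => (hw j).trans_le (h j)

open scoped Pointwise in
lemma volume_box_smul {n : ℕ} {c : ℝ} (hc : 0 < c) (σ : Fin n → ℝ) :
    volume (box fun j => c * σ j) =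
      ENNReal.ofReal (c ^ Module.finrank ℝ (Cn n)) * volume (box σ) := by
  have : (box fun j => c * σ j) = c • box σ := by
    ext w
    rw [mem_smul_set_iff_inv_smul_mem₀ hc.ne']
    refine forall_congr' fun j => ?_
    rw [PiLp.smul_apply, norm_smul, norm_inv, Real.norm_eq_abs, abs_of_pos hc,
      inv_mul_lt_iff₀ hc]
  rw [this, Measure.addHaar_smul, abs_of_pos (by positivity)]

lemma volume_box_pos {n : ℕ} {c : ℝ} (hc : 0 < c) : 0 < volume (box fun _ : Fin n => c) := by
  refine (Metric.measure_ball_pos volume (0 : Cn n) hc).trans_le (measure_mono fun w hw j => ?_)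
  exact (PiLp.norm_apply_le w j).trans_lt (by simpa using hw)

variable {n : ℕ} [NeZero n] {Ω : Set (Cn n)} {ρ : Cn n → ℝ} {qd : Cn n → Cn n → ℝ}

/-- The working form of the polydisc axioms: constants at least one, and positive radii. -/
structure PolydiscBounds (P : PolydiscSystem Ω ρ) (qd : Cn n → Cn n → ℝ) (L : NNReal)
    (A a δ : ℝ) : Prop where
  one_le_L : 1 ≤ L
  one_le_A : 1 ≤ A
  one_le_a : 1 ≤ a
  δ_pos : 0 < δ
  lipschitz : ∀ q ∈ frontier Ω, ∀ x ∈ Metric.ball q P.R, ∀ y ∈ Metric.ball q P.R,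
    ‖P.coord q x - P.coord q y‖ ≤ L * ‖x - y‖
  antilipschitz : ∀ q ∈ frontier Ω, ∀ x ∈ Metric.ball q P.R, ∀ y ∈ Metric.ball q P.R,
    ‖x - y‖ ≤ L * ‖P.coord q x - P.coord q y‖
  le_τ : ∀ q ∈ frontier Ω, ∀ t ∈ Ioo 0 δ, ∀ j, t ≤ A * P.τ q t j
  mono : ∀ q ∈ frontier Ω, ∀ s ∈ Ioo 0 δ, ∀ t ∈ Ioo 0 δ, s ≤ t → ∀ j, P.τ q s j ≤ P.τ q t j
  two_mul : ∀ q ∈ frontier Ω, ∀ t, 0 < t → 2 * t < δ → ∀ j, P.τ q (2 * t) j ≤ A * P.τ q t j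
  small : ∀ r > 0, ∃ t₁ > 0, t₁ ≤ δ ∧ ∀ q ∈ frontier Ω, ∀ t ∈ Ioo 0 t₁, ∀ z ∈ P.polydisc q t,
    ‖z - q‖ < r
  subset_image : ∀ q ∈ frontier Ω, ∀ t ∈ Ioo 0 δ, box (P.τ q t) ⊆ P.coord q '' Metric.ball q P.R
  variation : ∀ q ∈ frontier Ω, ∀ t ∈ Ioo 0 δ, ∀ z ∈ P.polydisc q t, |ρ z - ρ q| ≤ A * t
  polydisc_subset : ∀ q ∈ frontier Ω, ∀ t, 0 < t → a * t < δ →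
    P.polydisc q t ∩ frontier Ω ⊆ bdryBall Ω qd q (a * t)
  subset_polydisc : ∀ q ∈ frontier Ω, ∀ t, 0 < t → a * t < δ →
    bdryBall Ω qd q t ⊆ P.polydisc q (a * t)

lemma IsBoundaryQuasiMetric.exists_polydiscBounds {P : PolydiscSystem Ω ρ}
    (hqd : IsBoundaryQuasiMetric P qd) : ∃ L A a δ, PolydiscBounds P qd L A a δ := by
  obtain ⟨a, t₀, ha, ht₀, hat, hcomp⟩ := hqd.comparable
  have ha0 : 0 < a := by linarith
  set A := max P.A 1 with hA
  have hA1 : 1 ≤ A := le_max_right _ _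
  have hAP : P.A ≤ A := le_max_left _ _
  set L : NNReal := max P.L.toNNReal 1 with hL
  have hLP : P.L ≤ L := (Real.le_coe_toNNReal _).trans (by exact_mod_cast le_max_left _ _)
  set δ := min (a * t₀) 1 with hδ
  have hδ0 : 0 < δ := by positivity
  have hδδ : δ < P.δ₀ := (min_le_left _ _).trans_lt hat
  have hδa : δ ≤ a * t₀ := min_le_left _ _
  have hδ1 : δ ≤ 1 := min_le_right _ _
  have hIoo : ∀ t ∈ Ioo 0 δ, t ∈ Ioo 0 P.δ₀ := fun t ht => ⟨ht.1, ht.2.trans hδδ⟩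
  -- Positivity of the radii follows from `q ∈ B(q, t/a) ⊆ D(q, t)`. It is what allows the constant
  -- `P.A` to be enlarged to `max P.A 1` in bounds of the form `P.A * τ`.
  have hself : ∀ q ∈ frontier Ω, ∀ t ∈ Ioo 0 δ, ∀ j, 0 < P.τ q t j := by
    intro q hq t ht j
    have hta : t / a ∈ Ioo 0 t₀ := ⟨by have := ht.1; positivity, by
      rw [div_lt_iff₀ ha0]; linarith [ht.2]⟩
    have h1 := (hcomp q hq _ hta).2 ⟨hq, by
      rw [(hqd.eq_zero_iff q hq q hq).2 rfl]; exact hta.1⟩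
    rw [mul_div_cancel₀ _ ha0.ne'] at h1
    exact (norm_nonneg _).trans_lt (h1.1.2 j)
  have hlip : ∀ q ∈ frontier Ω, ∀ x ∈ Metric.ball q P.R, ∀ y ∈ Metric.ball q P.R,
      ‖x - y‖ ≤ L * ‖P.coord q x - P.coord q y‖ := fun q hq x hx y hy =>
    (P.coord_bilipschitz q hq x hx y hy).2.trans (mul_le_mul_of_nonneg_right hLP (norm_nonneg _))
  have hL0 : 0 < (L : ℝ) := lt_of_lt_of_le one_pos (by exact_mod_cast le_max_right _ _)
  refine ⟨L, A, a, δ, ⟨le_max_right _ _, hA1, ha, hδ0, ?_, hlip, ?_, ?_, ?_, ?_, ?_, ?_, ?_, ?_⟩⟩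
  · exact fun q hq x hx y hy => (P.coord_bilipschitz q hq x hx y hy).1.trans
      (mul_le_mul_of_nonneg_right hLP (norm_nonneg _))
  · intro q hq t ht j
    have hτ := hself q hq t ht j
    rcases eq_or_ne j 0 with rfl | hj
    · rw [P.τ_first q hq t (hIoo t ht)]
      nlinarith [ht.1]
    · have h1 := P.τ_lower q hq t (hIoo t ht) j hj
      have h2 : t ≤ t ^ (1 / 2 : ℝ) := by
        conv_lhs => rw [← Real.rpow_one t]
        exact Real.rpow_le_rpow_of_exponent_ge ht.1 (ht.2.le.trans hδ1) (by norm_num)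
      nlinarith
  · exact fun q hq s hs t ht hst j => P.τ_mono q hq s (hIoo s hs) t (hIoo t ht) hst j
  · intro q hq t ht ht2 j
    have h1 := P.τ_two_mul q hq t ht (ht2.trans hδδ) j
    have h2 := hself q hq t ⟨ht, by linarith⟩ j
    nlinarith
  · intro r hr
    have hlim : Filter.Tendsto (fun t : ℝ => L * (Real.sqrt n * (t + A * t ^ (1 / P.m : ℝ))))
        (nhds 0) (nhds 0) := by
      have hm : (0 : ℝ) < 1 / P.m := by have := P.m_pos; positivity
      have h1 : ContinuousAt (fun t : ℝ => L * (Real.sqrt n * (t + A * t ^ (1 / P.m : ℝ)))) 0 := by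
        have := Real.continuousAt_rpow_const 0 (1 / P.m : ℝ) (Or.inr hm.le)
        fun_prop
      have h2 := h1.tendsto
      simpa [Real.zero_rpow, P.m_pos.ne'] using h2
    have hev := hlim.eventually (gt_mem_nhds hr)
    obtain ⟨t₁, ht₁, hball⟩ := Metric.eventually_nhds_iff.1 hev
    refine ⟨min t₁ δ, by positivity, min_le_right _ _, fun q hq t ht z hz => ?_⟩
    have h1 : L * (Real.sqrt n * (t + A * t ^ (1 / P.m : ℝ))) < r := hball (by
      rw [Real.dist_eq, sub_zero, abs_of_pos ht.1]
      exact ht.2.trans_le (min_le_left _ _))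
    have htδ : t ∈ Ioo 0 δ := ⟨ht.1, ht.2.trans_le (min_le_right _ _)⟩
    have ht0 := ht.1
    have hq' : q ∈ Metric.ball q P.R := Metric.mem_ball_self P.R_pos
    have h2 := hlip q hq z hz.1 q hq'
    rw [P.coord_self q hq, sub_zero] at h2
    refine (h2.trans (mul_le_mul_of_nonneg_left ?_ hL0.le)).trans_lt h1
    rw [EuclideanSpace.norm_eq, ← Real.sqrt_sq (x := t + A * t ^ (1 / P.m : ℝ)) (by positivity),
      ← Real.sqrt_mul (by positivity)]
    apply Real.sqrt_le_sqrt
    have h3 : ∀ j, ‖P.coord q z j‖ ^ 2 ≤ (t + A * t ^ (1 / P.m : ℝ)) ^ 2 := by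
      intro j
      refine pow_le_pow_left₀ (norm_nonneg _) ((hz.2 j).le.trans ?_) 2
      rcases eq_or_ne j 0 with rfl | hj
      · rw [P.τ_first q hq t (hIoo t htδ)]
        have : 0 ≤ A * t ^ (1 / P.m : ℝ) := by positivity
        linarith
      · have h4 := P.τ_upper q hq t (hIoo t htδ) j hj
        have h5 : P.A * t ^ (1 / P.m : ℝ) ≤ A * t ^ (1 / P.m : ℝ) :=
          mul_le_mul_of_nonneg_right hAP (by positivity)
        linarith
    refine (Finset.sum_le_sum fun j _ => h3 j).trans ?_
    simp
  · exact fun q hq t ht => P.polydisc_subset q hq t (hIoo t ht)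
  · exact fun q hq t ht z hz => (P.defining_variation q hq t (hIoo t ht) z hz.1 hz.2).trans
      (mul_le_mul_of_nonneg_right hAP ht.1.le)
  · exact fun q hq t ht hta => (hcomp q hq t ⟨ht, by
      have : a * t < a * t₀ := hta.trans_le hδa
      exact lt_of_mul_lt_mul_left this ha0.le⟩).1
  · exact fun q hq t ht hta => (hcomp q hq t ⟨ht, by
      have : a * t < a * t₀ := hta.trans_le hδa
      exact lt_of_mul_lt_mul_left this ha0.le⟩).2.trans inter_subset_left

end BekolleBonami

namespace BekolleBonami

variable {n : ℕ} [NeZero n] {Ω : Set (Cn n)} {ρ : Cn n → ℝ} {qd : Cn n → Cn n → ℝ}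
  {P : PolydiscSystem Ω ρ} {L : NNReal} {A a δ : ℝ}

namespace PolydiscBounds

lemma τ_pos (h : PolydiscBounds P qd L A a δ) {q : Cn n} (hq : q ∈ frontier Ω) {t : ℝ}
    (ht : t ∈ Ioo 0 δ) (j : Fin n) : 0 < P.τ q t j := by
  have h1 := h.le_τ q hq t ht j
  have h2 := h.one_le_A
  have h3 := ht.1
  by_contra! hcon
  nlinarith

/-- A ball tent is contained in a polydisc of comparable size. -/
lemma exists_measure_tentOver_le (h : PolydiscBounds P qd L A a δ) :
    ∃ t₁ > 0, a * t₁ ≤ δ ∧ ∀ q ∈ frontier Ω, ∀ t ∈ Ioo 0 t₁,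
      volume (tentOver Ω (bdryBall Ω qd q t) t) ≤ (L : ℝ≥0∞) ^ Module.finrank ℝ (Cn n) *
        volume (box fun j => (1 + L * A) * P.τ q (a * t) j) := by
  have ha := h.one_le_a
  have hR := P.R_pos
  have hL1 : 1 ≤ (L : ℝ) := by exact_mod_cast h.one_le_L
  obtain ⟨t₂, ht₂, ht₂δ, hsmall⟩ := h.small (P.R / 2) (by linarith)
  refine ⟨min (t₂ / a) (P.R / 2), by positivity, ?_, fun q hq t ht => ?_⟩
  · calc a * min (t₂ / a) (P.R / 2) ≤ a * (t₂ / a) :=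
          mul_le_mul_of_nonneg_left (min_le_left _ _) (by linarith)
      _ = t₂ := by field_simp
      _ ≤ δ := ht₂δ
  have ht0 := ht.1
  have hat : a * t < t₂ := by
    have := ht.2.trans_le (min_le_left _ _)
    rwa [lt_div_iff₀ (by positivity), mul_comm] at this
  have htR : t < P.R / 2 := ht.2.trans_le (min_le_right _ _)
  have haδ : a * t ∈ Ioo 0 δ := ⟨by positivity, hat.trans_le ht₂δ⟩
  -- The foot of `z` lies in `D(q, at)`. Moving from it to `z` changes the coordinates by at most `L
  -- t`, which is at most `L A τ_j(q, at)`.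
  have key : ∀ z ∈ tentOver Ω (bdryBall Ω qd q t) t, z ∈ Metric.ball q P.R ∧
      P.coord q z ∈ box fun j => (1 + L * A) * P.τ q (a * t) j := by
    rintro z ⟨-, hzU, hzt⟩
    have h1 := h.subset_polydisc q hq t ht0 haδ.2 hzU
    have h2 := hsmall q hq (a * t) ⟨haδ.1, hat⟩ _ h1
    rw [dist_comm] at hzt
    have hzR : z ∈ Metric.ball q P.R := by
      rw [← dist_eq_norm] at h2
      rw [Metric.mem_ball]
      linarith [dist_triangle z (proj Ω z) q]
    refine ⟨hzR, fun j => ?_⟩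
    have h3 := h.lipschitz q hq z hzR _ h1.1
    rw [← dist_eq_norm z] at h3
    have h4 : ‖P.coord q z j‖ ≤ ‖P.coord q (proj Ω z) j‖ +
        ‖P.coord q z - P.coord q (proj Ω z)‖ := by
      have := PiLp.norm_apply_le (P.coord q z - P.coord q (proj Ω z)) j
      rw [PiLp.sub_apply] at this
      have h5 := norm_sub_norm_le (P.coord q z j) (P.coord q (proj Ω z) j)
      linarith
    have h5 := h1.2 j
    have h6 := h.le_τ q hq _ haδ j
    have h7 : L * dist z (proj Ω z) ≤ L * (A * P.τ q (a * t) j) :=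
      mul_le_mul_of_nonneg_left (by nlinarith) (by positivity)
    linarith
  refine (measure_le_of_antilipschitzOn volume (L := L) (f := P.coord q) fun x hx y hy =>
    h.antilipschitz q hq x (key x hx).1 y (key y hy).1).trans ?_
  gcongr
  rintro _ ⟨z, hz, rfl⟩
  exact (key z hz).2

/-- A ball tent contains a translate of a polydisc of comparable size. -/
lemma exists_le_measure_tentOver (h : PolydiscBounds P qd L A a δ)
    (hΩ : IsSmoothBoundedDomain Ω ρ) {ν : Cn n → Cn n} {K ε : ℝ}
    (hν : IsNormalField Ω ρ ν K ε) :
    ∃ θ > 0, θ ≤ 1 ∧ ∃ t₁ > 0, t₁ ≤ δ ∧ ∀ q ∈ frontier Ω, ∀ t ∈ Ioo 0 t₁,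
      volume (box fun j => 2⁻¹ * P.τ q (θ * t) j) ≤ (L : ℝ≥0∞) ^ Module.finrank ℝ (Cn n) *
        volume (tentOver Ω (bdryBall Ω qd q t) t) := by
  obtain ⟨c, hc, hgrow⟩ := hν.growth
  have hε := hν.pos
  have ha := h.one_le_a
  have hA := h.one_le_A
  have hδ := h.δ_pos
  have hR := P.R_pos
  have hL1 : 1 ≤ (L : ℝ) := by exact_mod_cast h.one_le_L
  have hL0 : 0 < (L : ℝ) := by linarith
  have ha0 : 0 < a := by linarith
  have hA0 : 0 < A := by linarith
  obtain ⟨t₂, ht₂, ht₂δ, hsmall⟩ := h.small (min (ε / 2) (P.R / 2)) (by positivity)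
  -- A polydisc of size `θt` is pushed inward by `κt`. The relation `cκ = 2Aθ` makes the push beat
  -- the variation `Aθt` of `ρ`, and `θ` is small enough that a displacement of `3κt` costs at most
  -- half of `τ_j(q, t/a)`.
  set θ := min (1 / a) (c / (12 * L * a * A ^ 2)) with hθ
  have hθ0 : 0 < θ := by positivity
  have hθa : θ ≤ 1 / a := min_le_left _ _
  have hθ1 : θ ≤ 1 := hθa.trans (by rw [div_le_one ha0]; exact ha)
  set κ := 2 * A * θ / c with hκ
  have hκ0 : 0 < κ := by positivity
  have hcκ : c * κ = 2 * A * θ := by rw [hκ]; field_simp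
  have hκ1 : 6 * L * a * A * κ ≤ 1 := by
    have : θ ≤ c / (12 * L * a * A ^ 2) := min_le_right _ _
    rw [le_div_iff₀ (by positivity)] at this
    have e : 6 * L * a * A * κ = θ * (12 * L * a * A ^ 2) / c := by rw [hκ]; field_simp; ring
    rw [e, div_le_one hc]; exact this
  have hκ2 : 6 * κ ≤ 1 := by
    have h1 : 1 ≤ L * a * A := one_le_mul_of_one_le_of_one_le
      (one_le_mul_of_one_le_of_one_le hL1 ha) hA
    nlinarith
  refine ⟨θ, hθ0, hθ1, min t₂ (min ε P.R), by positivity, (min_le_left _ _).trans ht₂δ,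
    fun q hq t ht => ?_⟩
  have ht0 := ht.1
  have htt₂ : t < t₂ := ht.2.trans_le (min_le_left _ _)
  have htε : t < ε := ht.2.trans_le ((min_le_right _ _).trans (min_le_left _ _))
  have htR : t < P.R := ht.2.trans_le ((min_le_right _ _).trans (min_le_right _ _))
  have hθt : θ * t ∈ Ioo 0 t₂ := ⟨by positivity, by nlinarith⟩
  have hθδ : θ * t ∈ Ioo 0 δ := ⟨hθt.1, hθt.2.trans_le ht₂δ⟩
  have hta : t / a ∈ Ioo 0 δ := ⟨by positivity, (div_le_self ht0.le ha).trans_lt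
    (htt₂.trans_le ht₂δ)⟩
  set S : Set (Cn n) := {z ∈ Metric.ball q P.R | P.coord q z ∈ box fun j => 2⁻¹ * P.τ q (θ * t) j}
    with hS
  have hbox : (box fun j => 2⁻¹ * P.τ q (θ * t) j) ⊆ P.coord q '' S := by
    intro w hw
    obtain ⟨z, hz, rfl⟩ := h.subset_image q hq _ hθδ (box_mono (fun j => by
      have := h.τ_pos hq hθδ j; linarith) hw)
    exact ⟨z, ⟨hz, hw⟩, rfl⟩
  have hSlip : LipschitzOnWith L (P.coord q) S := by
    refine LipschitzOnWith.of_dist_le_mul fun x hx y hy => ?_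
    rw [dist_eq_norm, dist_eq_norm]
    exact h.lipschitz q hq x hx.1 y hy.1
  refine (measure_mono hbox).trans ((measure_image_le_of_lipschitzOn volume hSlip).trans ?_)
  refine mul_le_mul_right ?_ _
  -- The point pushed inward lies in `Ω` and the one pushed outward does not, so the boundary is met
  -- within `2κt` of the former. Its foot is thus within `3κt` of `z`, and lies in `D(q, t/a) ∩ bΩ ⊆
  -- B(q, t)`.
  have hsub : S ⊆ (fun z => z + -((κ * t) • ν q)) ⁻¹' tentOver Ω (bdryBall Ω qd q t) t := by
    rintro z ⟨hzR, hzbox⟩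
    have hκt : 0 < κ * t := by positivity
    have hκt6 : 6 * (κ * t) ≤ t := by nlinarith
    have hzP : z ∈ P.polydisc q (θ * t) := ⟨hzR, fun j => (hzbox j).trans (by
      have := h.τ_pos hq hθδ j; linarith)⟩
    have hzq := hsmall q hq _ hθt z hzP
    have hzq1 : ‖z - q‖ < ε / 2 := hzq.trans_le (min_le_left _ _)
    have hzq2 : ‖z - q‖ < P.R / 2 := hzq.trans_le (min_le_right _ _)
    have hρ := h.variation q hq _ hθδ z hzP
    rw [hΩ.eq_zero_of_mem_frontier hq, sub_zero] at hρ
    have hν1 := hν.norm_eq q hq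
    set z' := z + -((κ * t) • ν q) with hz'
    have hzz' : dist z' z = κ * t := by
      rw [dist_eq_norm, hz', add_sub_cancel_left, norm_neg, norm_smul, hν1, mul_one,
        Real.norm_eq_abs, abs_of_pos hκt]
    have hAθ : 0 < A * (θ * t) := by positivity
    have hcκt : c * (κ * t) = 2 * (A * (θ * t)) := by rw [← mul_assoc, hcκ]; ring
    have hz'Ω : z' ∈ Ω := by
      rw [hΩ.eq_sublevel, mem_ofPred_eq]
      have h1 := hgrow q hq z' (by
        rw [Metric.mem_ball]
        have := dist_triangle z' z q
        rw [dist_eq_norm z q] at this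
        linarith) (κ * t) hκt (by linarith)
      rw [hz', neg_add_cancel_right, ← hz'] at h1
      linarith [(abs_le.1 hρ).2]
    have hz''Ω : z + (κ * t) • ν q ∉ Ω := by
      rw [hΩ.eq_sublevel, mem_ofPred_eq, not_lt]
      have h1 := hgrow q hq z (by
        rw [Metric.mem_ball, dist_eq_norm]; linarith) (κ * t) hκt (by linarith)
      linarith [(abs_le.1 hρ).1]
    have hdist : dist (proj Ω z') z' ≤ 2 * (κ * t) := by
      obtain ⟨p, hp, hpf⟩ := hΩ.exists_mem_frontier
        (convex_closedBall z' (2 * (κ * t))).isPreconnected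
        (Metric.mem_closedBall_self (by positivity)) hz'Ω
        (show z + (κ * t) • ν q ∈ Metric.closedBall z' (2 * (κ * t)) by
          rw [Metric.mem_closedBall, dist_eq_norm, hz',
            show z + (κ * t) • ν q - (z + -((κ * t) • ν q)) = (2 * (κ * t)) • ν q by
              rw [_root_.two_mul, add_smul]; abel, norm_smul, hν1, mul_one, Real.norm_eq_abs,
            abs_of_pos (by positivity)]) hz''Ω
      rw [hΩ.dist_proj]
      refine (Metric.infDist_le_dist_of_mem hpf).trans ?_
      rw [dist_comm]; exact hp
    have hpz : dist (proj Ω z') z ≤ 3 * (κ * t) := by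
      linarith [dist_triangle (proj Ω z') z' z]
    have hpR : proj Ω z' ∈ Metric.ball q P.R := by
      rw [Metric.mem_ball]
      have := dist_triangle (proj Ω z') z q
      rw [dist_eq_norm z q] at this
      linarith
    have hpP : proj Ω z' ∈ P.polydisc q (t / a) := by
      refine ⟨hpR, fun j => ?_⟩
      have h3 := h.lipschitz q hq _ hpR z hzR
      rw [← dist_eq_norm (proj Ω z')] at h3
      have h4 := PiLp.norm_apply_le (P.coord q (proj Ω z') - P.coord q z) j
      rw [PiLp.sub_apply] at h4
      have h5 := norm_sub_norm_le (P.coord q (proj Ω z') j) (P.coord q z j)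
      have h6 := hzbox j
      have h7 := h.mono q hq _ hθδ _ hta (by
        rw [div_eq_inv_mul]; exact mul_le_mul_of_nonneg_right (by rwa [one_div] at hθa) ht0.le) j
      have h8 := h.le_τ q hq _ hta j
      have h9 : L * dist (proj Ω z') z ≤ L * (3 * (κ * t)) :=
        mul_le_mul_of_nonneg_left hpz hL0.le
      have h10 : 2 * (L * (3 * (κ * t))) ≤ P.τ q (t / a) j := by
        have h11 : A * (2 * (L * (3 * (κ * t)))) ≤ t / a := by
          rw [le_div_iff₀ ha0]
          calc A * (2 * (L * (3 * (κ * t)))) * a = (6 * L * a * A * κ) * t := by ring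
            _ ≤ 1 * t := mul_le_mul_of_nonneg_right hκ1 ht0.le
            _ = t := one_mul t
        exact le_of_mul_le_mul_left (h11.trans h8) hA0
      linarith
    refine ⟨hz'Ω, ?_, by linarith⟩
    have h1 := h.polydisc_subset q hq (t / a) hta.1 (by
      rw [mul_div_cancel₀ _ ha0.ne']; exact htt₂.trans_le ht₂δ) ⟨hpP, hΩ.proj_mem z'⟩
    rwa [mul_div_cancel₀ _ ha0.ne'] at h1
  refine (measure_mono hsub).trans ?_
  rw [measure_preimage_add_right]

end PolydiscBounds

lemma PolydiscBounds.pow_mul (h : PolydiscBounds P qd L A a δ) {q : Cn n} (hq : q ∈ frontier Ω)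
    (k : ℕ) {t : ℝ} (ht : 0 < t) (htk : 2 ^ k * t < δ) (j : Fin n) :
    P.τ q (2 ^ k * t) j ≤ A ^ k * P.τ q t j := by
  induction k with
  | zero => simp
  | succ k ih =>
    have hA := h.one_le_A
    have h1 : 2 * (2 ^ k * t) < δ := by rw [pow_succ'] at htk; linarith
    have h2 : 0 < 2 ^ k * t := by positivity
    have h3 := h.two_mul q hq _ h2 h1 j
    have h4 := ih (by linarith)
    rw [pow_succ', mul_assoc, pow_succ', mul_assoc]
    exact h3.trans (mul_le_mul_of_nonneg_left h4 (by linarith))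

/-- Ball tents of a given size have measure bounded below. -/
lemma PolydiscBounds.exists_pos_le_measure (h : PolydiscBounds P qd L A a δ)
    (hΩ : IsSmoothBoundedDomain Ω ρ) {ν : Cn n → Cn n} {K ε : ℝ}
    (hν : IsNormalField Ω ρ ν K ε) {t : ℝ} (ht : 0 < t) :
    ∃ c > 0, ∀ q ∈ frontier Ω, c ≤ volume.real (tentOver Ω (bdryBall Ω qd q t) t) := by
  obtain ⟨θ, hθ, hθ1, t₁, ht₁, ht₁δ, hlow⟩ := h.exists_le_measure_tentOver hΩ hν
  have hA : 0 < A := by linarith [h.one_le_A]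
  set s := min t (t₁ / 2) with hs
  have hs0 : 0 < s := by positivity
  have hst₁ : s < t₁ := (min_le_right _ _).trans_lt (by linarith)
  have hL0 : (L : ℝ≥0∞) ≠ 0 := by
    have := h.one_le_L
    exact_mod_cast (zero_lt_one.trans_le this).ne'
  set D := Module.finrank ℝ (Cn n) with hD
  set b := volume (box fun _ : Fin n => 2⁻¹ * (θ * s / A)) with hb
  have hb0 : 0 < b := volume_box_pos (by positivity)
  have hbL : 0 < b / (L : ℝ≥0∞) ^ D := ENNReal.div_pos hb0.ne' (by finiteness)
  have hmain : ∀ q ∈ frontier Ω, b / (L : ℝ≥0∞) ^ D ≤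
      volume (tentOver Ω (bdryBall Ω qd q t) t) := by
    intro q hq
    have h1 := hlow q hq s ⟨hs0, hst₁⟩
    have hθs : θ * s ∈ Ioo 0 δ := ⟨by positivity, by nlinarith⟩
    have h2 : b ≤ volume (box fun j => 2⁻¹ * P.τ q (θ * s) j) := by
      refine measure_mono (box_mono fun j => ?_)
      have := h.le_τ q hq _ hθs j
      refine mul_le_mul_of_nonneg_left ?_ (by norm_num)
      rw [div_le_iff₀ hA]; linarith
    have h3 : volume (tentOver Ω (bdryBall Ω qd q s) s) ≤
        volume (tentOver Ω (bdryBall Ω qd q t) t) :=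
      measure_mono (tentOver_mono (fun x hx => ⟨hx.1, hx.2.trans_le (min_le_left _ _)⟩)
        (min_le_left _ _))
    rw [ENNReal.div_le_iff_le_mul (Or.inl (pow_ne_zero _ hL0)) (Or.inl (by finiteness)), mul_comm]
    refine (h2.trans h1).trans ?_
    gcongr
  have hfin : ∀ q, volume (tentOver Ω (bdryBall Ω qd q t) t) ≠ ⊤ := fun q =>
    ne_top_of_le_ne_top hΩ.measure_ne_top (measure_mono tentOver_subset)
  obtain ⟨q₀, hq₀⟩ := hΩ.frontier_nonempty
  have hbt : b / (L : ℝ≥0∞) ^ D ≠ ⊤ := ne_top_of_le_ne_top (hfin q₀) (hmain q₀ hq₀)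
  exact ⟨(b / (L : ℝ≥0∞) ^ D).toReal, ENNReal.toReal_pos hbL.ne' hbt, fun q hq =>
    ENNReal.toReal_mono (hfin q) (hmain q hq)⟩

/-- The measure of ball tents is doubling. -/
lemma PolydiscBounds.exists_doubling (h : PolydiscBounds P qd L A a δ)
    (hΩ : IsSmoothBoundedDomain Ω ρ) {ν : Cn n → Cn n} {K ε : ℝ}
    (hν : IsNormalField Ω ρ ν K ε) {lam : ℝ} (hlam : 1 ≤ lam) :
    ∃ C > 0, ∀ q ∈ frontier Ω, ∀ t > 0,
      volume.real (tentOver Ω (bdryBall Ω qd q (lam * t)) (lam * t)) ≤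
        C * volume.real (tentOver Ω (bdryBall Ω qd q t) t) := by
  obtain ⟨θ, hθ, hθ1, t₁, ht₁, ht₁δ, hlow⟩ := h.exists_le_measure_tentOver hΩ hν
  obtain ⟨t₂, ht₂, ht₂δ, hup⟩ := h.exists_measure_tentOver_le
  have hA : 0 < A := by linarith [h.one_le_A]
  have ha : 0 < a := by linarith [h.one_le_a]
  have hδ := h.δ_pos
  have hlam0 : 0 < lam := by linarith
  -- The outer polydisc has size `a lam t` and the inner one `θt`; `k` doublings lead from the inner
  -- to the outer.
  obtain ⟨k, hk⟩ := pow_unbounded_of_one_lt (a * lam / θ) (one_lt_two (α := ℝ))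
  rw [div_lt_iff₀ hθ] at hk
  set D := Module.finrank ℝ (Cn n) with hD
  set c := 2 * (1 + L * A) * A ^ k with hc
  have hc0 : 0 < c := by positivity
  -- Below this scale the two polydisc bounds apply. Above it the volumes are bounded below
  -- uniformly, and above by that of `Ω`.
  set t₃ := min (min t₁ (t₂ / lam)) (δ / 2 ^ k) with ht₃
  have ht₃0 : 0 < t₃ := by positivity
  obtain ⟨m, hm, hlarge⟩ := h.exists_pos_le_measure hΩ hν (half_pos ht₃0)
  have hfin : ∀ q s, volume (tentOver Ω (bdryBall Ω qd q s) s) ≠ ⊤ := fun q s =>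
    ne_top_of_le_ne_top hΩ.measure_ne_top (measure_mono tentOver_subset)
  set C₁ : ℝ := L ^ D * (c ^ D * L ^ D) with hC₁
  have hC₁0 : 0 ≤ C₁ := by positivity
  set C₂ : ℝ := volume.real Ω / m with hC₂
  have hC₂0 : 0 ≤ C₂ := by positivity
  refine ⟨C₁ + C₂ + 1, by positivity, fun q hq t ht => ?_⟩
  have hVt : 0 ≤ volume.real (tentOver Ω (bdryBall Ω qd q t) t) := measureReal_nonneg
  rcases lt_or_ge t t₃ with hlt | hge
  · have h1 : t < t₁ := hlt.trans_le ((min_le_left _ _).trans (min_le_left _ _))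
    have h2 : lam * t < t₂ := by
      have := hlt.trans_le ((min_le_left _ _).trans (min_le_right _ _))
      rwa [lt_div_iff₀ hlam0, mul_comm] at this
    have h3 : 2 ^ k * t < δ := by
      have := hlt.trans_le (min_le_right _ _)
      rwa [lt_div_iff₀ (by positivity), mul_comm] at this
    have h4 : 2 ^ k * (θ * t) < δ := by
      have : θ * t ≤ t := by nlinarith
      have := mul_le_mul_of_nonneg_left this (by positivity : (0:ℝ) ≤ 2 ^ k)
      linarith
    have h5 : a * (lam * t) ≤ 2 ^ k * (θ * t) := by nlinarith
    have hbox : volume (box fun j => (1 + L * A) * P.τ q (a * (lam * t)) j) ≤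
        ENNReal.ofReal (c ^ D) * volume (box fun j => 2⁻¹ * P.τ q (θ * t) j) := by
      rw [hD, ← volume_box_smul hc0]
      refine measure_mono (box_mono fun j => ?_)
      have h6 := h.mono q hq (a * (lam * t)) ⟨by positivity, by linarith⟩ (2 ^ k * (θ * t))
        ⟨by positivity, h4⟩ h5 j
      have h7 := h.pow_mul hq k (by positivity : 0 < θ * t) h4 j
      have h8 : (1 + L * A) * P.τ q (a * (lam * t)) j ≤
          (1 + L * A) * (A ^ k * P.τ q (θ * t) j) :=
        mul_le_mul_of_nonneg_left (h6.trans h7) (by positivity)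
      refine h8.trans_eq ?_
      rw [hc]; ring
    have h9 := (hup q hq (lam * t) ⟨by positivity, h2⟩).trans
      (mul_le_mul_right (hbox.trans (mul_le_mul_right (hlow q hq t ⟨ht, h1⟩) _)) _)
    have h10 := ENNReal.toReal_mono (by have := hfin q t; finiteness) h9
    simp only [ENNReal.toReal_mul, ENNReal.toReal_pow, ENNReal.coe_toReal,
      ENNReal.toReal_ofReal (pow_nonneg hc0.le D)] at h10
    change volume.real _ ≤ L ^ D * (c ^ D * (L ^ D * volume.real _)) at h10
    have e : (L : ℝ) ^ D * (c ^ D * (L ^ D * volume.real (tentOver Ω (bdryBall Ω qd q t) t))) =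
      C₁ * volume.real (tentOver Ω (bdryBall Ω qd q t) t) := by rw [hC₁]; ring
    rw [e] at h10
    nlinarith
  · have h1 : volume.real (tentOver Ω (bdryBall Ω qd q (lam * t)) (lam * t)) ≤ volume.real Ω :=
      measureReal_mono tentOver_subset hΩ.measure_ne_top
    have h2 : m ≤ volume.real (tentOver Ω (bdryBall Ω qd q t) t) :=
      (hlarge q hq).trans (measureReal_mono (tentOver_mono
        (fun x hx => ⟨hx.1, hx.2.trans_le (by linarith)⟩) (by linarith)) (hfin q t))
    have h3 : volume.real Ω = C₂ * m := by rw [hC₂]; field_simp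
    nlinarith

end BekolleBonami

/-! ### Tents and kubes of a dyadic system -/

namespace BekolleBonami

variable {n : ℕ} {Ω : Set (Cn n)} {ρ : Cn n → ℝ} {qd : Cn n → Cn n → ℝ}

/-- Ball tents of a given size have measure bounded below, and their measure is doubling. -/
structure IsDoublingTents (Ω : Set (Cn n)) (qd : Cn n → Cn n → ℝ) : Prop where
  lower : ∀ t > 0, ∃ c > 0, ∀ q ∈ frontier Ω,
    c ≤ volume.real (tentOver Ω (bdryBall Ω qd q t) t)
  doubling : ∀ lam : ℝ, 1 ≤ lam → ∃ C > 0, ∀ q ∈ frontier Ω, ∀ t > 0,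
    volume.real (tentOver Ω (bdryBall Ω qd q (lam * t)) (lam * t)) ≤
      C * volume.real (tentOver Ω (bdryBall Ω qd q t) t)

namespace DyadicSystem

variable (S : DyadicSystem Ω qd) {h : ℝ}

/-- The generation of a tent, counted from the root. -/
def gen : S.Idx → ℕ
  | none => 0
  | some ⟨k, _⟩ => k + 1

lemma s_pos : 0 < S.s := one_pos.trans S.one_lt_s

lemma inv_pow_pos (k : ℕ) : 0 < (S.s ^ k)⁻¹ := inv_pos.2 (pow_pos S.s_pos k)

lemma inv_pow_anti {k l : ℕ} (hkl : k ≤ l) : (S.s ^ l)⁻¹ ≤ (S.s ^ k)⁻¹ :=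
  inv_anti₀ (pow_pos S.s_pos k) (pow_le_pow_right₀ S.one_lt_s.le hkl)

lemma pt_mem_frontier (k : ℕ) (j : S.ι k) : S.pt k j ∈ frontier Ω := by
  rw [← S.iUnion_Q k]
  exact mem_iUnion.2 ⟨j, S.pt_mem k j⟩

lemma exists_mem_Q (k : ℕ) {p : Cn n} (hp : p ∈ frontier Ω) : ∃ j, p ∈ S.Q k j := by
  rw [← S.iUnion_Q k] at hp
  exact mem_iUnion.1 hp

lemma eq_of_mem_Q {k : ℕ} {i j : S.ι k} {p : Cn n} (hi : p ∈ S.Q k i) (hj : p ∈ S.Q k j) :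
    i = j := by
  by_contra hne
  exact Set.disjoint_left.1 (S.disjoint_Q k i j hne) hi hj

lemma Q_subset {k l : ℕ} (hkl : k < l) {j : S.ι k} {i : S.ι l} {p : Cn n} (hj : p ∈ S.Q k j)
    (hi : p ∈ S.Q l i) : S.Q l i ⊆ S.Q k j :=
  (S.nested k l hkl j i).resolve_right fun hd => Set.disjoint_left.1 hd hj hi

lemma smallTent_subset (hh : 0 < h) {k l : ℕ} (hkl : k ≤ l) {j : S.ι k} {i : S.ι l} {p : Cn n}
    (hj : p ∈ S.Q k j) (hi : p ∈ S.Q l i) : S.smallTent h l i ⊆ S.smallTent h k j := by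
  rcases hkl.eq_or_lt with rfl | hlt
  · rw [S.eq_of_mem_Q hj hi]
  · exact tentOver_mono (S.Q_subset hlt hj hi)
      (mul_le_mul_of_nonneg_right (S.inv_pow_anti hkl) hh.le)

lemma exists_generation {d : ℝ} (hd : 0 < d) (hdh : d < h) :
    ∃ k : ℕ, (S.s ^ (k + 1))⁻¹ * h ≤ d ∧ d < (S.s ^ k)⁻¹ * h := by
  have hex : ∃ m : ℕ, (S.s ^ m)⁻¹ * h ≤ d := by
    obtain ⟨m, hm⟩ := pow_unbounded_of_one_lt (h / d) S.one_lt_s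
    refine ⟨m, ?_⟩
    rw [div_lt_iff₀ hd] at hm
    rw [inv_mul_le_iff₀ (pow_pos S.s_pos m)]
    exact hm.le
  classical
  have hm := Nat.find_spec hex
  have hmin := fun k => Nat.find_min hex (m := k)
  rcases hk : Nat.find hex with _ | k
  · rw [hk] at hm; simp at hm; linarith
  · rw [hk] at hm
    exact ⟨k, hm, not_le.1 (hmin k (by omega))⟩

lemma tent_subset (h : ℝ) (i : S.Idx) : S.tent h i ⊆ Ω := by
  rcases i with _ | ⟨k, j⟩
  · exact Subset.rfl
  · exact tentOver_subset

lemma kube_subset_tent (h : ℝ) (i : S.Idx) : S.kube h i ⊆ S.tent h i := by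
  rcases i with _ | ⟨k, j⟩ <;> exact sdiff_subset

lemma disjoint_of_gen_eq (i j : S.Idx) (hne : i ≠ j) (hg : S.gen i = S.gen j) :
    Disjoint (S.tent h i) (S.tent h j) := by
  rcases i with _ | ⟨k, i⟩ <;> rcases j with _ | ⟨l, j⟩
  · exact absurd rfl hne
  · simp [gen] at hg
  · simp [gen] at hg
  · obtain rfl : k = l := Nat.succ_injective hg
    have hij : i ≠ j := fun hij => hne (by rw [hij])
    refine Set.disjoint_left.2 fun z hz hz' => ?_
    exact Set.disjoint_left.1 (S.disjoint_Q k i j hij) hz.2.1 hz'.2.1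

lemma nested_tent (hh : 0 < h) (i j : S.Idx) (hg : S.gen i < S.gen j) :
    S.tent h j ⊆ S.tent h i ∨ Disjoint (S.tent h i) (S.tent h j) := by
  rcases i with _ | ⟨k, i⟩ <;> rcases j with _ | ⟨l, j⟩
  · simp [gen] at hg
  · exact Or.inl (S.tent_subset h _)
  · simp [gen] at hg
  · have hkl : k < l := by simpa [gen] using hg
    rcases S.nested k l hkl i j with hs | hd
    · exact Or.inl (tentOver_mono hs (mul_le_mul_of_nonneg_right (S.inv_pow_anti hkl.le) hh.le))
    · exact Or.inr (Set.disjoint_left.2 fun z hz hz' => Set.disjoint_left.1 hd hz.2.1 hz'.2.1)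

/-- Dyadic tents are comparable with ball tents about their reference points. -/
lemma exists_tent_comparable (hh : 0 < h) :
    ∃ t₀ > 0, ∃ lam : ℝ, 1 ≤ lam ∧ ∀ k (j : S.ι k),
      tentOver Ω (bdryBall Ω qd (S.pt k j) ((S.s ^ k)⁻¹ * t₀)) ((S.s ^ k)⁻¹ * t₀) ⊆
        S.smallTent h k j ∧
      S.smallTent h k j ⊆ tentOver Ω (bdryBall Ω qd (S.pt k j) (lam * ((S.s ^ k)⁻¹ * t₀)))
        (lam * ((S.s ^ k)⁻¹ * t₀)) := by
  obtain ⟨c, C, hc, hC, hsand⟩ := S.sandwich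
  have hδ := S.δ_pos
  -- The width `δ` of the base and the height `h` of the tent are independent, so the inner ball
  -- tent uses the smaller of the two scales and the outer one the larger.
  set t₀ := min (c * S.δ) h with ht₀
  have ht₀0 : 0 < t₀ := by positivity
  set lam := max 1 (max (C * S.δ) h / t₀) with hlam
  have hlam1 : max (C * S.δ) h ≤ lam * t₀ := by
    rw [← div_le_iff₀ ht₀0]; exact le_max_right _ _
  refine ⟨t₀, ht₀0, lam, le_max_left _ _, fun k j => ⟨?_, ?_⟩⟩
  · have hs := S.inv_pow_pos k
    have h1 := mul_le_mul_of_nonneg_left (min_le_left (c * S.δ) h) hs.le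
    have h2 : bdryBall Ω qd (S.pt k j) ((S.s ^ k)⁻¹ * t₀) ⊆
        bdryBall Ω qd (S.pt k j) (c * ((S.s ^ k)⁻¹ * S.δ)) := fun x hx =>
      ⟨hx.1, hx.2.trans_le (h1.trans_eq (by ring))⟩
    exact tentOver_mono (h2.trans (hsand k j).1)
      (mul_le_mul_of_nonneg_left (min_le_right _ _) hs.le)
  · have hs := S.inv_pow_pos k
    refine tentOver_mono ((hsand k j).2.trans fun x hx => ⟨hx.1, hx.2.trans_le ?_⟩) ?_
    · have := mul_le_mul_of_nonneg_left ((le_max_left _ _).trans hlam1) hs.le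
      linarith
    · have := mul_le_mul_of_nonneg_left ((le_max_right _ _).trans hlam1) hs.le
      linarith

variable [NeZero n]

/-- The foot of a point over `Q k j` lies in some set of generation `k + 1`, which by nesting is
contained in `Q k j` together with its reference point. Removing the child tents therefore removes
exactly the lower layer. -/
lemma kube_some (hΩ : IsSmoothBoundedDomain Ω ρ) (k : ℕ) (j : S.ι k) :
    S.kube h (some ⟨k, j⟩) = strip Ω (S.Q k j) ((S.s ^ (k + 1))⁻¹ * h) ((S.s ^ k)⁻¹ * h) := by
  ext z
  simp only [kube, smallTent, strip, tentOver, mem_sdiff, mem_iUnion, mem_ofPred_eq, not_exists,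
    not_and, not_lt]
  constructor
  · rintro ⟨⟨hz, hzQ, hzt⟩, hn⟩
    refine ⟨hz, hzQ, ?_, hzt⟩
    obtain ⟨l, hl⟩ := S.exists_mem_Q (k + 1) (hΩ.proj_mem z)
    exact hn l (S.Q_subset (Nat.lt_succ_self k) hzQ hl (S.pt_mem _ l)) hz hl
  · rintro ⟨hz, hzQ, hz1, hz2⟩
    exact ⟨⟨hz, hzQ, hz2⟩, fun l _ _ _ => hz1⟩

lemma kube_none (hΩ : IsSmoothBoundedDomain Ω ρ) :
    S.kube h none = {z ∈ Ω | h ≤ dist (proj Ω z) z} := by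
  ext z
  simp only [kube, smallTent, tentOver, mem_sdiff, mem_iUnion, mem_ofPred_eq, not_exists,
    not_and, not_lt, pow_zero, inv_one, one_mul]
  constructor
  · rintro ⟨hz, hn⟩
    obtain ⟨l, hl⟩ := S.exists_mem_Q 0 (hΩ.proj_mem z)
    exact ⟨hz, hn l hz hl⟩
  · rintro ⟨hz, hz1⟩
    exact ⟨hz, fun l _ _ => hz1⟩

lemma disjoint_kube (hΩ : IsSmoothBoundedDomain Ω ρ) (hh : 0 < h) (i j : S.Idx) (hne : i ≠ j) :
    Disjoint (S.kube h i) (S.kube h j) := by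
  have h0 : ∀ k (j : S.ι k), Disjoint (S.kube h none) (S.kube h (some ⟨k, j⟩)) := by
    intro k j
    rw [S.kube_none hΩ, S.kube_some hΩ]
    refine Set.disjoint_left.2 fun z hz hz' => ?_
    have h1 : (S.s ^ k)⁻¹ ≤ 1 := by simpa using S.inv_pow_anti (Nat.zero_le k)
    have h2 := hz.2
    have h3 := hz'.2.2.2
    nlinarith
  have h1 : ∀ k l (i : S.ι k) (j : S.ι l), k < l →
      Disjoint (S.kube h (some ⟨k, i⟩)) (S.kube h (some ⟨l, j⟩)) := by
    intro k l i j hkl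
    rw [S.kube_some hΩ, S.kube_some hΩ]
    refine Set.disjoint_left.2 fun z hz hz' => ?_
    have h1 := mul_le_mul_of_nonneg_right (S.inv_pow_anti (Nat.succ_le_of_lt hkl)) hh.le
    have h2 := hz.2.2.1
    have h3 := hz'.2.2.2
    simp only [Nat.succ_eq_add_one] at h1
    linarith
  rcases i with _ | ⟨k, i⟩ <;> rcases j with _ | ⟨l, j⟩
  · exact absurd rfl hne
  · exact h0 l j
  · exact (h0 k i).symm
  · rcases lt_trichotomy k l with hkl | rfl | hkl
    · exact h1 k l i j hkl
    · rw [S.kube_some hΩ, S.kube_some hΩ]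
      have hij : i ≠ j := fun hij => hne (by rw [hij])
      refine Set.disjoint_left.2 fun z hz hz' => ?_
      exact Set.disjoint_left.1 (S.disjoint_Q k i j hij) hz.2.1 hz'.2.1
    · exact (h1 l k j i hkl).symm

lemma cover (hΩ : IsSmoothBoundedDomain Ω ρ) (hh : 0 < h) (i : S.Idx) (z : Cn n)
    (hz : z ∈ S.tent h i) :
    ∃ j, S.gen i ≤ S.gen j ∧ S.tent h j ⊆ S.tent h i ∧ z ∈ S.kube h j := by
  have hzΩ : z ∈ Ω := S.tent_subset h i hz
  have hd := hΩ.dist_proj_pos hzΩ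
  rcases le_or_gt h (dist (proj Ω z) z) with hdh | hdh
  · rcases i with _ | ⟨k, i⟩
    · refine ⟨none, le_rfl, Subset.rfl, ?_⟩
      rw [S.kube_none hΩ]
      exact ⟨hzΩ, hdh⟩
    · exfalso
      have h1 : (S.s ^ k)⁻¹ ≤ 1 := by simpa using S.inv_pow_anti (Nat.zero_le k)
      have h2 : dist (proj Ω z) z < (S.s ^ k)⁻¹ * h := hz.2.2
      nlinarith
  · obtain ⟨k, hk1, hk2⟩ := S.exists_generation hd hdh
    obtain ⟨l, hl⟩ := S.exists_mem_Q k (hΩ.proj_mem z)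
    have hmem : z ∈ S.kube h (some ⟨k, l⟩) := by
      rw [S.kube_some hΩ]
      exact ⟨hzΩ, hl, hk1, hk2⟩
    rcases i with _ | ⟨m, i⟩
    · exact ⟨some ⟨k, l⟩, Nat.zero_le _, S.tent_subset h _, hmem⟩
    · have hmk : m ≤ k := by
        by_contra! hcon
        have h1 := mul_le_mul_of_nonneg_right (S.inv_pow_anti (Nat.succ_le_of_lt hcon)) hh.le
        have h2 : dist (proj Ω z) z < (S.s ^ m)⁻¹ * h := hz.2.2
        simp only [Nat.succ_eq_add_one] at h1
        linarith
      exact ⟨some ⟨k, l⟩, Nat.succ_le_succ hmk, S.smallTent_subset hh hmk hz.2.1 hl, hmem⟩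

/-- The child's reference point lies in the parent's base, so the ball about the parent's point fits
in a larger ball about the child's point, by quasi-symmetry and the quasi-triangle inequality. -/
lemma exists_parent_comparable {P : PolydiscSystem Ω ρ} (hqd : IsBoundaryQuasiMetric P qd)
    {t₀ lam : ℝ} (ht₀ : 0 < t₀) (hlam : 1 ≤ lam)
    (hcomp : ∀ k (j : S.ι k), S.smallTent h k j ⊆
      tentOver Ω (bdryBall Ω qd (S.pt k j) (lam * ((S.s ^ k)⁻¹ * t₀)))
        (lam * ((S.s ^ k)⁻¹ * t₀))) :
    ∃ lam' : ℝ, 1 ≤ lam' ∧ ∀ k (j : S.ι k) (i : S.ι (k + 1)), S.Q (k + 1) i ⊆ S.Q k j →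
      S.smallTent h k j ⊆
        tentOver Ω (bdryBall Ω qd (S.pt (k + 1) i) (lam' * ((S.s ^ (k + 1))⁻¹ * t₀)))
          (lam' * ((S.s ^ (k + 1))⁻¹ * t₀)) := by
  obtain ⟨κ, hκ⟩ := hqd.quasi_symm
  obtain ⟨κ', hκ'⟩ := hqd.quasi_triangle
  obtain ⟨c, C, hc, hC, hsand⟩ := S.sandwich
  set m := max κ 1 with hm
  set m' := max κ' 1 with hm'
  have hm1 : 1 ≤ m := le_max_right _ _
  have hm1' : 1 ≤ m' := le_max_right _ _
  have hs1 := S.one_lt_s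
  have hδ := S.δ_pos
  set B := C * S.δ / t₀ with hB
  have hB0 : 0 < B := by positivity
  set lam' := (m' * (m * B + lam) * S.s + lam * S.s) with hlam'
  have hpos : 0 < m' * (m * B + lam) * S.s := by positivity
  have hll : lam * S.s ≤ lam' := by linarith
  refine ⟨lam', by nlinarith, fun k j i hij => ?_⟩
  have hsk := S.inv_pow_pos k
  have hsk1 := S.inv_pow_pos (k + 1)
  have hss : (S.s ^ k)⁻¹ = S.s * (S.s ^ (k + 1))⁻¹ := by
    have := S.s_pos.ne'
    rw [pow_succ]; field_simp
  set u := (S.s ^ (k + 1))⁻¹ * t₀ with hu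
  have hu0 : 0 < u := by positivity
  have hut : (S.s ^ k)⁻¹ * t₀ = S.s * u := by rw [hss, hu]; ring
  refine (hcomp k j).trans (tentOver_mono ?_ ?_)
  · rintro x ⟨hxf, hx⟩
    refine ⟨hxf, ?_⟩
    have hpi := S.pt_mem_frontier (k + 1) i
    have hpj := S.pt_mem_frontier k j
    have h1 := hκ' _ hpi _ hpj _ hxf
    have h2 := hκ _ hpi _ hpj
    have h3 : qd (S.pt k j) (S.pt (k + 1) i) < B * (S.s * u) := by
      have := ((hsand k j).2 (hij (S.pt_mem (k + 1) i))).2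
      refine this.trans_eq ?_
      rw [← hut, hB]; field_simp
    have h0 := hqd.nonneg _ hpj _ hpi
    have h0' := hqd.nonneg _ hpi _ hpj
    have h0'' := hqd.nonneg _ hpj _ hxf
    rw [hut] at hx
    have h4 : qd (S.pt (k + 1) i) (S.pt k j) ≤ m * (B * (S.s * u)) :=
      h2.trans ((mul_le_mul_of_nonneg_right (le_max_left _ _) h0).trans
        (mul_le_mul_of_nonneg_left h3.le (by linarith)))
    have h5 : qd (S.pt (k + 1) i) x ≤ m' * (m * (B * (S.s * u)) + lam * (S.s * u)) :=
      h1.trans ((mul_le_mul_of_nonneg_right (le_max_left _ _) (by linarith)).trans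
        (mul_le_mul_of_nonneg_left (by linarith) (by linarith)))
    have h6 : 0 < lam * S.s * u := by positivity
    calc _ ≤ _ := h5
      _ = m' * (m * B + lam) * S.s * u := by ring
      _ < lam' * u := by rw [hlam', add_mul]; linarith
  · rw [hut, ← mul_assoc]
    exact mul_le_mul_of_nonneg_right hll hu0.le

end DyadicSystem

end BekolleBonami

/-! ### Dyadic tents as a tree with measure bounds -/

namespace BekolleBonami

variable {n : ℕ} {Ω : Set (Cn n)} {ρ : Cn n → ℝ} {qd : Cn n → Cn n → ℝ}

namespace DyadicSystem

variable (S : DyadicSystem Ω qd) {h : ℝ}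

lemma measureReal_tent_pos (hΩ : IsSmoothBoundedDomain Ω ρ) (hd : IsDoublingTents Ω qd)
    (hh : 0 < h) (i : S.Idx) : 0 < volume.real (S.tent h i) := by
  have hfin : ∀ s ⊆ Ω, volume s ≠ ⊤ := fun s hs =>
    ne_top_of_le_ne_top hΩ.measure_ne_top (measure_mono hs)
  rcases i with _ | ⟨k, j⟩
  · exact ENNReal.toReal_pos (hΩ.isOpen.measure_pos volume hΩ.connected.nonempty).ne'
      hΩ.measure_ne_top
  · obtain ⟨t₀, ht₀, lam, -, hcomp⟩ := S.exists_tent_comparable hh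
    obtain ⟨c, hc, hlow⟩ := hd.lower ((S.s ^ k)⁻¹ * t₀) (mul_pos (S.inv_pow_pos k) ht₀)
    exact hc.trans_le ((hlow _ (S.pt_mem_frontier k j)).trans
      (measureReal_mono (hcomp k j).1 (hfin _ tentOver_subset)))

/-- Every dyadic tent is contained in a tent of `ballTents` of comparable measure. -/
lemma exists_ballTent (hΩ : IsSmoothBoundedDomain Ω ρ) (hd : IsDoublingTents Ω qd) (hh : 0 < h)
    {ε₀ : ℝ} (hε₀ : 0 < ε₀) :
    ∃ C : ℝ, 1 ≤ C ∧ ∀ i : S.Idx, ∃ B ∈ ballTents Ω qd ε₀, B ⊆ Ω ∧ S.tent h i ⊆ B ∧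
      volume.real B ≤ C * volume.real (S.tent h i) := by
  have hfin : ∀ {s}, s ⊆ Ω → volume s ≠ ⊤ := fun hs =>
    ne_top_of_le_ne_top hΩ.measure_ne_top (measure_mono hs)
  obtain ⟨t₀, ht₀, lam, hlam, hcomp⟩ := S.exists_tent_comparable hh
  have hlam0 : 0 < lam := by linarith
  obtain ⟨C, hC, hdoub⟩ := hd.doubling lam hlam
  obtain ⟨c, hc, hlow⟩ := hd.lower (ε₀ / lam) (by positivity)
  have hq : 0 ≤ volume.real Ω / c := by positivity
  refine ⟨1 + C + volume.real Ω / c, by linarith, fun i => ?_⟩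
  rcases i with _ | ⟨k, j⟩
  · refine ⟨Ω, Or.inr rfl, Subset.rfl, Subset.rfl, ?_⟩
    have : 0 ≤ volume.real Ω := measureReal_nonneg
    change volume.real Ω ≤ _ * volume.real Ω
    nlinarith [mul_nonneg hq this]
  · set t := (S.s ^ k)⁻¹ * t₀ with ht
    have ht0 : 0 < t := mul_pos (S.inv_pow_pos k) ht₀
    have hpf := S.pt_mem_frontier k j
    have h3 := measureReal_mono (μ := volume) (hcomp k j).1 (hfin tentOver_subset)
    have h5 : 0 ≤ volume.real (S.smallTent h k j) := measureReal_nonneg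
    -- If the enclosing ball tent exceeds the admissible height, `Ω` takes its place. The dyadic
    -- tent then has volume bounded below, so the loss is still bounded.
    rcases le_or_gt (lam * t) ε₀ with hle | hgt
    · refine ⟨_, Or.inl ⟨S.pt k j, hpf, lam * t, ⟨by positivity, hle⟩, rfl⟩, tentOver_subset,
        (hcomp k j).2, ?_⟩
      have h2 := hdoub _ hpf t ht0
      have h6 := mul_le_mul_of_nonneg_left h3 hC.le
      change _ ≤ _ * volume.real (S.smallTent h k j)
      nlinarith [mul_nonneg hq h5]
    · refine ⟨Ω, Or.inr rfl, Subset.rfl, S.tent_subset h _, ?_⟩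
      have hlt : ε₀ / lam ≤ t := by rw [div_le_iff₀ hlam0]; linarith
      have hball : bdryBall Ω qd (S.pt k j) (ε₀ / lam) ⊆ bdryBall Ω qd (S.pt k j) t :=
        fun x hx => ⟨hx.1, hx.2.trans_le hlt⟩
      have h1 : c ≤ volume.real (S.smallTent h k j) :=
        (hlow _ hpf).trans ((measureReal_mono (tentOver_mono hball hlt)
          (hfin tentOver_subset)).trans h3)
      have h2 : volume.real Ω = volume.real Ω / c * c := by field_simp
      change _ ≤ _ * volume.real (S.smallTent h k j)
      nlinarith [mul_le_mul_of_nonneg_left h1 hq, mul_nonneg hC.le h5]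

variable [NeZero n]

/-- The tents of one generation are disjoint, measurable and of positive measure. -/
lemma countable_index (hΩ : IsSmoothBoundedDomain Ω ρ) (hd : IsDoublingTents Ω qd)
    {ν : Cn n → Cn n} {K ε : ℝ} (hν : IsNormalField Ω ρ ν K ε) (hh : 0 < h) (hhε : h ≤ ε) :
    Countable S.Idx := by
  have h1 : ∀ k, Countable (S.ι k) := by
    intro k
    have hsk : (S.s ^ k)⁻¹ * h ≤ ε := by
      have h1 : (S.s ^ k)⁻¹ ≤ 1 := by simpa using S.inv_pow_anti (Nat.zero_le k)
      nlinarith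
    have hc := Measure.countable_meas_pos_of_disjoint_iUnion (μ := (volume : Measure (Cn n)))
      (As := fun j : S.ι k => S.smallTent h k j)
      (fun j => hν.measurableSet_tentOver hΩ (S.measurable_Q k j) hsk)
      (fun i j hij => Set.disjoint_left.2 fun z hz hz' =>
        Set.disjoint_left.1 (S.disjoint_Q k i j hij) hz.2.1 hz'.2.1)
    have huniv : {j : S.ι k | 0 < volume (S.smallTent h k j)} = univ := by
      refine eq_univ_of_forall fun j => ?_
      have := S.measureReal_tent_pos hΩ hd hh (some ⟨k, j⟩)
      exact (ENNReal.toReal_pos_iff.1 this).1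
    rw [huniv] at hc
    exact Set.countable_univ_iff.1 hc
  exact inferInstance

lemma measurableSet_tent (hΩ : IsSmoothBoundedDomain Ω ρ)
    {ν : Cn n → Cn n} {K ε : ℝ} (hν : IsNormalField Ω ρ ν K ε) (hh : 0 < h) (hhε : h ≤ ε)
    (i : S.Idx) : MeasurableSet (S.tent h i) := by
  rcases i with _ | ⟨k, j⟩
  · exact hΩ.isOpen.measurableSet
  · refine hν.measurableSet_tentOver hΩ (S.measurable_Q k j) ?_
    have h1 : (S.s ^ k)⁻¹ ≤ 1 := by simpa using S.inv_pow_anti (Nat.zero_le k)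
    nlinarith

lemma measurableSet_kube (hΩ : IsSmoothBoundedDomain Ω ρ) (hd : IsDoublingTents Ω qd)
    {ν : Cn n → Cn n} {K ε : ℝ} (hν : IsNormalField Ω ρ ν K ε) (hh : 0 < h) (hhε : h ≤ ε)
    (i : S.Idx) : MeasurableSet (S.kube h i) := by
  have := S.countable_index hΩ hd hν hh hhε
  have hc : ∀ k, Countable (S.ι k) := fun k =>
    Function.Injective.countable (f := fun j : S.ι k => (some ⟨k, j⟩ : S.Idx))
      fun i j hij => by simpa using hij
  have hm := S.measurableSet_tent hΩ hν hh hhε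
  rcases i with _ | ⟨k, j⟩
  · exact (hm none).diff (MeasurableSet.iUnion fun j => hm (some ⟨0, j⟩))
  · exact (hm (some ⟨k, j⟩)).diff
      (MeasurableSet.iUnion fun l => MeasurableSet.iUnion fun _ => hm (some ⟨k + 1, l⟩))

/-- Non-root kubes are the top strips of their tents. The root kube is a single set, and `hroot`
makes it contain a nonempty open set. -/
lemma exists_le_measure_kube (hΩ : IsSmoothBoundedDomain Ω ρ)
    {ν : Cn n → Cn n} {K ε : ℝ} (hν : IsNormalField Ω ρ ν K ε) (hh : 0 < h) (hhε : h ≤ ε)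
    (hroot : ∃ z ∈ Ω, h < Metric.infDist z (frontier Ω)) :
    ∃ c > 0, ∀ i : S.Idx, c * volume.real (S.tent h i) ≤ volume.real (S.kube h i) := by
  obtain ⟨C, hC, hstrip⟩ := hν.exists_measure_tentOver_le_strip hΩ S.one_lt_s
  have hΩ0 : 0 < volume.real Ω :=
    ENNReal.toReal_pos (hΩ.isOpen.measure_pos volume hΩ.connected.nonempty).ne' hΩ.measure_ne_top
  have hr0 : 0 < volume.real (S.kube h none) := by
    rw [S.kube_none hΩ]
    have hfin : volume {z ∈ Ω | h ≤ dist (proj Ω z) z} ≠ ⊤ :=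
      ne_top_of_le_ne_top hΩ.measure_ne_top (measure_mono fun z hz => hz.1)
    refine ENNReal.toReal_pos (ne_of_gt ?_) hfin
    obtain ⟨z, hz, hzh⟩ := hroot
    have hop : IsOpen (Ω ∩ {z | h < Metric.infDist z (frontier Ω)}) :=
      hΩ.isOpen.inter (isOpen_lt continuous_const (Metric.continuous_infDist_pt _))
    refine (hop.measure_pos volume ⟨z, hz, hzh⟩).trans_le (measure_mono fun w hw => ⟨hw.1, ?_⟩)
    rw [hΩ.dist_proj]
    exact le_of_lt hw.2
  refine ⟨min (volume.real (S.kube h none) / volume.real Ω) C⁻¹, by positivity, fun i => ?_⟩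
  rcases i with _ | ⟨k, j⟩
  · calc _ ≤ volume.real (S.kube h none) / volume.real Ω * volume.real Ω :=
          mul_le_mul_of_nonneg_right (min_le_left _ _) hΩ0.le
      _ = _ := by field_simp
  · rw [S.kube_some hΩ]
    have h1 : (S.s ^ k)⁻¹ ≤ 1 := by simpa using S.inv_pow_anti (Nat.zero_le k)
    have h2 := hstrip (S.Q k j) ((S.s ^ k)⁻¹ * h) (mul_pos (S.inv_pow_pos k) hh) (by nlinarith)
    have h3 : S.s⁻¹ * ((S.s ^ k)⁻¹ * h) = (S.s ^ (k + 1))⁻¹ * h := by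
      rw [pow_succ, mul_inv]; ring
    rw [h3] at h2
    refine (mul_le_mul_of_nonneg_right (min_le_right _ _) measureReal_nonneg).trans ?_
    rw [inv_mul_le_iff₀ hC]
    exact h2

/-- Between consecutive generations this is doubling. Between the root and generation `0` it is the
uniform lower bound for tents of a given size. -/
lemma exists_measure_parent_le {P : PolydiscSystem Ω ρ} (hΩ : IsSmoothBoundedDomain Ω ρ)
    (hqd : IsBoundaryQuasiMetric P qd) (hd : IsDoublingTents Ω qd) (hh : 0 < h) :
    ∃ D : ℝ, 2 ≤ D ∧ (∀ j : S.ι 0, volume.real Ω ≤ D * volume.real (S.smallTent h 0 j)) ∧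
      ∀ k (j : S.ι k) (i : S.ι (k + 1)), S.Q (k + 1) i ⊆ S.Q k j →
        volume.real (S.smallTent h k j) ≤ D * volume.real (S.smallTent h (k + 1) i) := by
  have hfin : ∀ {s}, s ⊆ Ω → volume s ≠ ⊤ := fun hs =>
    ne_top_of_le_ne_top hΩ.measure_ne_top (measure_mono hs)
  obtain ⟨t₀, ht₀, lam, hlam, hcomp⟩ := S.exists_tent_comparable hh
  obtain ⟨lam', hlam', hpar⟩ := S.exists_parent_comparable hqd ht₀ hlam fun k j => (hcomp k j).2
  obtain ⟨C, hC, hdoub⟩ := hd.doubling lam' hlam'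
  obtain ⟨c, hc, hlow⟩ := hd.lower t₀ ht₀
  refine ⟨2 + C + volume.real Ω / c, ?_, fun j => ?_, fun k j i hij => ?_⟩
  · have : 0 ≤ volume.real Ω / c := by positivity
    linarith
  · have h1 : c ≤ volume.real (S.smallTent h 0 j) := by
      refine (hlow _ (S.pt_mem_frontier 0 j)).trans (measureReal_mono ?_ (hfin tentOver_subset))
      simpa using (hcomp 0 j).1
    have h2 : volume.real Ω = volume.real Ω / c * c := by field_simp
    have h3 : 0 ≤ volume.real Ω / c := by positivity
    nlinarith
  · have h1 := measureReal_mono (μ := volume) (hpar k j i hij) (hfin tentOver_subset)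
    have h2 := hdoub _ (S.pt_mem_frontier (k + 1) i) _ (mul_pos (S.inv_pow_pos (k + 1)) ht₀)
    have h3 := measureReal_mono (μ := volume) (hcomp (k + 1) i).1 (hfin tentOver_subset)
    have h4 : 0 ≤ volume.real Ω / c := by positivity
    have h5 : 0 ≤ volume.real (S.smallTent h (k + 1) i) := measureReal_nonneg
    have h6 := mul_le_mul_of_nonneg_left h3 hC.le
    nlinarith

/-- The tents and kubes of a dyadic system form a tree. -/
lemma exists_tentTree {P : PolydiscSystem Ω ρ} (hΩ : IsSmoothBoundedDomain Ω ρ)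
    (hqd : IsBoundaryQuasiMetric P qd) (hd : IsDoublingTents Ω qd)
    {ν : Cn n → Cn n} {K ε : ℝ} (hν : IsNormalField Ω ρ ν K ε) (hh : 0 < h) (hhε : h ≤ ε)
    (hroot : ∃ z ∈ Ω, h < Metric.infDist z (frontier Ω)) :
    ∃ c D : ℝ, 0 < c ∧ 2 ≤ D ∧ TentTree volume (S.tent h) (S.kube h) S.gen c D := by
  obtain ⟨c, hc, hkube⟩ := S.exists_le_measure_kube hΩ hν hh hhε hroot
  obtain ⟨D, hD, hD0, hDk⟩ := S.exists_measure_parent_le hΩ hqd hd hh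
  refine ⟨c, D, hc, hD, ⟨S.measurableSet_tent hΩ hν hh hhε, S.measurableSet_kube hΩ hd hν hh hhε,
    fun i => (ENNReal.toReal_pos_iff.1 (S.measureReal_tent_pos hΩ hd hh i)).1.ne',
    fun i => ne_top_of_le_ne_top hΩ.measure_ne_top (measure_mono (S.tent_subset h i)),
    S.kube_subset_tent h, S.disjoint_kube hΩ hh, S.cover hΩ hh, S.disjoint_of_gen_eq,
    S.nested_tent hh, ?_, hkube⟩⟩
  intro i j hij hji
  rcases j with _ | ⟨k, j⟩
  · simp [gen] at hij
  have hpos := S.measureReal_tent_pos hΩ hd hh (some ⟨k, j⟩)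
  obtain ⟨z, hz⟩ := nonempty_of_measure_ne_zero (ENNReal.toReal_pos_iff.1 hpos).1.ne'
  rcases k with _ | k
  · refine ⟨none, rfl, S.tent_subset h _, ?_, hD0 j⟩
    rcases i with _ | ⟨m, i⟩
    · exact Subset.rfl
    · simp [gen] at hij
  · obtain ⟨l, hl⟩ := S.exists_mem_Q k (S.pt_mem_frontier (k + 1) j)
    have hsub := S.Q_subset (Nat.lt_succ_self k) hl (S.pt_mem (k + 1) j)
    refine ⟨some ⟨k, l⟩, rfl, S.smallTent_subset hh (Nat.le_succ k) hl (S.pt_mem (k + 1) j), ?_,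
      hDk k l j hsub⟩
    rcases i with _ | ⟨m, i⟩
    · exact S.tent_subset h _
    · have hmk : m ≤ k := by simp [gen] at hij; omega
      exact S.smallTent_subset hh hmk (hji hz).2.1 (hsub hz.2.1)

end DyadicSystem

end BekolleBonami

namespace BekolleBonami

open Matrix

/-! ### Quadratic forms of matrix weights -/

variable {d : ℕ}

/-- The quadratic form `⟨M u, u⟩`. -/
def quad (M : Matrix (Fin d) (Fin d) ℂ) (u : Fin d → ℂ) : ℝ := (star u ⬝ᵥ M *ᵥ u).re

lemma quad_nonneg {M : Matrix (Fin d) (Fin d) ℂ} (hM : M.PosSemidef) (u : Fin d → ℂ) :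
    0 ≤ quad M u := (Complex.nonneg_iff.1 (hM.dotProduct_mulVec_nonneg u)).1

lemma quad_eq_norm_sq (M : Matrix (Fin d) (Fin d) ℂ) (u : Fin d → ℂ) :
    quad (Mᴴ * M) u = ‖WithLp.toLp 2 (M *ᵥ u)‖ ^ 2 := by
  rw [quad, ← mulVec_mulVec, dotProduct_mulVec, ← star_mulVec, ← inner_self_eq_norm_sq (𝕜 := ℂ),
    EuclideanSpace.inner_eq_star_dotProduct, dotProduct_comm]
  rfl

/-- Cauchy–Schwarz for `M` and its inverse, as a quadratic inequality. -/
lemma quad_discriminant {M : Matrix (Fin d) (Fin d) ℂ} (hM : M.PosDef) (u e : Fin d → ℂ) (x : ℝ) :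
    0 ≤ quad M u * (x * x) + -2 * (star e ⬝ᵥ u).re * x + quad M⁻¹ e := by
  have hdet : IsUnit M.det := isUnit_iff_ne_zero.2 (hM.posSemidef.posDef_iff_det_ne_zero.1 hM)
  -- Expanding the form of `M` at `x u - M⁻¹ e` gives the stated quadratic polynomial in `x`.
  have h := quad_nonneg hM.posSemidef ((x : ℂ) • u - M⁻¹ *ᵥ e)
  have h1 : star ((x : ℂ) • u - M⁻¹ *ᵥ e) ⬝ᵥ M *ᵥ ((x : ℂ) • u - M⁻¹ *ᵥ e) =
      (x * x : ℝ) * (star u ⬝ᵥ M *ᵥ u) - (x : ℂ) * (star u ⬝ᵥ e) - (x : ℂ) * (star e ⬝ᵥ u) +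
        star e ⬝ᵥ M⁻¹ *ᵥ e := by
    have hinv : M⁻¹ᴴ = M⁻¹ := hM.isHermitian.inv
    have e1 : M *ᵥ M⁻¹ *ᵥ e = e := by
      rw [mulVec_mulVec, mul_nonsing_inv _ hdet, one_mulVec]
    have e2 : star (M⁻¹ *ᵥ e) ⬝ᵥ M *ᵥ u = star e ⬝ᵥ u := by
      rw [star_mulVec, hinv, ← dotProduct_mulVec, mulVec_mulVec, nonsing_inv_mul _ hdet,
        one_mulVec]
    have e3 : star (M⁻¹ *ᵥ e) ⬝ᵥ e = star e ⬝ᵥ M⁻¹ *ᵥ e := by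
      rw [star_mulVec, hinv, dotProduct_mulVec]
    rw [mulVec_sub, e1, mulVec_smul, star_sub, star_smul, sub_dotProduct, dotProduct_sub,
      dotProduct_sub, smul_dotProduct, smul_dotProduct, dotProduct_smul, dotProduct_smul, e2, e3]
    simp only [smul_eq_mul, Complex.star_def, Complex.conj_ofReal, Complex.ofReal_mul]
    ring
  have h2 : (star u ⬝ᵥ e).re = (star e ⬝ᵥ u).re := by
    have : star u ⬝ᵥ e = star (star e ⬝ᵥ u) := by
      rw [star_dotProduct]
    rw [this, Complex.star_def, Complex.conj_re]
  rw [quad, h1] at h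
  simp only [Complex.add_re, Complex.sub_re, Complex.re_ofReal_mul, h2] at h
  rw [quad, quad]
  linarith

/-- `A V A ≤ ‖A^{1/2} V^{1/2}‖² A` as quadratic forms. -/
lemma quad_mulVec_le {A V : Matrix (Fin d) (Fin d) ℂ} (hA : A.PosSemidef) (hV : V.PosSemidef)
    (u : Fin d → ℂ) : quad V (A *ᵥ u) ≤ ‖CFC.sqrt A * CFC.sqrt V‖ ^ 2 * quad A u := by
  have hA1 : CFC.sqrt A * CFC.sqrt A = A := CFC.sqrt_mul_sqrt_self A hA.nonneg
  have hV1 : CFC.sqrt V * CFC.sqrt V = V := CFC.sqrt_mul_sqrt_self V hV.nonneg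
  have hA2 : (CFC.sqrt A)ᴴ = CFC.sqrt A := (nonneg_iff_posSemidef.1 (CFC.sqrt_nonneg A)).isHermitian
  have hV2 : (CFC.sqrt V)ᴴ = CFC.sqrt V := (nonneg_iff_posSemidef.1 (CFC.sqrt_nonneg V)).isHermitian
  have e1 : quad V (A *ᵥ u) = ‖WithLp.toLp 2 (CFC.sqrt V *ᵥ (A *ᵥ u))‖ ^ 2 := by
    rw [← quad_eq_norm_sq, hV2, hV1]
  have e2 : quad A u = ‖WithLp.toLp 2 (CFC.sqrt A *ᵥ u)‖ ^ 2 := by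
    rw [← quad_eq_norm_sq, hA2, hA1]
  have e3 : CFC.sqrt V *ᵥ (A *ᵥ u) = (CFC.sqrt V * CFC.sqrt A) *ᵥ (CFC.sqrt A *ᵥ u) := by
    rw [mulVec_mulVec, mulVec_mulVec, Matrix.mul_assoc, hA1]
  have e4 : ‖CFC.sqrt A * CFC.sqrt V‖ = ‖CFC.sqrt V * CFC.sqrt A‖ := by
    rw [← l2_opNorm_conjTranspose, conjTranspose_mul, hA2, hV2]
  rw [e1, e2, e3, e4, ← mul_pow]
  exact pow_le_pow_left₀ (norm_nonneg _)
    (l2_opNorm_mulVec (CFC.sqrt V * CFC.sqrt A) (WithLp.toLp 2 (CFC.sqrt A *ᵥ u))) 2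

variable {n : ℕ} {Ω B : Set (Cn n)} {W : Cn n → Matrix (Fin d) (Fin d) ℂ}

lemma integrableOn_dotProduct (hW : ∀ a b, IntegrableOn (fun z => W z a b) B) (u : Fin d → ℂ) :
    IntegrableOn (fun z => star u ⬝ᵥ W z *ᵥ u) B := by
  simp only [dotProduct, mulVec, Finset.mul_sum]
  exact integrable_finsetSum _ fun a _ => integrable_finsetSum _ fun b _ =>
    ((hW a b).mul_const _).const_mul _

lemma integrableOn_quad (hW : ∀ a b, IntegrableOn (fun z => W z a b) B) (u : Fin d → ℂ) :
    IntegrableOn (fun z => quad (W z) u) B :=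
  (integrableOn_dotProduct hW u).re

lemma dotProduct_avg (hW : ∀ a b, IntegrableOn (fun z => W z a b) B) (u : Fin d → ℂ) :
    star u ⬝ᵥ avg W B *ᵥ u = ⨍ z in B, star u ⬝ᵥ W z *ᵥ u := by
  rw [setAverage_eq]
  simp only [dotProduct, mulVec, avg, of_apply, setAverage_eq, Finset.mul_sum]
  rw [integral_finsetSum _ fun a _ => integrable_finsetSum _ fun b _ =>
    ((hW a b).mul_const _).const_mul _, Finset.smul_sum]
  refine Finset.sum_congr rfl fun a _ => ?_
  rw [integral_finsetSum _ fun b _ => ((hW a b).mul_const _).const_mul _, Finset.smul_sum]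
  refine Finset.sum_congr rfl fun b _ => ?_
  rw [integral_const_mul, integral_mul_const]
  simp only [Complex.real_smul]
  ring

lemma quad_avg (hW : ∀ a b, IntegrableOn (fun z => W z a b) B) (u : Fin d → ℂ) :
    quad (avg W B) u = ⨍ z in B, quad (W z) u := by
  have h1 : (∫ z in B, star u ⬝ᵥ W z *ᵥ u).re = ∫ z in B, quad (W z) u :=
    (integral_re (integrableOn_dotProduct hW u)).symm
  rw [quad, dotProduct_avg hW, setAverage_eq, setAverage_eq, Complex.smul_re, h1]

lemma measureReal_mul_quad_avg (hW : ∀ a b, IntegrableOn (fun z => W z a b) B)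
    (hB : volume.real B ≠ 0) (u : Fin d → ℂ) :
    volume.real B * quad (avg W B) u = ∫ z in B, quad (W z) u := by
  rw [quad_avg hW, setAverage_eq, smul_eq_mul, mul_inv_cancel_left₀ hB]

lemma posSemidef_avg (hW : ∀ a b, IntegrableOn (fun z => W z a b) B)
    (hpos : ∀ᵐ z ∂(volume.restrict B), (W z).PosSemidef) : (avg W B).PosSemidef := by
  have hherm : (avg W B).IsHermitian := by
    ext a b
    simp only [conjTranspose_apply, avg, of_apply, setAverage_eq, star_smul, star_trivial]
    congr 1
    rw [Complex.star_def, ← integral_conj]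
    refine integral_congr_ae ?_
    filter_upwards [hpos] with z hz
    exact hz.isHermitian.apply a b
  refine PosSemidef.of_dotProduct_mulVec_nonneg hherm fun u => Complex.nonneg_iff.2 ⟨?_, ?_⟩
  · change 0 ≤ quad (avg W B) u
    rw [quad_avg hW, setAverage_eq]
    refine smul_nonneg (by positivity) (integral_nonneg_of_ae ?_)
    filter_upwards [hpos] with z hz using quad_nonneg hz u
  · exact (hherm.im_star_dotProduct_mulVec_self u).symm

/-- Here `q` is the average of `⟨W u, u⟩` over `B`, `g = |G|`, `m = |B|`, `w` is the mass of `G`,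
and `i` the integral of the inverse form over `G`. The discriminant gives `q² g² ≤ w i ≤ w m b q`,
and one factor `q` cancels. -/
lemma discriminant_arith {q g w m b i : ℝ} (hq : 0 ≤ q) (hm : 0 ≤ m) (hb : 0 ≤ b) (hw : 0 ≤ w)
    (hi : i ≤ m * (b * q)) (hd : (-2 * q * g) ^ 2 - 4 * w * i ≤ 0) :
    g ^ 2 * (m * q) ≤ b * w * m ^ 2 := by
  rcases hq.eq_or_lt with rfl | hq
  · rw [mul_zero, mul_zero]; positivity
  · have h1 := mul_le_mul_of_nonneg_left hi hw
    have h2 : q * (q * g ^ 2) ≤ q * (w * m * b) := by nlinarith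
    have h3 := mul_le_mul_of_nonneg_left (le_of_mul_le_mul_left h2 hq) hm
    linarith

/-- The `A₂`-type comparison of the measures `⟨W u, u⟩ dV` and `dV` that `⟨W⟩_B`, `⟨W⁻¹⟩_B`
control. -/
lemma measure_sq_mul_quad_le (hW : ∀ a b, IntegrableOn (fun z => W z a b) B)
    (hW' : ∀ a b, IntegrableOn (fun z => (W z)⁻¹ a b) B)
    (hpos : ∀ᵐ z ∂(volume.restrict B), (W z).PosDef) {G : Set (Cn n)} (hGB : G ⊆ B)
    (hB : volume.real B ≠ 0) (hB' : volume B ≠ ⊤) (u : Fin d → ℂ) :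
    volume.real G ^ 2 * ∫ z in B, quad (W z) u ≤
      ‖CFC.sqrt (avg W B) * CFC.sqrt (avg (fun z => (W z)⁻¹) B)‖ ^ 2 *
        (∫ z in G, quad (W z) u) * volume.real B ^ 2 := by
  set A := avg W B with hA
  set V := avg (fun z => (W z)⁻¹) B with hV
  set b := ‖CFC.sqrt A * CFC.sqrt V‖ ^ 2 with hb
  have hAps : A.PosSemidef := posSemidef_avg hW (hpos.mono fun z hz => hz.posSemidef)
  have hVps : V.PosSemidef := posSemidef_avg hW' (hpos.mono fun z hz => hz.inv.posSemidef)
  -- With this vector the cross term is the constant `⟨A u, u⟩`, and the inverse form averages to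
  -- `⟨V A u, A u⟩`, which `quad_mulVec_le` bounds by `b ⟨A u, u⟩`.
  set e := A *ᵥ u with he
  have hβ : (star e ⬝ᵥ u).re = quad A u := by
    rw [he, star_mulVec, hAps.isHermitian.eq, ← dotProduct_mulVec, quad]
  have hβ0 : 0 ≤ quad A u := quad_nonneg hAps u
  have hposG : ∀ᵐ z ∂(volume.restrict G), (W z).PosDef := ae_restrict_of_ae_restrict_of_subset hGB hpos
  have hGW : IntegrableOn (fun z => quad (W z) u) G := (integrableOn_quad hW u).mono_set hGB
  have hBW' := integrableOn_quad hW' e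
  have hGW' : IntegrableOn (fun z => quad (W z)⁻¹ e) G := hBW'.mono_set hGB
  have hG' : volume G ≠ ⊤ := ne_top_of_le_ne_top hB' (measure_mono hGB)
  have hb0 : 0 ≤ b := by positivity
  have hm0 : 0 ≤ volume.real B := measureReal_nonneg
  have hwG0 : 0 ≤ ∫ z in G, quad (W z) u := integral_nonneg_of_ae (by
    filter_upwards [hposG] with z hz using quad_nonneg hz.posSemidef u)
  have hInv : ∫ z in G, quad (W z)⁻¹ e ≤ volume.real B * (b * quad A u) := by
    calc ∫ z in G, quad (W z)⁻¹ e ≤ ∫ z in B, quad (W z)⁻¹ e :=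
          setIntegral_mono_set hBW' (by
            filter_upwards [hpos] with z hz using quad_nonneg hz.inv.posSemidef e)
            hGB.eventuallyLE
      _ = volume.real B * quad V e := (measureReal_mul_quad_avg hW' hB e).symm
      _ ≤ _ := mul_le_mul_of_nonneg_left (quad_mulVec_le hAps hVps u) hm0
  -- The pointwise quadratic inequality is integrated over `G` before the discriminant is taken.
  have hdisc : ∀ x : ℝ, 0 ≤ (∫ z in G, quad (W z) u) * (x * x) +
      (-2 * quad A u * volume.real G) * x + ∫ z in G, quad (W z)⁻¹ e := by
    intro x
    have h1 : 0 ≤ ∫ z in G, (quad (W z) u * (x * x) + -2 * quad A u * x + quad (W z)⁻¹ e) :=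
      integral_nonneg_of_ae (by
        filter_upwards [hposG] with z hz
        have := quad_discriminant hz u e x
        rwa [hβ] at this)
    have hc : IntegrableOn (fun _ : Cn n => -2 * quad A u * x) G := integrableOn_const hG'
    have hs : IntegrableOn (fun z => quad (W z) u * (x * x) + -2 * quad A u * x) G :=
      (hGW.mul_const _).add hc
    rw [integral_add hs hGW', integral_add (hGW.mul_const _) hc, integral_mul_const,
      setIntegral_const, smul_eq_mul] at h1
    refine h1.trans_eq ?_
    ring
  rw [← measureReal_mul_quad_avg hW hB u]
  exact discriminant_arith hβ0 hm0 hb0 hwG0 hInv (discrim_le_zero hdisc)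

end BekolleBonami

/-! ### Reverse Hölder inequality for step weights -/

lemma TentTree.mono {X : Type*} [MeasurableSpace X] {μ : Measure X} {I : Type*}
    {T K : I → Set X} {gen : I → ℕ} {c D c' D' : ℝ} (h : TentTree μ T K gen c D) (hc : c' ≤ c)
    (hD : D ≤ D') : TentTree μ T K gen c' D' :=
  { h with
    parent := fun i j hij hji => by
      obtain ⟨p, h1, h2, h3, h4⟩ := h.parent i j hij hji
      exact ⟨p, h1, h2, h3, h4.trans (mul_le_mul_of_nonneg_right hD measureReal_nonneg)⟩
    kube_large := fun i =>
      (mul_le_mul_of_nonneg_right hc measureReal_nonneg).trans (h.kube_large i) }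

namespace BekolleBonami

open Matrix

variable {n d : ℕ} {Ω : Set (Cn n)} {ρ : Cn n → ℝ} {qd : Cn n → Cn n → ℝ}
  {W : Cn n → Matrix (Fin d) (Fin d) ℂ}

/-- The root `H` is Hermitian because `CFC.sqrt` is always nonnegative, so `H` can be moved onto `v`
with no information about the average of `𝒲⁻¹`. -/
lemma exists_scalarStepWeight_eq_quad (S : DyadicSystem Ω qd) (h : ℝ) (i : S.Idx)
    (v : EuclideanSpace ℂ (Fin d)) :
    ∃ u, ∀ z, scalarStepWeight S h W i v z = quad (stepWeight S h W z) u := by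
  set H := CFC.sqrt (avg (fun w => (stepWeight S h W w)⁻¹) (S.tent h i)) with hH
  have hHH : Hᴴ = H := (nonneg_iff_posSemidef.1 (CFC.sqrt_nonneg _)).isHermitian
  refine ⟨H *ᵥ v.ofLp, fun z => ?_⟩
  simp only [scalarStepWeight, quad]
  rw [← hH, EuclideanSpace.inner_eq_star_dotProduct, dotProduct_comm, star_mulVec, hHH,
    ← dotProduct_mulVec, mulVec_mulVec, mulVec_mulVec, Matrix.mul_assoc]
  rfl

lemma stepWeight_of_mem_kube (S : DyadicSystem Ω qd) {h : ℝ}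
    (hdisj : ∀ i j, i ≠ j → Disjoint (S.kube h i) (S.kube h j)) {i : S.Idx} {z : Cn n}
    (hz : z ∈ S.kube h i) : stepWeight S h W z = avg W (S.kube h i) := by
  rw [stepWeight, tsum_eq_single i fun j hj => ?_, indicator_of_mem hz]
  exact indicator_of_notMem (fun hzj => Set.disjoint_left.1 (hdisj j i hj) hzj hz) _

lemma IsMatrixWeight.integral_quad_pos (hW : IsMatrixWeight Ω W) (hΩ : volume Ω ≠ 0)
    {u : Fin d → ℂ} (hu : u ≠ 0) : 0 < ∫ z in Ω, quad (W z) u := by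
  have hpos : ∀ᵐ z ∂(volume.restrict Ω), 0 < quad (W z) u := by
    filter_upwards [hW.posDef] with z hz
    exact (Complex.pos_iff.1 (hz.dotProduct_mulVec_pos hu)).1
  rw [integral_pos_iff_support_of_nonneg_ae (hpos.mono fun z hz => hz.le)
    (integrableOn_quad hW.integrable u)]
  have h1 : (Function.support fun z => quad (W z) u) =ᵐ[volume.restrict Ω] univ := by
    filter_upwards [hpos] with z hz
    exact propext ⟨fun _ => trivial, fun _ => hz.ne'⟩
  rw [measure_congr h1, Measure.restrict_apply_univ]
  exact pos_iff_ne_zero.2 hΩ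

/-- The matrix `A₂` quantity of `Ω` is at least one. -/
lemma IsMatrixWeight.one_le_norm_sq [NeZero d] (hW : IsMatrixWeight Ω W) (hΩ : volume Ω ≠ 0)
    (hΩ' : volume Ω ≠ ⊤) :
    1 ≤ ‖CFC.sqrt (avg W Ω) * CFC.sqrt (avg (fun z => (W z)⁻¹) Ω)‖ ^ 2 := by
  have hm : 0 < volume.real Ω := ENNReal.toReal_pos hΩ hΩ'
  have hw := hW.integral_quad_pos hΩ (u := 1) one_ne_zero
  have h := measure_sq_mul_quad_le hW.integrable hW.integrable_inv hW.posDef Subset.rfl hm.ne'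
    hΩ' 1
  have h1 : (volume.real Ω ^ 2 * ∫ z in Ω, quad (W z) 1) * 1 ≤
      (volume.real Ω ^ 2 * ∫ z in Ω, quad (W z) 1) *
        ‖CFC.sqrt (avg W Ω) * CFC.sqrt (avg (fun z => (W z)⁻¹) Ω)‖ ^ 2 := by
    rw [mul_one]
    exact h.trans_eq (by ring)
  exact le_of_mul_le_mul_left h1 (by positivity)

lemma rpow_average_arith {Y y avg ε X : ℝ} (hε : 0 < ε) (hX : 0 ≤ X) (ha : 0 ≤ avg) (hY : 1 ≤ Y)
    (hYy : Y ≤ y) (h : X ≤ Y * (avg ^ ε * avg)) : X ^ (1 / (1 + ε)) ≤ y * avg := by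
  have h1 : avg ^ ε * avg = avg ^ (1 + ε) := by
    rcases ha.eq_or_lt with rfl | ha
    · rw [mul_zero, Real.zero_rpow (by linarith)]
    · rw [Real.rpow_add ha, Real.rpow_one, mul_comm]
  rw [h1] at h
  have hr : 0 < 1 / (1 + ε) := by positivity
  calc X ^ (1 / (1 + ε)) ≤ (Y * avg ^ (1 + ε)) ^ (1 / (1 + ε)) := Real.rpow_le_rpow hX h hr.le
    _ = Y ^ (1 / (1 + ε)) * avg := by
      rw [Real.mul_rpow (by linarith) (by positivity), ← Real.rpow_mul ha,
        mul_one_div_cancel (by positivity), Real.rpow_one]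
    _ ≤ y * avg := by
      refine mul_le_mul_of_nonneg_right (le_trans ?_ hYy) ha
      conv_rhs => rw [← Real.rpow_one Y]
      exact Real.rpow_le_rpow_of_exponent_le hY (by rw [div_le_one (by positivity)]; linarith)

/-- Step weights have the same mass as the weight on every union of kubes. -/
lemma lintegral_step_eq {S : DyadicSystem Ω qd} {h c D : ℝ}
    (tree : TentTree volume (S.tent h) (S.kube h) S.gen c D) [Countable S.Idx] (hc : 0 < c)
    (hW : IsMatrixWeight Ω W) (u : Fin d → ℂ) (J : Set S.Idx) :
    ∫⁻ z in ⋃ j ∈ J, S.kube h j, ENNReal.ofReal (quad (stepWeight S h W z) u) =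
      ENNReal.ofReal (∫ z in ⋃ j ∈ J, S.kube h j, quad (W z) u) := by
  have hKΩ : ∀ i, S.kube h i ⊆ Ω := fun i => (tree.kube_subset i).trans (S.tent_subset h i)
  have hGΩ : (⋃ j ∈ J, S.kube h j) ⊆ Ω := iUnion₂_subset fun i _ => hKΩ i
  have hnn : ∀ s ⊆ Ω, 0 ≤ᵐ[volume.restrict s] fun z => quad (W z) u := fun s hs => by
    filter_upwards [ae_restrict_of_ae_restrict_of_subset hs hW.posDef] with z hz
    exact quad_nonneg hz.posSemidef u
  have hint := integrableOn_quad hW.integrable u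
  have hd : J.PairwiseDisjoint (S.kube h) := fun i _ j _ hij => tree.disjoint_kube i j hij
  rw [ofReal_integral_eq_lintegral_ofReal (hint.mono_set hGΩ) (hnn _ hGΩ),
    lintegral_biUnion (to_countable _) (fun j _ => tree.measurableSet_kube j) hd,
    lintegral_biUnion (to_countable _) (fun j _ => tree.measurableSet_kube j) hd]
  refine tsum_congr fun j => ?_
  have hWj : ∀ a b, IntegrableOn (fun z => W z a b) (S.kube h j) := fun a b =>
    (hW.integrable a b).mono_set (hKΩ j)
  have hKpos : 0 < volume.real (S.kube h j) :=
    (mul_pos hc (tree.measureReal_pos j)).trans_le (tree.kube_large j)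
  have hKtop : volume (S.kube h j) ≠ ⊤ :=
    ne_top_of_le_ne_top (tree.measure_ne_top j) (measure_mono (tree.kube_subset j))
  rw [← ofReal_integral_eq_lintegral_ofReal (hint.mono_set (hKΩ j)) (hnn _ (hKΩ j)),
    ← measureReal_mul_quad_avg hWj hKpos.ne', setLIntegral_congr_fun (tree.measurableSet_kube j)
      (g := fun _ => ENNReal.ofReal (quad (avg W (S.kube h j)) u)) (fun z hz => by
        simp only [stepWeight_of_mem_kube S tree.disjoint_kube hz]),
    setLIntegral_const, ENNReal.ofReal_mul measureReal_nonneg, Measure.real,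
    ENNReal.ofReal_toReal hKtop, mul_comm]

/-- Reverse Hölder inequality for the step weights of one dyadic system. -/
lemma scalarStepWeight_reverse_holder {S : DyadicSystem Ω qd} {h c D : ℝ}
    (tree : TentTree volume (S.tent h) (S.kube h) S.gen c D) [Countable S.Idx] (hc : 0 < c)
    (hc1 : c ≤ 1) (hD : 2 ≤ D) (hΩ : volume Ω ≠ ⊤) (hW : IsMatrixWeight Ω W) {C b ε : ℝ}
    (hC : 1 ≤ C) (hb : 1 ≤ b)
    (hB : ∀ i : S.Idx, ∃ B ⊆ Ω, S.tent h i ⊆ B ∧ volume.real B ≤ C * volume.real (S.tent h i) ∧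
      ‖CFC.sqrt (avg W B) * CFC.sqrt (avg (fun z => (W z)⁻¹) B)‖ ^ 2 ≤ b)
    (hε : ε = 1 / (16 * (C ^ 2 * b) * Real.log (2 * D))) (i : S.Idx)
    (v : EuclideanSpace ℂ (Fin d)) :
    (0 ≤ ⨍ z in S.tent h i, scalarStepWeight S h W i v z) ∧
      IntegrableOn (fun z => scalarStepWeight S h W i v z ^ (1 + ε)) (S.tent h i) ∧
      (⨍ z in S.tent h i, scalarStepWeight S h W i v z ^ (1 + ε)) ^ (1 / (1 + ε)) ≤
        4 / c * ⨍ z in S.tent h i, scalarStepWeight S h W i v z := by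
  obtain ⟨u, hu⟩ := exists_scalarStepWeight_eq_quad (W := W) S h i v
  simp only [hu]
  set f : Cn n → ℝ := fun z => quad (stepWeight S h W z) u with hf
  have hKΩ : ∀ i, S.kube h i ⊆ Ω := fun i => (tree.kube_subset i).trans (S.tent_subset h i)
  have hlog1 : 1 ≤ Real.log (2 * D) := by
    rw [Real.le_log_iff_exp_le (by linarith)]
    linarith [Real.exp_one_lt_d9]
  have hCb : 1 ≤ C ^ 2 * b := one_le_mul_of_one_le_of_one_le (one_le_pow₀ hC) hb
  have hε0 : 0 < ε := by rw [hε]; positivity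
  have hε1 : ε ≤ 1 := by
    rw [hε, div_le_one (by positivity)]
    nlinarith
  have hfK : ∀ i, ∀ z ∈ S.kube h i, f z = quad (avg W (S.kube h i)) u := fun i z hz => by
    rw [hf]; simp only [stepWeight_of_mem_kube S tree.disjoint_kube hz]
  have ha : ∀ i, 0 ≤ quad (avg W (S.kube h i)) u := fun i =>
    quad_nonneg (posSemidef_avg (fun a b => (hW.integrable a b).mono_set (hKΩ i))
      ((ae_restrict_of_ae_restrict_of_subset (hKΩ i) hW.posDef).mono fun z hz => hz.posSemidef)) u
  have hmass : ∀ J : Set S.Idx, ∫⁻ z in ⋃ j ∈ J, S.kube h j, ENNReal.ofReal (f z) =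
      ENNReal.ofReal (∫ z in ⋃ j ∈ J, S.kube h j, quad (W z) u) :=
    lintegral_step_eq tree hc hW u
  have hint := integrableOn_quad hW.integrable u
  have hnn : ∀ s ⊆ Ω, 0 ≤ᵐ[volume.restrict s] fun z => quad (W z) u := fun s hs => by
    filter_upwards [ae_restrict_of_ae_restrict_of_subset hs hW.posDef] with z hz
    exact quad_nonneg hz.posSemidef u
  have hTmass : ∀ i, ∫⁻ z in S.tent h i, ENNReal.ofReal (f z) =
      ENNReal.ofReal (∫ z in S.tent h i, quad (W z) u) := fun i => by
    -- With nothing removed, the lemma says that a tent is the union of the kubes it contains.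
    have h1 := tree.diff_eq_iUnion_kube i ∅
    rw [biUnion_empty, sdiff_empty] at h1
    have h2 := hmass {j | S.kube h j ⊆ S.tent h i}
    rwa [← h1] at h2
  have hTfin : ∀ i, ∫⁻ z in S.tent h i, ENNReal.ofReal (f z) ≠ ⊤ := fun i => by
    rw [hTmass]; exact ENNReal.ofReal_ne_top
  have hTreal : ∀ i, (∫⁻ z in S.tent h i, ENNReal.ofReal (f z)).toReal =
      ∫ z in S.tent h i, quad (W z) u := fun i => by
    rw [hTmass, ENNReal.toReal_ofReal (integral_nonneg_of_ae (hnn _ (S.tent_subset h i)))]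
  -- The comparison is applied on the larger set `B` and transferred to the tent; the ratio of
  -- volumes enters squared, hence `C ^ 2 * b`.
  have hH : ∀ i, ∀ J : Set S.Idx, (⋃ j ∈ J, S.kube h j) ⊆ S.tent h i →
      volume.real (⋃ j ∈ J, S.kube h j) ^ 2 *
        (∫⁻ z in S.tent h i, ENNReal.ofReal (f z)).toReal ≤
      C ^ 2 * b * (∫⁻ z in ⋃ j ∈ J, S.kube h j, ENNReal.ofReal (f z)).toReal *
        volume.real (S.tent h i) ^ 2 := by
    intro i J hJ
    obtain ⟨B, hBΩ, hTB, hBC, hBb⟩ := hB i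
    have hGΩ := hJ.trans (S.tent_subset h i)
    have hG0 : 0 ≤ ∫ z in ⋃ j ∈ J, S.kube h j, quad (W z) u :=
      integral_nonneg_of_ae (hnn _ hGΩ)
    rw [hTreal, hmass, ENNReal.toReal_ofReal hG0]
    have hBtop : volume B ≠ ⊤ := ne_top_of_le_ne_top hΩ (measure_mono hBΩ)
    have hBpos : 0 < volume.real B :=
      (tree.measureReal_pos i).trans_le (measureReal_mono hTB hBtop)
    have h1 := measure_sq_mul_quad_le (fun a b => (hW.integrable a b).mono_set hBΩ)
      (fun a b => (hW.integrable_inv a b).mono_set hBΩ)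
      (ae_restrict_of_ae_restrict_of_subset hBΩ hW.posDef) (hJ.trans hTB) hBpos.ne' hBtop u
    have h2 : ∫ z in S.tent h i, quad (W z) u ≤ ∫ z in B, quad (W z) u :=
      setIntegral_mono_set (hint.mono_set hBΩ) (hnn _ hBΩ) hTB.eventuallyLE
    have h3 : volume.real B ^ 2 ≤ (C * volume.real (S.tent h i)) ^ 2 :=
      pow_le_pow_left₀ hBpos.le hBC 2
    calc _ ≤ volume.real (⋃ j ∈ J, S.kube h j) ^ 2 * ∫ z in B, quad (W z) u :=
          mul_le_mul_of_nonneg_left h2 (by positivity)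
      _ ≤ _ := h1
      _ ≤ b * (∫ z in ⋃ j ∈ J, S.kube h j, quad (W z) u) * (C * volume.real (S.tent h i)) ^ 2 := by
        gcongr
      _ = _ := by ring
  have hRH := tree.reverse_holder (f := fun z => ENNReal.ofReal (f z)) ha
    (fun i z hz => by simp only [hfK i z hz]) hTfin hc hD hCb hε hH i
  have hTcover : S.tent h i ⊆ ⋃ j, S.kube h j := fun z hz => by
    obtain ⟨j, -, -, hzj⟩ := tree.cover i z hz
    exact mem_iUnion.2 ⟨j, hzj⟩
  have hf0 : ∀ z ∈ S.tent h i, 0 ≤ f z := fun z hz => by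
    obtain ⟨j, hzj⟩ := mem_iUnion.1 (hTcover hz)
    rw [hfK j z hzj]; exact ha j
  have hf0' : 0 ≤ᵐ[volume.restrict (S.tent h i)] f :=
    ae_restrict_of_forall_mem (tree.measurableSet_tent i) hf0
  have hfm : AEMeasurable f (volume.restrict (S.tent h i)) := by
    refine AEMeasurable.mono_measure ?_ (Measure.restrict_mono hTcover le_rfl)
    rw [aemeasurable_iUnion_iff]
    exact fun j => aemeasurable_const.congr
      (ae_restrict_of_forall_mem (tree.measurableSet_kube j) fun z hz => (hfK j z hz).symm)
  have hpow : ∫⁻ z in S.tent h i, ENNReal.ofReal (f z) ^ (1 + ε) =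
      ∫⁻ z in S.tent h i, ENNReal.ofReal (f z ^ (1 + ε)) :=
    setLIntegral_congr_fun (tree.measurableSet_tent i) fun z hz =>
      ENNReal.ofReal_rpow_of_nonneg (hf0 z hz) (by positivity)
  have hpow0 : 0 ≤ᵐ[volume.restrict (S.tent h i)] fun z => f z ^ (1 + ε) := by
    filter_upwards [hf0'] with z hz using Real.rpow_nonneg hz _
  have hpm : AEStronglyMeasurable (fun z => f z ^ (1 + ε)) (volume.restrict (S.tent h i)) :=
    (hfm.pow_const _).aestronglyMeasurable
  rw [hpow] at hRH
  have hTpos := tree.measureReal_pos i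
  set m := (∫⁻ z in S.tent h i, ENNReal.ofReal (f z)).toReal with hm
  have hm0 : 0 ≤ m := ENNReal.toReal_nonneg
  have hfint : ∫ z in S.tent h i, f z = m :=
    integral_eq_lintegral_of_nonneg_ae hf0' hfm.aestronglyMeasurable
  refine ⟨?_, ⟨hpm, ?_⟩, ?_⟩
  · rw [setAverage_eq]
    exact smul_nonneg (by positivity) (integral_nonneg_of_ae hf0')
  · rw [hasFiniteIntegral_iff_ofReal hpow0]
    exact hRH.trans_lt ENNReal.ofReal_lt_top
  · have hp : ∫ z in S.tent h i, f z ^ (1 + ε) ≤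
        2 * (2 / c) ^ ε * ((m / volume.real (S.tent h i)) ^ ε * m) := by
      rw [integral_eq_lintegral_of_nonneg_ae hpow0 hpm]
      exact ENNReal.toReal_le_of_le_ofReal (by positivity) hRH
    have h2c : 1 ≤ 2 / c := by rw [le_div_iff₀ hc]; linarith
    have hY1 : 1 ≤ (2 / c) ^ ε := Real.one_le_rpow h2c hε0.le
    -- Since `ε ≤ 1`, the final constant `4 / c` does not depend on the weight.
    have hY2 : (2 / c) ^ ε ≤ 2 / c := by
      conv_rhs => rw [← Real.rpow_one (2 / c)]
      exact Real.rpow_le_rpow_of_exponent_le h2c hε1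
    rw [setAverage_eq, setAverage_eq, hfint, smul_eq_mul, smul_eq_mul, inv_mul_eq_div _ m]
    refine rpow_average_arith (Y := 2 * (2 / c) ^ ε) hε0
      (mul_nonneg (by positivity) (integral_nonneg_of_ae hpow0)) (by positivity) (by linarith)
      (by linarith [show 4 / c = 2 * (2 / c) by ring]) ?_
    rw [inv_mul_le_iff₀ hTpos]
    refine hp.trans_eq ?_
    field_simp

end BekolleBonami

/-! ### Uniform constants and the conclusion -/

namespace BekolleBonami

variable {n d : ℕ} {Ω : Set (Cn n)} {ρ : Cn n → ℝ} {qd : Cn n → Cn n → ℝ}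
  {W : Cn n → Matrix (Fin d) (Fin d) ℂ}

lemma norm_sq_le_B2_toReal {𝓢 : Set (Set (Cn n))} (hB2 : B2 𝓢 W ≠ ⊤) {B : Set (Cn n)}
    (hB : B ∈ 𝓢) :
    ‖CFC.sqrt (avg W B) * CFC.sqrt (avg (fun z => (W z)⁻¹) B)‖ ^ 2 ≤ (B2 𝓢 W).toReal := by
  have h : ENNReal.ofReal (‖CFC.sqrt (avg W B) * CFC.sqrt (avg (fun z => (W z)⁻¹) B)‖ ^ 2) ≤
      B2 𝓢 W := by
    rw [B2]
    exact le_iSup₂ (f := fun (B : Set (Cn n)) (_ : B ∈ 𝓢) => ENNReal.ofReal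
      (‖CFC.sqrt (avg W B) * CFC.sqrt (avg (fun z => (W z)⁻¹) B)‖ ^ 2)) B hB
  exact (ENNReal.ofReal_le_iff_le_toReal hB2).1 h

/-- A finite family of reals has a common upper bound that is at least a given number. -/
lemma exists_common_bound {ι : Type*} [Finite ι] (f : ι → ℝ) (a : ℝ) :
    ∃ M, a ≤ M ∧ ∀ i, f i ≤ M := by
  obtain ⟨M, hM⟩ := (Set.finite_range f).bddAbove
  exact ⟨max a M, le_max_left _ _, fun i => (hM ⟨i, rfl⟩).trans (le_max_right _ _)⟩

end BekolleBonami

open BekolleBonami in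
theorem lemma4p3 {n d : ℕ} [NeZero n] [NeZero d] {Ω : Set (Cn n)} {ρ : Cn n → ℝ}
    (hΩ : IsSmoothBoundedDomain Ω ρ) (P : PolydiscSystem Ω ρ) {qd : Cn n → Cn n → ℝ}
    (hqd : IsBoundaryQuasiMetric P qd) :
    ∃ ε₁ : ℝ, 0 < ε₁ ∧ ∀ ε₀ : ℝ, 0 < ε₀ → ε₀ ≤ ε₁ →
      ∀ (N : ℕ) (𝒬 : Fin N → DyadicSystem Ω qd) (h : Fin N → ℝ),
        (∀ l, 0 < h l ∧ h l < ε₀) →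
        ∃ C : ℝ, 0 < C ∧
          ∀ 𝓢 : Set (Set (Cn n)), (𝓢 = ballTents Ω qd ε₀ ∨ 𝓢 = dyadicTents 𝒬 h) →
          ∀ W : Cn n → Matrix (Fin d) (Fin d) ℂ, IsMatrixWeight Ω W → B2 𝓢 W ≠ ⊤ →
            ∃ r : ℝ, 1 < r ∧
              C⁻¹ * ((B2 𝓢 W).toReal)⁻¹ ≤ r - 1 ∧ r - 1 ≤ C * ((B2 𝓢 W).toReal)⁻¹ ∧
              ∀ (l : Fin N) (i : (𝒬 l).Idx) (v : EuclideanSpace ℂ (Fin d)), ‖v‖ = 1 →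
                IntegrableOn (fun z => scalarStepWeight (𝒬 l) (h l) W i v z ^ r)
                  ((𝒬 l).tent (h l) i) ∧
                (⨍ z in (𝒬 l).tent (h l) i, scalarStepWeight (𝒬 l) (h l) W i v z ^ r) ^ (1 / r) ≤
                  C * ⨍ z in (𝒬 l).tent (h l) i, scalarStepWeight (𝒬 l) (h l) W i v z := by
  obtain ⟨ν, K, ε, hν⟩ := hΩ.exists_isNormalField
  obtain ⟨L, A, a, δ, hP⟩ := hqd.exists_polydiscBounds
  have hd : IsDoublingTents Ω qd :=
    ⟨fun t ht => hP.exists_pos_le_measure hΩ hν ht, fun lam hlam => hP.exists_doubling hΩ hν hlam⟩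
  obtain ⟨z₀, hz₀⟩ := hΩ.connected.nonempty
  have hd₀ : 0 < Metric.infDist z₀ (frontier Ω) := by
    rw [← hΩ.dist_proj]; exact hΩ.dist_proj_pos hz₀
  have hΩ0 : volume Ω ≠ 0 := (hΩ.isOpen.measure_pos volume hΩ.connected.nonempty).ne'
  have hεpos := hν.pos
  -- The first bound keeps all tents where the projection is well behaved; the second leaves an open
  -- piece of `Ω` about `z₀` in every root kube.
  refine ⟨min ε (Metric.infDist z₀ (frontier Ω)), by positivity, fun ε₀ hε₀ hε₀₁ N 𝒬 h hh => ?_⟩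
  have hhε : ∀ l, h l ≤ ε := fun l => (hh l).2.le.trans (hε₀₁.trans (min_le_left _ _))
  have hroot : ∀ l, ∃ z ∈ Ω, h l < Metric.infDist z (frontier Ω) := fun l =>
    ⟨z₀, hz₀, (hh l).2.trans_le (hε₀₁.trans (min_le_right _ _))⟩
  choose c D hc hD tree using fun l =>
    (𝒬 l).exists_tentTree hΩ hqd hd hν (hh l).1 (hhε l) (hroot l)
  choose M hM hball using fun l => (𝒬 l).exists_ballTent hΩ hd (hh l).1 hε₀
  have hcount : ∀ l, Countable (𝒬 l).Idx := fun l =>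
    (𝒬 l).countable_index hΩ hd hν (hh l).1 (hhε l)
  obtain ⟨γ, hγ1, hγ⟩ := exists_common_bound (fun l => (c l)⁻¹) 1
  obtain ⟨D', hD2, hD'⟩ := exists_common_bound D 2
  obtain ⟨M', hM1, hM'⟩ := exists_common_bound M 1
  have hγ0 : 0 < γ := by linarith
  have hlog : 0 < Real.log (2 * D') := Real.log_pos (by linarith)
  -- The exponent of `reverse_holder` is `κ / b`, with `κ` depending only on the geometry. Of the
  -- summands of `C`, `κ` and `κ⁻¹` serve the two bounds on `r - 1`, and `4 * γ` the reverse Hölder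
  -- constant.
  set κ := 1 / (16 * M' ^ 2 * Real.log (2 * D')) with hκ
  have hκ0 : 0 < κ := by positivity
  have hCpos : 0 < κ + κ⁻¹ + 4 * γ := by positivity
  refine ⟨κ + κ⁻¹ + 4 * γ, hCpos, fun 𝓢 h𝓢 W hW hB2 => ?_⟩
  have hΩ𝓢 : Ω ∈ 𝓢 := by
    rcases h𝓢 with rfl | rfl <;> exact Or.inr rfl
  set b := (B2 𝓢 W).toReal with hb
  -- Both families contain `Ω`, whose `A₂` quantity is at least one.
  have hb1 : 1 ≤ b :=
    (hW.one_le_norm_sq hΩ0 hΩ.measure_ne_top).trans (norm_sq_le_B2_toReal hB2 hΩ𝓢)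
  have hb0 : 0 < b := by linarith
  have hκb : κ * b⁻¹ = 1 / (16 * (M' ^ 2 * b) * Real.log (2 * D')) := by
    rw [hκ]; field_simp
  refine ⟨1 + κ * b⁻¹, by have : 0 < κ * b⁻¹ := by positivity
                          linarith, ?_, ?_, fun l i v _ => ?_⟩
  · rw [add_sub_cancel_left]
    refine mul_le_mul_of_nonneg_right ?_ (by positivity)
    rw [inv_le_comm₀ hCpos hκ0]
    linarith
  · rw [add_sub_cancel_left]
    refine mul_le_mul_of_nonneg_right ?_ (by positivity)
    have : 0 < κ⁻¹ := by positivity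
    linarith
  · have := hcount l
    have hcγ : γ⁻¹ ≤ c l := inv_le_of_inv_le₀ (hc l) (hγ l)
    have hB : ∀ i : (𝒬 l).Idx, ∃ B ⊆ Ω, (𝒬 l).tent (h l) i ⊆ B ∧
        volume.real B ≤ M' * volume.real ((𝒬 l).tent (h l) i) ∧
        ‖CFC.sqrt (avg W B) * CFC.sqrt (avg (fun z => (W z)⁻¹) B)‖ ^ 2 ≤ b := by
      intro i
      have hpos : 0 ≤ volume.real ((𝒬 l).tent (h l) i) := measureReal_nonneg
      -- For ball tents each dyadic tent is enlarged to a comparable member of the family; for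
      -- dyadic tents it is a member itself.
      rcases h𝓢 with rfl | rfl
      · obtain ⟨B, hB, hBΩ, hTB, hBM⟩ := hball l i
        exact ⟨B, hBΩ, hTB, hBM.trans (mul_le_mul_of_nonneg_right (hM' l) hpos),
          norm_sq_le_B2_toReal hB2 hB⟩
      · exact ⟨_, (𝒬 l).tent_subset (h l) i, Subset.rfl, le_mul_of_one_le_left hpos hM1,
          norm_sq_le_B2_toReal hB2 (Or.inl ⟨l, i, rfl⟩)⟩
    obtain ⟨h0, h1, h2⟩ := scalarStepWeight_reverse_holder ((tree l).mono hcγ (hD' l))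
      (inv_pos.2 hγ0) (inv_le_one_of_one_le₀ hγ1) hD2 hΩ.measure_ne_top hW hM1 hb1 hB hκb i v
    refine ⟨h1, h2.trans ?_⟩
    rw [div_inv_eq_mul]
    refine mul_le_mul_of_nonneg_right ?_ h0
    have : 0 < κ⁻¹ := by positivity
    linarith
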